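/- **SLOCAL model.** Networks are finite simple graphs with input labels on nodes and half-edges (a half-edge is a pair of a node and an incident edge); on $n$ nodes, the nodes have unique identifiers from $\{1,\dots,n^c\}$, where $c\ge 1$ is a fixed constant. A deterministic SLOCAL algorithm of locality $T(n)$ processes the nodes one by one in an adversarial order. When $v$ is processed, it sees $n$, and the subgraph induced by the nodes at distance at most $T(n)$ from $v$, with identifiers, input labels (including the labels of all half-edges of these nodes) and current states; the new state of $v$, which contains its output, is an arbitrary function of this. A problem has SLOCAL complexity at most $T(n)$ if some such algorithm produces a valid output on every instance, for all identifiers and all orders. **Linearizable problems.** Such a problem $P=(\Sigma,(F,L,R),B)$ of rank $\Delta$ consists of a finite label set $\Sigma$, sets $F,L\subseteq\Sigma$ and $R\subseteq\Sigma\times\Sigma$, and a finite set $B$ of multisets over $\Sigma$. Its instances are the finite bipartite graphs, possibly with parallel edges, with white and black nodes, in which black nodes have degree at most $\Delta$ and the incident edges of each white node are ordered. Every node knows its colour and adjacent nodes know the positions of the edges joining them. Every white node outputs a label in $\Sigma$ for each incident edge. If $\ell_1,\dots,\ell_d$ with $d\ge1$ are the labels of the edges of a white node in their order, then $\ell_1\in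 F$, $\ell_d\in L$ and $(\ell_i,\ell_{i+1})\in R$ for $1\le i<d$; the multiset of labels at every non-isolated black node is in $B$. **The graph family $\mathcal G$.** A *tree-like gadget* of height $h\geq 1$ has the nodes $(l,k)$ with $0\le l<h$, $0\le k<2^l$, with edges between $(l,k)$ and $(l,k+1)$ and between $(l,k)$ and its children $(l+1,2k)$, $(l+1,2k+1)$. An *octopus gadget* consists of a tree-like head-gadget and, for each leaf of it, one or two tree-like port-gadgets, whose roots are joined to this leaf. A *proper instance* consists of disjoint octopus gadgets and pairwise non-adjacent inter-octopus nodes of degree at most $\Delta$, where the left-most leaf of each port-gadget is adjacent to exactly one inter-octopus node, and there are no other edges. The input labels say for each node whether it is a head, port or inter-octopus node, and for each half-edge whether it leads to the left or right neighbour in the layer, the parent, the left or right child, the first or second port-gadget, the head-gadget, the inter-octopus node, or the port-gadget. The following constraints at a node $u$ check locally that a graph is a so-labelled proper instance, and $\mathcal G$ is the family of labelled graphs that satisfy them at all nodes: - the two labels of each edge at $u$ match each other and the kinds of its endpoints (left/right, parent/child inside one kind; port/head between head and port nodes; to-inter/to-port between port and inter-octopus nodes); - if $u$ is not an inter-octopus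 node, its half-edge labels are distinct; if it is one, its degree is at most $\Delta$; - $u$ has a left child iff it has a right child, and the right child is then the right neighbour of the left child; if $u$ has a right neighbour $v$, then $u$ has children iff $v$ has, and the left child of $v$ is then the right neighbour of the right child of $u$; - if $u$ has no parent, it has no left and no right neighbour; if $u$ is the left (right) child of $p$, then $u$ has a left (right) neighbour iff $p$ has; - a head node has a first port-gadget iff it has no children, and a second one only if it has no children; a port node has a half-edge to the head-gadget iff it has no parent, and a half-edge to an inter-octopus node iff it has neither children nor a left neighbour. **The problem $\mathrm{lift}(P)$.** Its inputs are all finite simple graphs with input labels as above. Each node is either marked with one of error, up, down, or is unmarked and outputs $\bot$ or a label in $\Sigma$. The output is valid if the following holds. - An error node violates the constraints in the input graph. A node marked up has a marked node above it, along a half-edge to the parent or to the head-gadget. A node marked down has below it, along a half-edge to a child, to a port-gadget or to an inter-octopus node, a node marked error or down. An unmarked node satisfies the constraints in the subgraph induced by the unmarked nodes (so this subgraph is in $\mathcal G$). - In the subgraph induced by the unmarked nodes: exactly the nodes of port-gadgets output a label in $\Sigma$, and all nodes of the same port-gadget output the same one; the labels $\ell_1,\dots,\ell_d$ of the port-gadgets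 of an octopus gadget, from left to right, satisfy $\ell_1\in F$, $\ell_d\in L$ and $(\ell_i,\ell_{i+1})\in R$ for $1\le i<d$; the multiset of the labels of the port-gadgets adjacent to a non-isolated inter-octopus node is in $B$. **Lemma.** Let $P$ be a linearizable problem and $T:\mathbb N\to\mathbb N$ with $T(n)\ge1$ for all $n$. If $P$ has SLOCAL complexity at most $T(n)$ on its instances, which may have parallel edges, then $\mathrm{lift}(P)$ has SLOCAL complexity $O(T(n)\log n)$. -/

import Mathlib

open Filter Asymptotics

/-! ### Labelled graphs -/

/-- A finite simple graph in which every node `v` carries a label `node v` and every half-edge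
`(v, {v, u})` carries a label `half v u` (the value is meaningful only if `v` and `u` are
adjacent). -/
structure LabeledGraph (X E : Type) where
  V : Type
  [fintypeV : Fintype V]
  graph : SimpleGraph V
  node : V → X
  half : V → V → E

attribute [instance] LabeledGraph.fintypeV

namespace LabeledGraph

variable {X E : Type}

/-- The set of neighbours of `u`. -/
noncomputable def nbrs (G : LabeledGraph X E) (u : G.V) : Finset G.V :=
  open Classical in Finset.univ.filter fun v => G.graph.Adj u v

/-- `v` is reached from `u` through a half-edge of `u` that is labelled `a`. -/
def Step (G : LabeledGraph X E) (a : E) (u v : G.V) : Prop :=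
  G.graph.Adj u v ∧ G.half u v = a

/-- Some half-edge of `u` is labelled `a`. -/
def Has (G : LabeledGraph X E) (a : E) (u : G.V) : Prop :=
  ∃ v, G.Step a u v

/-- The subgraph induced by `S`; the nodes outside `S` are kept as isolated nodes, so that the node
type does not change. -/
def keep (G : LabeledGraph X E) (S : Set G.V) : LabeledGraph X E where
  V := G.V
  graph :=
    { Adj := fun u v => G.graph.Adj u v ∧ u ∈ S ∧ v ∈ S
      symm := ⟨fun _ _ h => ⟨h.1.symm, h.2.2, h.2.1⟩⟩
      loopless := ⟨fun _ h => h.1.ne rfl⟩ }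
  node := G.node
  half := G.half

end LabeledGraph

/-! ### The SLOCAL model -/

/-- What a node sees when it queries its radius-`T` neighbourhood. Nodes are named by their
identifiers. `n` is the number of nodes of the network and `center` the identifier of the querying
node. For every node of the neighbourhood, `info` gives its input label, the labels of all its
half-edges and its current state (`none` for a node that has not been processed yet); for every
edge between two nodes of the neighbourhood, `edge` gives the labels of its two half-edges. -/
structure View (X E S : Type) where
  n : ℕ
  center : ℕ
  info : ℕ → Option (X × Multiset E × Option S)
  edge : ℕ → ℕ → Option E

/-- The radius-`T` view of `v` when the current states of the nodes are given by `σ`. -/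
noncomputable def LabeledGraph.view {X E S : Type} (G : LabeledGraph X E) (ident : G.V → ℕ)
    (T : ℕ) (σ : G.V → Option S) (v : G.V) : View X E S :=
  open Classical in
  { n := Fintype.card G.V
    center := ident v
    info := fun i =>
      if h : ∃ u, ident u = i ∧ G.graph.edist v u ≤ T then
        some (G.node h.choose, (G.nbrs h.choose).val.map (G.half h.choose), σ h.choose)
      else none
    edge := fun i j =>
      if h : ∃ p : G.V × G.V, ident p.1 = i ∧ ident p.2 = j ∧ G.graph.edist v p.1 ≤ T ∧
          G.graph.edist v p.2 ≤ T ∧ G.graph.Adj p.1 p.2 then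
        some (G.half h.choose.1 h.choose.2)
      else none }

/-- A deterministic SLOCAL algorithm: an arbitrary function that maps the view of the processed node
to the new state of this node. The output of the node is a part of its state. -/
structure SLOCALAlgorithm (X E Y : Type) where
  State : Type
  step : View X E State → State
  output : State → Y

/-- The states after the nodes of the list `order` have been processed one after the other, each of
them with a query of radius `T`. -/
noncomputable def SLOCALAlgorithm.run {X E Y : Type} (A : SLOCALAlgorithm X E Y)
    (G : LabeledGraph X E) (ident : G.V → ℕ) (T : ℕ) (order : List G.V) : G.V → Option A.State :=
  open Classical in
  order.foldl (fun σ v => Function.update σ v (some (A.step (G.view ident T σ v)))) fun _ => none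

/-- A distributed problem: a class of instances, the network of each instance with its input labels,
and the valid outputs. -/
structure DistributedProblem (X E Y : Type) where
  Inst : Type 1
  net : Inst → LabeledGraph X E
  Valid : (I : Inst) → ((net I).V → Y) → Prop

/-- Unique identifiers from `{1, …, n ^ c}`, where `n` is the number of nodes. -/
def IsIdentifierAssignment {V : Type} [Fintype V] (c : ℕ) (ident : V → ℕ) : Prop :=
  Function.Injective ident ∧ ∀ v, 1 ≤ ident v ∧ ident v ≤ Fintype.card V ^ c

/-- `T` is an upper bound on the SLOCAL complexity of the problem `Q`: some SLOCAL algorithm that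
queries radius `T n` on networks with `n` nodes produces a valid output on every instance, for all
identifiers from `{1, …, n ^ c}` and every processing order. -/
def SolvableInSLOCAL {X E Y : Type} (c : ℕ) (Q : DistributedProblem X E Y) (T : ℕ → ℕ) : Prop :=
  ∃ A : SLOCALAlgorithm X E Y, ∀ (I : Q.Inst) (ident : (Q.net I).V → ℕ),
    IsIdentifierAssignment c ident →
    ∀ order : List (Q.net I).V, order.Nodup → (∀ v, v ∈ order) →
      ∃ y : (Q.net I).V → Y,
        (∀ v, (A.run (Q.net I) ident (T (Fintype.card (Q.net I).V)) order v).map A.output =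
          some (y v)) ∧
        Q.Valid I y

/-! ### Linearizable problems -/

/-- A linearizable problem with the finite label set `Γ`, on hypergraphs of rank at most `rank`. -/
structure LinearizableProblem (Γ : Type) where
  first : Finset Γ
  last : Finset Γ
  pairs : Finset (Γ × Γ)
  black : Finset (Multiset Γ)
  rank : ℕ

/-- A bipartite multigraph, possibly with parallel edges, with white nodes `W` and black nodes `B`:
the incident edges of each white node `w` are ordered, and the `i`-th of its `deg w` incident edges
leads to the black node `nbr w i`. -/
structure IncidenceMultigraph where
  W : Type
  B : Type
  [fintypeW : Fintype W]
  [fintypeB : Fintype B]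
  deg : W → ℕ
  nbr : (w : W) → Fin (deg w) → B

attribute [instance] IncidenceMultigraph.fintypeW IncidenceMultigraph.fintypeB

inductive Color
  | white
  | black

namespace IncidenceMultigraph

/-- The edges, named by their white endpoint and their position there, that are incident to the
black node `b`. -/
noncomputable def edgesAt (M : IncidenceMultigraph) (b : M.B) : Finset (Σ w : M.W, Fin (M.deg w)) :=
  open Classical in Finset.univ.filter fun e => M.nbr e.1 e.2 = b

/-- The positions, in the ordering of the edges of the white node `w`, of the parallel edges that
join `w` and `b`. -/
noncomputable def positions (M : IncidenceMultigraph) (w : M.W) (b : M.B) : Finset ℕ :=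
  open Classical in (Finset.univ.filter fun i => M.nbr w i = b).map Fin.valEmbedding

/-- The multigraph as a network: all nodes, white and black, compute; every node knows its colour,
and two adjacent nodes know the positions of the edges that join them. -/
noncomputable def net (M : IncidenceMultigraph) : LabeledGraph Color (Finset ℕ) where
  V := M.W ⊕ M.B
  graph := SimpleGraph.fromRel fun x y => ∃ w i, x = Sum.inl w ∧ y = Sum.inr (M.nbr w i)
  node := Sum.elim (fun _ => Color.white) (fun _ => Color.black)
  half := fun x y =>
    match x, y with
    | Sum.inl w, Sum.inr b => M.positions w b
    | Sum.inr b, Sum.inl w => M.positions w b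
    | _, _ => ∅

end IncidenceMultigraph

namespace LinearizableProblem

variable {Γ : Type}

/-- The white constraint for a node whose `d` incident edges are labelled `ℓ 0, …, ℓ (d - 1)`. -/
def WhiteOk (P : LinearizableProblem Γ) (d : ℕ) (ℓ : ℕ → Γ) : Prop :=
  (0 < d → ℓ 0 ∈ P.first ∧ ℓ (d - 1) ∈ P.last) ∧ ∀ i, i + 1 < d → (ℓ i, ℓ (i + 1)) ∈ P.pairs

/-- The black constraint; a node without incident edges carries no constraint. -/
def BlackOk (P : LinearizableProblem Γ) (m : Multiset Γ) : Prop :=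
  m ≠ 0 → m ∈ P.black

/-- The linearizable problem as a distributed problem, on all bipartite multigraphs whose black
nodes have degree at most the rank. A white node `w` outputs the labels of its incident edges: the
`i`-th one is labelled `y w i`. The outputs of the black nodes are ignored. -/
noncomputable def problem (P : LinearizableProblem Γ) :
    DistributedProblem Color (Finset ℕ) (ℕ → Γ) where
  Inst := {M : IncidenceMultigraph // ∀ b, (M.edgesAt b).card ≤ P.rank}
  net := fun M => M.1.net
  Valid := fun M y =>
    (∀ w : M.1.W, P.WhiteOk (M.1.deg w) (y (Sum.inl w))) ∧
    ∀ b : M.1.B, P.BlackOk ((M.1.edgesAt b).val.map fun e => y (Sum.inl e.1) e.2)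

end LinearizableProblem

/-! ### Proper instances and their local constraints -/

/-- The input labels of nodes: a node of a head-gadget, a node of a port-gadget, or an inter-octopus
node. -/
inductive NodeKind
  | head
  | port
  | inter

/-- The input labels of half-edges. The first five describe a tree-like gadget: the half-edge leads
to the left or right neighbour in the same layer, to the parent, or to the left or right child.
From a leaf of a head-gadget, `port1` and `port2` lead to the roots of the port-gadgets attached to
it, and `toHead` leads back. From the left-most leaf of a port-gadget, `toInter` leads to an
inter-octopus node, and `toPort` leads back. -/
inductive HalfEdgeLabel
  | left
  | right
  | parent
  | leftChild
  | rightChild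
  | port1
  | port2
  | toHead
  | toInter
  | toPort

/-- `EdgeOk k a b k'`: an edge may join a node of kind `k`, with label `a` at its half-edge, to a
node of kind `k'`, with label `b` at its half-edge. -/
inductive EdgeOk : NodeKind → HalfEdgeLabel → HalfEdgeLabel → NodeKind → Prop
  | right (k : NodeKind) (hk : k ≠ .inter) : EdgeOk k .right .left k
  | leftChild (k : NodeKind) (hk : k ≠ .inter) : EdgeOk k .leftChild .parent k
  | rightChild (k : NodeKind) (hk : k ≠ .inter) : EdgeOk k .rightChild .parent k
  | port1 : EdgeOk .head .port1 .toHead .port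
  | port2 : EdgeOk .head .port2 .toHead .port
  | toInter : EdgeOk .port .toInter .toPort .inter
  | symm {k k' : NodeKind} {a b : HalfEdgeLabel} (h : EdgeOk k a b k') : EdgeOk k' b a k

/-- Graphs with the input labels of the lifted problem. -/
abbrev GadgetGraph := LabeledGraph NodeKind HalfEdgeLabel

namespace GadgetGraph

open HalfEdgeLabel

/-- The local constraint at `u`. It inspects only the radius-`2` neighbourhood of `u`. The graphs
that satisfy it at all nodes are the labelled proper instances: disjoint octopus gadgets, in which
the left-most leaf of each port-gadget is adjacent to exactly one inter-octopus node, where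
inter-octopus nodes are pairwise non-adjacent and have degree at most `rank`. -/
structure Constraint (G : GadgetGraph) (rank : ℕ) (u : G.V) : Prop where
  edge_ok : ∀ v, G.graph.Adj u v → EdgeOk (G.node u) (G.half u v) (G.half v u) (G.node v)
  distinct : G.node u ≠ .inter →
    ∀ v w, G.graph.Adj u v → G.graph.Adj u w → G.half u v = G.half u w → v = w
  inter_degree : G.node u = .inter → (G.nbrs u).card ≤ rank
  -- both children or none, and the two children are consecutive in their layer
  children_iff : G.Has leftChild u ↔ G.Has rightChild u
  siblings : ∀ v w, G.Step leftChild u v → G.Step rightChild u w → G.Step right v w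
  -- consecutive nodes of a layer: both are leaves or none, and their children are consecutive
  layer_iff : ∀ v, G.Step right u v → (G.Has leftChild u ↔ G.Has leftChild v)
  cousins : ∀ v a b, G.Step right u v → G.Step rightChild u a → G.Step leftChild v b →
    G.Step right a b
  -- the layer of the root consists of the root, and layers end where the layer above ends
  root_alone : ¬ G.Has parent u → ¬ G.Has left u ∧ ¬ G.Has right u
  left_end : ∀ p, G.Step leftChild p u → (G.Has left u ↔ G.Has left p)
  right_end : ∀ p, G.Step rightChild p u → (G.Has right u ↔ G.Has right p)
  -- head-gadgets: one or two port-gadgets at each leaf, none elsewhere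
  head_port1 : G.node u = .head → (G.Has port1 u ↔ ¬ G.Has leftChild u)
  head_port2 : G.node u = .head → G.Has port2 u → ¬ G.Has leftChild u
  -- port-gadgets: exactly the root is attached to a head-gadget, and exactly the left-most leaf
  -- is attached to an inter-octopus node
  port_root : G.node u = .port → (G.Has toHead u ↔ ¬ G.Has parent u)
  port_leaf : G.node u = .port → (G.Has toInter u ↔ ¬ G.Has leftChild u ∧ ¬ G.Has left u)

/-- The family of labelled graphs that satisfy the local constraints at all nodes. -/
def InFamily (G : GadgetGraph) (rank : ℕ) : Prop :=
  ∀ u, Constraint G rank u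

/-- From a node of a gadget to its parent, or from the root of a port-gadget to the head-gadget. -/
def StepUp (G : GadgetGraph) (u v : G.V) : Prop :=
  G.Step parent u v ∨ G.Step toHead u v

/-- From a node of a gadget to one of its children, from a leaf of a head-gadget to the root of an
attached port-gadget, or from a port-gadget to the attached inter-octopus node. -/
def StepDown (G : GadgetGraph) (u v : G.V) : Prop :=
  G.Step leftChild u v ∨ G.Step rightChild u v ∨ G.Step port1 u v ∨ G.Step port2 u v ∨
    G.Step toInter u v

/-- `v` is the root of the right-most port-gadget attached to the head-gadget leaf `u`. -/
def LastPort (G : GadgetGraph) (u v : G.V) : Prop :=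
  G.Step port2 u v ∨ (¬ G.Has port2 u ∧ G.Step port1 u v)

end GadgetGraph

/-! ### The lifted problem -/

/-- The output labels: a node is marked, either as an error or with a pointer up or down that leads
to an error, or it is unmarked and outputs `⊥` (written `none`) or a label of the linearizable
problem. -/
inductive LiftOutput (Γ : Type)
  | error
  | up
  | down
  | unmarked (o : Option Γ)

namespace LiftOutput

variable {Γ : Type}

def IsUnmarked (y : LiftOutput Γ) : Prop :=
  ∃ o, y = unmarked o

def label : LiftOutput Γ → Option Γ
  | unmarked o => o
  | _ => none

end LiftOutput

namespace GadgetGraph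

variable {Γ : Type}

open HalfEdgeLabel

/-- The local rule, at `u`, of the problem that marks the nodes that are not in a proper instance:
an error node violates the local constraint; a node with an up-pointer has a marked node above it;
a node with a down-pointer has below it a node that is an error or has a down-pointer; an unmarked
node satisfies the local constraint in the subgraph induced by the unmarked nodes. -/
def BadGraphRule (G : GadgetGraph) (rank : ℕ) (y : G.V → LiftOutput Γ) (u : G.V) : Prop :=
  match y u with
  | .error => ¬ Constraint G rank u
  | .up => ∃ v, StepUp G u v ∧ ¬ (y v).IsUnmarked
  | .down => ∃ v, StepDown G u v ∧ (y v = .error ∨ y v = .down)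
  | .unmarked _ => Constraint (G.keep {v | (y v).IsUnmarked}) rank u

/-- The local rule, at `u`, of the promise problem with respect to the node labels `ℓ`. -/
structure PromiseRule (G : GadgetGraph) (P : LinearizableProblem Γ) (ℓ : G.V → Option Γ)
    (u : G.V) : Prop where
  port_iff : (ℓ u).isSome ↔ G.node u = .port
  same_port : ∀ v, G.graph.Adj u v → G.node u = .port → G.node v = .port → ℓ u = ℓ v
  -- the port-gadgets of an octopus gadget in their left-to-right order
  first : ∀ v a, G.node u = .head → ¬ G.Has left u → G.Step port1 u v → ℓ v = some a →
    a ∈ P.first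
  last : ∀ v a, G.node u = .head → ¬ G.Has right u → LastPort G u v → ℓ v = some a →
    a ∈ P.last
  pair_same_leaf : ∀ v w a b, G.Step port1 u v → G.Step port2 u w → ℓ v = some a →
    ℓ w = some b → (a, b) ∈ P.pairs
  pair_next_leaf : ∀ u' v w a b, G.Step right u u' → LastPort G u v → G.Step port1 u' w →
    ℓ v = some a → ℓ w = some b → (a, b) ∈ P.pairs
  black : G.node u = .inter → P.BlackOk ((G.nbrs u).val.filterMap ℓ)

end GadgetGraph

/-- The lifted problem, on all finite graphs with the input labels above: solve the marking problem,
and solve the promise problem on the subgraph induced by the unmarked nodes. -/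
def lift {Γ : Type} (P : LinearizableProblem Γ) :
    DistributedProblem NodeKind HalfEdgeLabel (LiftOutput Γ) where
  Inst := GadgetGraph
  net := fun G => G
  Valid := fun G y => ∀ u, GadgetGraph.BadGraphRule G P.rank y u ∧
    ((y u).IsUnmarked →
      GadgetGraph.PromiseRule (G.keep {v | (y v).IsUnmarked}) P (fun v => (y v).label) u)

/-! The algorithm marks every node that can be blamed on a violated constraint, and on the unmarked
rest it simulates the given algorithm for `P` on a virtual multigraph with one white node per
octopus gadget.

Marking. A node is marked if some path that goes up and then down leads to a node that violates its
constraint. Below a node whose descendants satisfy their constraints, every nonempty layer `l` is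
full, so it contains `2 ^ l` distinct nodes and `l` is less than `height G`, which is logarithmic in
the number of nodes. A downward path crosses at most a head-gadget and a port-gadget before it meets
an error or stops at an inter-octopus node. Hence searches of length `depth G` already find
everything (`Down.bound`, `Up.bound`), and the marked set is both locally computable and closed
under the relevant steps. Consequently an unmarked node that is not an inter-octopus node has only
unmarked neighbours (`not_marked_of_adj`): unmarked octopus gadgets survive in full, and an
inter-octopus node can only lose neighbours, which its constraint tolerates.

Virtual multigraph. The root of an unmarked head-gadget stands for its octopus gadget, and its edges
are the port-gadgets from left to right, each leading to the inter-octopus node at its left-most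
leaf. Two port-gadgets of one octopus gadget may reach the same inter-octopus node, which is where
parallel edges arise. All other nodes that are not inter-octopus nodes become isolated white nodes,
so the number of nodes and the identifiers carry over unchanged.

Simulation. The first processed node of an octopus gadget performs the virtual step of that gadget;
its state stores the result, which every later node of the gadget finds and copies. The virtual
order is thus the order of first visits (`simulation`). One virtual step spans at most `span G` real
steps, a logarithmic number, so a radius of `span G * (T n + 3)` suffices.

Locality. That all these notions depend only on the view is shown with back-and-forth systems. Equal
views give such a system between two networks, each notion is transported along it at the cost of
some radius, and the virtual networks inherit a system that makes the virtual views equal. The new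
state may therefore be computed from any configuration that has the observed view
(`Configuration.next_eq`). -/

/-- The constraint that the label at one half of an edge imposes on the rest of the edge. -/
def EdgeTable (k : NodeKind) (a b : HalfEdgeLabel) (k' : NodeKind) : Prop :=
  match a with
  | .right => b = .left ∧ k' = k ∧ k ≠ .inter
  | .left => b = .right ∧ k' = k ∧ k ≠ .inter
  | .parent => (b = .leftChild ∨ b = .rightChild) ∧ k' = k ∧ k ≠ .inter
  | .leftChild => b = .parent ∧ k' = k ∧ k ≠ .inter
  | .rightChild => b = .parent ∧ k' = k ∧ k ≠ .inter
  | .port1 => b = .toHead ∧ k = .head ∧ k' = .port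
  | .port2 => b = .toHead ∧ k = .head ∧ k' = .port
  | .toHead => (b = .port1 ∨ b = .port2) ∧ k = .port ∧ k' = .head
  | .toInter => b = .toPort ∧ k = .port ∧ k' = .inter
  | .toPort => b = .toInter ∧ k = .inter ∧ k' = .port

/-- Both directions are proved together because the rule `symm` exchanges them in the induction. -/
theorem EdgeOk.table_and {k k' : NodeKind} {a b : HalfEdgeLabel} (h : EdgeOk k a b k') :
    EdgeTable k a b k' ∧ EdgeTable k' b a k := by
  induction h with
  | symm _ ih => exact ih.symm
  | _ => simp_all [EdgeTable]

/-! ### Consistent edges and their reversals -/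

namespace GadgetGraph

open HalfEdgeLabel

variable {G : GadgetGraph} {rank : ℕ} {u v w : G.V}

/-- The labels of the edge from `u` to `v` are consistent with each other and with the kinds of the
endpoints. -/
def EdgeGood (G : GadgetGraph) (u v : G.V) : Prop :=
  EdgeOk (G.node u) (G.half u v) (G.half v u) (G.node v)

theorem Constraint.good (h : Constraint G rank u) (ha : G.graph.Adj u v) : EdgeGood G u v :=
  h.edge_ok v ha

/-- `EdgeOk` is symmetric, so a constraint at either endpoint makes the edge usable from both sides;
the other endpoint may be an error. -/
theorem Constraint.good' (h : Constraint G rank v) (ha : G.graph.Adj u v) : EdgeGood G u v :=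
  (h.edge_ok u ha.symm).symm

theorem EdgeGood.table (h : EdgeGood G u v) :
    EdgeTable (G.node u) (G.half u v) (G.half v u) (G.node v) :=
  (EdgeOk.table_and h).1

theorem EdgeGood.of_right (h : EdgeGood G u v) (hs : G.Step right u v) :
    G.Step left v u ∧ G.node v = G.node u ∧ G.node u ≠ .inter := by
  have := h.table
  rw [hs.2] at this
  exact ⟨⟨hs.1.symm, this.1⟩, this.2⟩

theorem EdgeGood.of_left (h : EdgeGood G u v) (hs : G.Step left u v) :
    G.Step right v u ∧ G.node v = G.node u ∧ G.node u ≠ .inter := by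
  have := h.table
  rw [hs.2] at this
  exact ⟨⟨hs.1.symm, this.1⟩, this.2⟩

theorem EdgeGood.of_leftChild (h : EdgeGood G u v) (hs : G.Step leftChild u v) :
    G.Step parent v u ∧ G.node v = G.node u ∧ G.node u ≠ .inter := by
  have := h.table
  rw [hs.2] at this
  exact ⟨⟨hs.1.symm, this.1⟩, this.2⟩

theorem EdgeGood.of_rightChild (h : EdgeGood G u v) (hs : G.Step rightChild u v) :
    G.Step parent v u ∧ G.node v = G.node u ∧ G.node u ≠ .inter := by
  have := h.table
  rw [hs.2] at this
  exact ⟨⟨hs.1.symm, this.1⟩, this.2⟩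

theorem EdgeGood.of_parent (h : EdgeGood G u v) (hs : G.Step parent u v) :
    (G.Step leftChild v u ∨ G.Step rightChild v u) ∧
      G.node v = G.node u ∧ G.node u ≠ .inter := by
  have := h.table
  rw [hs.2] at this
  exact ⟨this.1.imp (fun h => ⟨hs.1.symm, h⟩) fun h => ⟨hs.1.symm, h⟩, this.2⟩

theorem EdgeGood.of_port1 (h : EdgeGood G u v) (hs : G.Step port1 u v) :
    G.Step toHead v u ∧ G.node u = .head ∧ G.node v = .port := by
  have := h.table
  rw [hs.2] at this
  exact ⟨⟨hs.1.symm, this.1⟩, this.2⟩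

theorem EdgeGood.of_port2 (h : EdgeGood G u v) (hs : G.Step port2 u v) :
    G.Step toHead v u ∧ G.node u = .head ∧ G.node v = .port := by
  have := h.table
  rw [hs.2] at this
  exact ⟨⟨hs.1.symm, this.1⟩, this.2⟩

theorem EdgeGood.of_toHead (h : EdgeGood G u v) (hs : G.Step toHead u v) :
    (G.Step port1 v u ∨ G.Step port2 v u) ∧
      G.node u = .port ∧ G.node v = .head := by
  have := h.table
  rw [hs.2] at this
  exact ⟨this.1.imp (fun h => ⟨hs.1.symm, h⟩) fun h => ⟨hs.1.symm, h⟩, this.2⟩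

theorem EdgeGood.of_toInter (h : EdgeGood G u v) (hs : G.Step toInter u v) :
    G.Step toPort v u ∧ G.node u = .port ∧ G.node v = .inter := by
  have := h.table
  rw [hs.2] at this
  exact ⟨⟨hs.1.symm, this.1⟩, this.2⟩

theorem EdgeGood.half_of_inter (h : EdgeGood G u v) (hu : G.node u = .inter) :
    G.half u v = toPort ∧ G.half v u = toInter ∧ G.node v = .port := by
  have := h.table
  rw [hu] at this
  cases ha : G.half u v <;> rw [ha] at this <;> simp_all [EdgeTable]

theorem Constraint.unique {a : HalfEdgeLabel} (h : Constraint G rank u) (hu : G.node u ≠ .inter)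
    (hv : G.Step a u v) (hw : G.Step a u w) : v = w :=
  h.distinct hu v w hv.1 hw.1 (hv.2.trans hw.2.symm)

theorem Constraint.not_step_of_inter {a : HalfEdgeLabel} (h : Constraint G rank u)
    (hu : G.node u = .inter) (ha : a ≠ toPort) : ¬ G.Step a u v := fun hs =>
  ha (hs.2.symm.trans ((h.good hs.1).half_of_inter hu).1)

theorem Constraint.has_rightChild (h : Constraint G rank u) (hl : G.Has leftChild u) :
    ∃ v w, G.Step leftChild u v ∧ G.Step rightChild u w ∧ G.Step right v w := by
  obtain ⟨v, hv⟩ := hl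
  obtain ⟨w, hw⟩ := h.children_iff.1 ⟨v, hv⟩
  exact ⟨v, w, hv, hw, h.siblings v w hv hw⟩

/-! ### Descendants -/

/-- `Pos G x l k u`: following children from `x`, the node `u` is the `k`-th node of the `l`-th
layer below `x`. -/
inductive Pos (G : GadgetGraph) (x : G.V) : ℕ → ℕ → G.V → Prop
  | refl : Pos G x 0 0 x
  | left {l k : ℕ} {p u : G.V} (h : Pos G x l k p) (hs : G.Step leftChild p u) :
      Pos G x (l + 1) (2 * k) u
  | right {l k : ℕ} {p u : G.V} (h : Pos G x l k p) (hs : G.Step rightChild p u) :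
      Pos G x (l + 1) (2 * k + 1) u

/-- All descendants of `x` in the layers before the `l`-th one satisfy the constraints. -/
def CleanBelow (G : GadgetGraph) (rank : ℕ) (x : G.V) (l : ℕ) : Prop :=
  ∀ j < l, ∀ k u, Pos G x j k u → Constraint G rank u

theorem CleanBelow.mono {x : G.V} {l m : ℕ} (h : CleanBelow G rank x l) (hm : m ≤ l) :
    CleanBelow G rank x m :=
  fun j hj => h j (hj.trans_le hm)

theorem Pos.zero {x : G.V} {k : ℕ} (h : Pos G x 0 k u) : k = 0 ∧ u = x := by
  cases h
  exact ⟨rfl, rfl⟩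

theorem Pos.succ {x : G.V} {l k : ℕ} (h : Pos G x (l + 1) k u) :
    ∃ j p, Pos G x l j p ∧
      ((k = 2 * j ∧ G.Step leftChild p u) ∨ (k = 2 * j + 1 ∧ G.Step rightChild p u)) := by
  cases h with
  | left h hs => exact ⟨_, _, h, .inl ⟨rfl, hs⟩⟩
  | right h hs => exact ⟨_, _, h, .inr ⟨rfl, hs⟩⟩

theorem Pos.lt {x : G.V} {l k : ℕ} (h : Pos G x l k u) : k < 2 ^ l := by
  induction h with
  | refl => simp
  | left _ _ ih => rw [pow_succ]; omega
  | right _ _ ih => rw [pow_succ]; omega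

theorem Pos.trans {x y : G.V} {l m j k : ℕ} (h : Pos G x l j y) (h' : Pos G y m k u) :
    ∃ i, Pos G x (l + m) i u := by
  induction h' with
  | refl => exact ⟨_, h⟩
  | left _ hs ih =>
    obtain ⟨i, hi⟩ := ih
    exact ⟨_, hi.left hs⟩
  | right _ hs ih =>
    obtain ⟨i, hi⟩ := ih
    exact ⟨_, hi.right hs⟩

theorem Pos.split {x : G.V} {l m : ℕ} : ∀ {k : ℕ} {u : G.V}, Pos G x (l + m) k u →
    ∃ y i j, Pos G x l i y ∧ Pos G y m j u := by
  induction m with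
  | zero => exact fun {k u} h => ⟨u, k, 0, h, .refl⟩
  | succ m ih =>
    intro k u h
    obtain ⟨j, p, hp, hj⟩ := Pos.succ h
    obtain ⟨y, i, i', hy, hy'⟩ := ih hp
    rcases hj with ⟨-, hs⟩ | ⟨-, hs⟩
    · exact ⟨y, i, _, hy, hy'.left hs⟩
    · exact ⟨y, i, _, hy, hy'.right hs⟩

/-- Child edges preserve the kind, and the constraint at the parent is enough for this. Therefore
`u` itself, in layer `l`, may violate its constraint. -/
theorem Pos.kind {x : G.V} {l k : ℕ} (h : Pos G x l k u) (hc : CleanBelow G rank x l) :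
    G.node u = G.node x := by
  induction h with
  | refl => rfl
  | left h hs ih =>
    exact (((hc _ (by omega) _ _ h).good hs.1).of_leftChild hs).2.1.trans (ih (hc.mono (by omega)))
  | right h hs ih =>
    exact (((hc _ (by omega) _ _ h).good hs.1).of_rightChild hs).2.1.trans (ih (hc.mono (by omega)))

theorem Pos.kind_ne_inter {x : G.V} {l k : ℕ} (h : Pos G x (l + 1) k u)
    (hc : CleanBelow G rank x (l + 1)) : G.node x ≠ .inter := by
  obtain ⟨j, p, hp, hj⟩ := Pos.succ h
  have hk := hp.kind (hc.mono (Nat.le_succ l))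
  have hcp := hc l (Nat.lt_succ_self l) _ _ hp
  rcases hj with ⟨-, hs⟩ | ⟨-, hs⟩
  · exact hk ▸ ((hcp.good hs.1).of_leftChild hs).2.2
  · exact hk ▸ ((hcp.good hs.1).of_rightChild hs).2.2

/-- There is at most one node at each position. -/
theorem Pos.eq {x : G.V} {l : ℕ} : ∀ {k : ℕ} {u v : G.V}, CleanBelow G rank x l →
    Pos G x l k u → Pos G x l k v → u = v := by
  induction l with
  | zero => exact fun _ hu hv => hu.zero.2.trans hv.zero.2.symm
  | succ l ih =>
    intro k u v hc hu hv
    have hx := hu.kind_ne_inter hc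
    have hc' := hc.mono (Nat.le_succ l)
    obtain ⟨i, p, hp, hi⟩ := hu.succ
    obtain ⟨j, q, hq, hj⟩ := hv.succ
    have hij : i = j := by omega
    subst hij
    obtain rfl := ih hc' hp hq
    have hcp := hc l (Nat.lt_succ_self l) _ _ hp
    have hpx : G.node p ≠ .inter := hp.kind hc' ▸ hx
    rcases hi with ⟨e, hs⟩ | ⟨e, hs⟩ <;> rcases hj with ⟨e', hs'⟩ | ⟨e', hs'⟩
    · exact hcp.unique hpx hs hs'
    · omega
    · omega
    · exact hcp.unique hpx hs hs'

/-- Consecutive positions of a layer are joined by an edge. -/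
theorem Pos.step_right {x : G.V} {l : ℕ} : ∀ {k : ℕ} {u v : G.V}, CleanBelow G rank x l →
    Pos G x l k u → Pos G x l (k + 1) v → G.Step .right u v := by
  induction l with
  | zero => exact fun _ _ hv => absurd hv.zero.1 (by omega)
  | succ l ih =>
    intro k u v hc hu hv
    have hc' := hc.mono (Nat.le_succ l)
    obtain ⟨i, p, hp, hi⟩ := hu.succ
    obtain ⟨j, q, hq, hj⟩ := hv.succ
    have hcp := hc l (Nat.lt_succ_self l) _ _ hp
    rcases hi with ⟨e, hs⟩ | ⟨e, hs⟩ <;> rcases hj with ⟨e', hs'⟩ | ⟨e', hs'⟩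
    · omega
    · obtain rfl : i = j := by omega
      obtain rfl := hp.eq hc' hq
      exact hcp.siblings _ _ hs hs'
    · obtain rfl : j = i + 1 := by omega
      -- The pair straddles two parents, which are consecutive in the layer above.
      exact hcp.cousins _ _ _ (ih hc' hp hq) hs hs'
    · omega

theorem exists_of_step_iff {f : ℕ → Prop} {N : ℕ} (h : ∀ j, j + 1 < N → (f j ↔ f (j + 1))) {m : ℕ}
    (hm : m < N) (hf : f m) : ∀ j < N, f j := by
  have key : ∀ j < N, (f 0 ↔ f j) := by
    intro j
    induction j with
    | zero => exact fun _ => Iff.rfl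
    | succ j ih => exact fun hj => (ih (by omega)).trans (h j hj)
  exact fun j hj => (key j hj).1 ((key m hm).2 hf)

/-- A layer with one node is full. -/
theorem Pos.full {x : G.V} {l : ℕ} : ∀ {k : ℕ} {u : G.V}, CleanBelow G rank x l →
    Pos G x l k u → ∀ j < 2 ^ l, ∃ v, Pos G x l j v := by
  induction l with
  | zero =>
    intro k u _ _ j hj
    obtain rfl : j = 0 := by simpa using hj
    exact ⟨x, .refl⟩
  | succ l ih =>
    intro k u hc hu
    have hc' := hc.mono (Nat.le_succ l)
    obtain ⟨i, p, hp, hi⟩ := hu.succ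
    have hcon : ∀ {j v}, Pos G x l j v → Constraint G rank v :=
      fun h => hc l (Nat.lt_succ_self l) _ _ h
    have hhas : G.Has leftChild p := by
      rcases hi with ⟨-, hs⟩ | ⟨-, hs⟩
      · exact ⟨_, hs⟩
      · exact (hcon hp).children_iff.2 ⟨_, hs⟩
    have hrow := ih hc' hp
    -- By `layer_iff`, having children is invariant along consecutive nodes of the full layer above,
    -- so one parent with children forces it for all.
    have hall := exists_of_step_iff (f := fun j => ∃ v, Pos G x l j v ∧ G.Has leftChild v)
      (N := 2 ^ l) (fun j hj => by
        obtain ⟨v, hv⟩ := hrow j (by omega)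
        obtain ⟨w, hw⟩ := hrow (j + 1) hj
        have hlay := (hcon hv).layer_iff w (hv.step_right hc' hw)
        constructor
        · rintro ⟨v', hv', h⟩
          obtain rfl := hv.eq hc' hv'
          exact ⟨w, hw, hlay.1 h⟩
        · rintro ⟨w', hw', h⟩
          obtain rfl := hw.eq hc' hw'
          exact ⟨v, hv, hlay.2 h⟩) hp.lt ⟨p, hp, hhas⟩
    intro j hj
    obtain ⟨v, hv, hl⟩ := hall (j / 2) (by rw [pow_succ] at hj; omega)
    obtain ⟨a, b, ha, hb, -⟩ := (hcon hv).has_rightChild hl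
    rcases Nat.even_or_odd' j with ⟨i, rfl | rfl⟩
    · refine ⟨a, ?_⟩
      have := hv.left ha
      rwa [show 2 * i / 2 = i by omega] at this
    · refine ⟨b, ?_⟩
      have := hv.right hb
      rwa [show (2 * i + 1) / 2 = i by omega] at this

/-- Within a layer, either all nodes have children or none. -/
theorem Pos.has_leftChild {x : G.V} {l j k : ℕ} (hc : CleanBelow G rank x (l + 1))
    (hu : Pos G x l j u) (hv : Pos G x l k v) (h : G.Has leftChild u) : G.Has leftChild v := by
  obtain ⟨w, hw⟩ := h
  have hc' := hc.mono (Nat.le_succ l)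
  obtain ⟨z, hz⟩ := (hu.left hw).full hc (2 * k) (by rw [pow_succ]; have := hv.lt; omega)
  obtain ⟨i, p, hp, ⟨e, hs⟩ | ⟨e, hs⟩⟩ := hz.succ
  · obtain rfl : k = i := by omega
    obtain rfl := hp.eq hc' hv
    exact ⟨z, hs⟩
  · omega

theorem Pos.step_parent {x : G.V} {l k : ℕ} (h : Pos G x (l + 1) k u)
    (hc : CleanBelow G rank x (l + 1)) : ∃ j p, Pos G x l j p ∧ G.Step .parent u p ∧
      G.node u = G.node p ∧ G.node p ≠ .inter ∧
      ((k = 2 * j ∧ G.half p u = leftChild) ∨ (k = 2 * j + 1 ∧ G.half p u = rightChild)) := by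
  obtain ⟨j, p, hp, hj⟩ := Pos.succ h
  have hcp := hc l (Nat.lt_succ_self l) _ _ hp
  rcases hj with ⟨e, hs⟩ | ⟨e, hs⟩
  · have := (hcp.good hs.1).of_leftChild hs
    exact ⟨j, p, hp, this.1, this.2.1, this.2.2, .inl ⟨e, hs.2⟩⟩
  · have := (hcp.good hs.1).of_rightChild hs
    exact ⟨j, p, hp, this.1, this.2.1, this.2.2, .inr ⟨e, hs.2⟩⟩

/-- A node has at most one position in each layer. -/
theorem Pos.index_eq {x : G.V} {l : ℕ} : ∀ {j k : ℕ} {u : G.V}, CleanBelow G rank x (l + 1) →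
    Pos G x l j u → Pos G x l k u → j = k := by
  induction l with
  | zero => exact fun _ hu hv => hu.zero.1.trans hv.zero.1.symm
  | succ l ih =>
    intro j k u hc hu hv
    have hc' := hc.mono (Nat.le_succ (l + 1))
    obtain ⟨i, p, hp, hup, hk, hi, hpi⟩ := hu.step_parent hc'
    obtain ⟨i', q, hq, huq, -, -, hqi⟩ := hv.step_parent hc'
    have hcu := hc _ (Nat.lt_succ_self _) _ _ hu
    -- The parent is unique by the constraint at `u` itself, which is why layer `l` is included in
    -- the clean part.
    obtain rfl := hcu.unique (hk ▸ hi) hup huq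
    obtain rfl := ih hc' hp hq
    rcases hpi with ⟨e, h1⟩ | ⟨e, h1⟩ <;> rcases hqi with ⟨e', h2⟩ | ⟨e', h2⟩ <;>
      simp_all

/-- The layer is full and its positions hold distinct nodes. This exponential growth is the source
of the logarithm in the final bound. -/
theorem Pos.two_pow_le {x : G.V} {l k : ℕ} (hc : CleanBelow G rank x (l + 1))
    (h : Pos G x l k u) : 2 ^ l ≤ Fintype.card G.V := by
  choose f hf using fun j : Fin (2 ^ l) => h.full (hc.mono (Nat.le_succ l)) j.1 j.2
  have hinj : Function.Injective f := fun i j hij =>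
    Fin.ext ((hf i).index_eq hc (hij ▸ hf j))
  simpa using Fintype.card_le_of_injective f hinj

end GadgetGraph

theorem LabeledGraph.mem_nbrs {X E : Type} {G : LabeledGraph X E} {u v : G.V} :
    v ∈ G.nbrs u ↔ G.graph.Adj u v := by
  simp [LabeledGraph.nbrs]

namespace GadgetGraph

open HalfEdgeLabel

variable {G : GadgetGraph} {rank : ℕ} {u v w : G.V}

/-! ### The marked nodes -/

/-- An upper bound on the number of layers of a gadget without errors. -/
noncomputable def height (G : GadgetGraph) : ℕ :=
  Nat.log 2 (Fintype.card G.V) + 1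

theorem card_lt_two_pow_height (G : GadgetGraph) : Fintype.card G.V < 2 ^ height G :=
  Nat.lt_pow_succ_log_self one_lt_two _

theorem Pos.lt_height {x : G.V} {l k : ℕ} (hc : CleanBelow G rank x (l + 1))
    (h : Pos G x l k u) : l < height G := by
  by_contra! hl
  have := Nat.pow_le_pow_right (n := 2) (by norm_num) hl
  have := h.two_pow_le hc
  have := card_lt_two_pow_height G
  omega

/-- Some node that violates the constraints is reached from `u` by at most `m` steps down. -/
def Down (G : GadgetGraph) (rank : ℕ) : ℕ → G.V → Prop
  | 0, u => ¬ Constraint G rank u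
  | m + 1, u => Down G rank m u ∨ ∃ v, StepDown G u v ∧ Down G rank m v

/-- An upper bound on the number of steps that lead to an error. -/
noncomputable def depth (G : GadgetGraph) : ℕ :=
  2 * height G + 2

/-- Some node from which an error is reached downwards is reached from `u` by at most `m` steps
up. -/
def Up (G : GadgetGraph) (rank : ℕ) : ℕ → G.V → Prop
  | 0, u => Down G rank (depth G) u
  | m + 1, u => Up G rank m u ∨ ∃ v, StepUp G u v ∧ Up G rank m v

def Marked (G : GadgetGraph) (rank : ℕ) (u : G.V) : Prop :=
  Up G rank (depth G) u

theorem Down.mono {m k : ℕ} (h : Down G rank m u) (hk : m ≤ k) : Down G rank k u := by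
  induction k, hk using Nat.le_induction with
  | base => exact h
  | succ k _ ih => exact .inl ih

theorem Up.mono {m k : ℕ} (h : Up G rank m u) (hk : m ≤ k) : Up G rank k u := by
  induction k, hk using Nat.le_induction with
  | base => exact h
  | succ k _ ih => exact .inl ih

theorem Up.of_down (h : Down G rank (depth G) u) (m : ℕ) : Up G rank m u :=
  Up.mono (m := 0) h (Nat.zero_le m)

theorem Down.of_pos {x : G.V} {l k m : ℕ} (h : Pos G x l k u) :
    Down G rank m u → Down G rank (l + m) x := by
  induction h generalizing m with
  | refl => exact fun h => h.mono (by omega)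
  | left _ hs ih => exact fun h => (ih (m := m + 1) (.inr ⟨_, .inl hs, h⟩)).mono (by omega)
  | right _ hs ih => exact fun h => (ih (m := m + 1) (.inr ⟨_, .inr (.inl hs), h⟩)).mono (by omega)

/-- A step down that leaves the gadget. -/
def StepExit (G : GadgetGraph) (u v : G.V) : Prop :=
  G.Step port1 u v ∨ G.Step port2 u v ∨ G.Step toInter u v

theorem StepExit.stepDown (h : StepExit G u v) : StepDown G u v :=
  .inr (.inr h)

/-- A downward path is cut at its first edge that leaves the gadget, or at the error if there is no
such edge. The child steps before the cut form one `Pos`. -/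
theorem Down.exists_segment {m : ℕ} : ∀ {u : G.V}, Down G rank m u →
    ∃ l k v, Pos G u l k v ∧
      (¬ Constraint G rank v ∨ ∃ w m, StepExit G v w ∧ Down G rank m w) := by
  induction m with
  | zero => exact fun {u} h => ⟨0, 0, u, .refl, .inl h⟩
  | succ m ih =>
    rintro u (h | ⟨v, hs, h⟩)
    · exact ih h
    · obtain ⟨l, k, x, hx, hx'⟩ := ih h
      rcases hs with hs | hs | hs
      · obtain ⟨i, hi⟩ := (Pos.refl.left hs).trans hx
        exact ⟨_, i, x, hi, hx'⟩
      · obtain ⟨i, hi⟩ := (Pos.refl.right hs).trans hx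
        exact ⟨_, i, x, hi, hx'⟩
      · exact ⟨0, 0, u, .refl, .inr ⟨v, m, hs, h⟩⟩

/-- A shortest segment that leads downwards out of a gadget or to an error. -/
theorem Down.exists_short_segment {m : ℕ} (h : Down G rank m u) :
    ∃ l k v, Pos G u l k v ∧ l ≤ height G ∧ G.node v = G.node u ∧
      (¬ Constraint G rank v ∨ ∃ w m, StepExit G v w ∧ Down G rank m w) := by
  classical
  have hex := h.exists_segment
  obtain ⟨k, v, hv, hv'⟩ := Nat.find_spec hex
  have hmin := fun j => Nat.find_min hex (m := j)
  generalize Nat.find hex = l at hv hmin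
  -- An error in an earlier layer would give a shorter segment.
  have hc : CleanBelow G rank u l := fun j hj k x hx => by
    by_contra hcon
    exact hmin j hj ⟨k, x, hx, .inl hcon⟩
  refine ⟨l, k, v, hv, ?_, hv.kind hc, hv'⟩
  cases l with
  | zero => exact Nat.zero_le _
  | succ l =>
    obtain ⟨j, p, hp, -⟩ := hv.succ
    exact hp.lt_height hc

theorem Constraint.stepDown_inter (h : Constraint G rank u) (hu : G.node u = .inter) :
    ¬ StepDown G u v := by
  rintro (hs | hs | hs | hs | hs) <;> exact h.not_step_of_inter hu (by simp) hs

theorem Constraint.stepUp_inter (h : Constraint G rank u) (hu : G.node u = .inter) :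
    ¬ StepUp G u v := by
  rintro (hs | hs) <;> exact h.not_step_of_inter hu (by simp) hs

/-- A clean inter-octopus node has no downward half-edge, so the path has to end where it starts. -/
theorem Down.bound_inter {m : ℕ} (hu : G.node u = .inter) (h : Down G rank m u) :
    ¬ Constraint G rank u := by
  intro hc
  induction m with
  | zero => exact h hc
  | succ m ih =>
    rcases h with h | ⟨v, hs, -⟩
    · exact ih h
    · exact hc.stepDown_inter hu hs

theorem Constraint.stepExit_port (h : Constraint G rank u) (hu : G.node u = .port)
    (hs : StepExit G u v) : G.node v = .inter := by
  rcases hs with hs | hs | hs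
  · exact absurd (hu.symm.trans ((h.good hs.1).of_port1 hs).2.1) (by simp)
  · exact absurd (hu.symm.trans ((h.good hs.1).of_port2 hs).2.1) (by simp)
  · exact ((h.good hs.1).of_toInter hs).2.2

theorem Constraint.stepExit_head (h : Constraint G rank u) (hu : G.node u = .head)
    (hs : StepExit G u v) : G.node v = .port := by
  rcases hs with hs | hs | hs
  · exact ((h.good hs.1).of_port1 hs).2.2
  · exact ((h.good hs.1).of_port2 hs).2.2
  · exact absurd (hu.symm.trans ((h.good hs.1).of_toInter hs).2.1) (by simp)

theorem Down.of_segment {l k m : ℕ} (hp : Pos G u l k v) (hs : StepExit G v w)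
    (h : Down G rank m w) : Down G rank (l + (m + 1)) u :=
  Down.of_pos hp (.inr ⟨w, hs.stepDown, h⟩)

/-- A clean port node can exit only to an inter-octopus node, where the search ends: at most `height
G` child steps and one exit. -/
theorem Down.bound_port {m : ℕ} (hu : G.node u = .port) (h : Down G rank m u) :
    Down G rank (height G + 1) u := by
  obtain ⟨l, k, v, hv, hl, hk, h'⟩ := h.exists_short_segment
  by_cases hc : Constraint G rank v
  · obtain ⟨w, m, hs, hw⟩ := h'.resolve_left (not_not.2 hc)
    have hw' : Down G rank 0 w := hw.bound_inter (hc.stepExit_port (hk.trans hu) hs)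
    exact (Down.of_segment hv hs hw').mono (by omega)
  · exact (Down.of_pos (m := 0) hv hc).mono (by omega)

/-- The worst case starts in a head-gadget: `height G` steps, an exit, `height G` steps in a
port-gadget, and a second exit, which is exactly `depth G`. So `Down G rank (depth G)` is the full
transitive closure. -/
theorem Down.bound {m : ℕ} (h : Down G rank m u) : Down G rank (depth G) u := by
  unfold depth
  cases hu : G.node u with
  | inter => exact Down.mono (m := 0) (h.bound_inter hu) (by omega)
  | port => exact (h.bound_port hu).mono (by omega)
  | head =>
    obtain ⟨l, k, v, hv, hl, hk, h'⟩ := h.exists_short_segment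
    by_cases hc : Constraint G rank v
    · obtain ⟨w, m, hs, hw⟩ := h'.resolve_left (not_not.2 hc)
      have hw' := hw.bound_port (hc.stepExit_head (hk.trans hu) hs)
      exact (Down.of_segment hv hs hw').mono (by omega)
    · exact (Down.of_pos (m := 0) hv hc).mono (by omega)

theorem Down.of_stepDown {m : ℕ} (hs : StepDown G u v) (h : Down G rank m v) :
    Down G rank (depth G) u :=
  Down.bound (m := m + 1) (.inr ⟨v, hs, h⟩)

theorem constraint_of_not_down {m : ℕ} (h : ¬ Down G rank m u) : Constraint G rank u := by
  by_contra hc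
  exact h (Down.mono (m := 0) hc (Nat.zero_le m))

theorem cleanBelow_of_not_down (h : ¬ Down G rank (depth G) u) (l : ℕ) :
    CleanBelow G rank u l := fun j _ k x hx => by
  by_contra hc
  exact h (Down.of_pos (m := 0) hx hc).bound

theorem Pos.lt_height_of_not_down {x : G.V} {l k : ℕ} (h : Pos G x l k u)
    (hx : ¬ Down G rank (depth G) x) : l < height G :=
  h.lt_height (cleanBelow_of_not_down hx _)

/-- A child either violates its constraint, and is then marked itself, or its half-edge to the
parent is labelled consistently and it can point up. -/
theorem Up.of_pos {x : G.V} {l k m : ℕ} (h : Pos G x l k u) (hx : Up G rank m x) :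
    Up G rank (m + l) u := by
  induction h with
  | refl => exact hx
  | @left _ _ p u _ hs ih =>
    by_cases hc : Constraint G rank u
    · exact .inr ⟨p, .inl ((hc.good' hs.1).of_leftChild hs).1, ih⟩
    · exact Up.of_down (Down.bound (m := 0) hc) _
  | @right _ _ p u _ hs ih =>
    by_cases hc : Constraint G rank u
    · exact .inr ⟨p, .inl ((hc.good' hs.1).of_rightChild hs).1, ih⟩
    · exact Up.of_down (Down.bound (m := 0) hc) _

theorem Constraint.pos_of_parent (h : Constraint G rank u) (hs : G.Step parent u v) :
    ∃ k, Pos G v 1 k u :=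
  ((h.good hs.1).of_parent hs).1.elim (fun h => ⟨_, Pos.refl.left h⟩) fun h => ⟨_, Pos.refl.right h⟩

/-- An upward path is cut at the first step to a head-gadget, or earlier at a node from which an
error is reached downwards. A node with a violated constraint counts as the latter. -/
theorem Up.exists_segment {m : ℕ} : ∀ {u : G.V}, Up G rank m u →
    ∃ l a k, Pos G a l k u ∧ (Down G rank (depth G) a ∨
      (G.node a = G.node u ∧ ∃ w m, G.Step toHead a w ∧ Up G rank m w)) := by
  induction m with
  | zero => exact fun {u} h => ⟨0, u, 0, .refl, .inl h⟩
  | succ m ih =>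
    rintro u (h | ⟨v, hs, h⟩)
    · exact ih h
    · by_cases hc : Constraint G rank u
      · rcases hs with hs | hs
        · obtain ⟨l, a, k, ha, ha'⟩ := ih h
          obtain ⟨j, hj⟩ := hc.pos_of_parent hs
          obtain ⟨i, hi⟩ := ha.trans hj
          refine ⟨_, a, i, hi, ha'.imp_right fun h' => ⟨h'.1.trans ?_, h'.2⟩⟩
          exact ((hc.good hs.1).of_parent hs).2.1
        · exact ⟨0, u, 0, .refl, .inr ⟨rfl, v, m, hs, h⟩⟩
      · exact ⟨0, u, 0, .refl, .inl (Down.bound (m := 0) hc)⟩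

theorem Up.exists_short_segment {m : ℕ} (h : Up G rank m u) :
    ∃ l a k, Pos G a l k u ∧ l ≤ height G ∧ (Down G rank (depth G) a ∨
      (G.node a = G.node u ∧ ∃ w m, G.Step toHead a w ∧ Up G rank m w)) := by
  classical
  have hex := h.exists_segment
  obtain ⟨a, k, hv, hv'⟩ := Nat.find_spec hex
  have hmin := fun j => Nat.find_min hex (m := j)
  generalize Nat.find hex = l at hv hmin
  refine ⟨l, a, k, hv, ?_, hv'⟩
  by_contra! hl
  obtain ⟨d, rfl⟩ := Nat.exists_eq_add_of_lt hl
  rw [show height G + d + 1 = (d + 1) + height G by omega] at hv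
  -- The ancestor `y` lies exactly `height G` layers above `u`. If an error is below `y`, the
  -- segment was not shortest; otherwise the layers below `y` are too many for a clean gadget.
  obtain ⟨y, i, j, -, hy⟩ := hv.split
  by_cases hd : Down G rank (depth G) y
  · exact hmin _ hl ⟨y, j, hy, .inl hd⟩
  · exact absurd (hy.lt_height_of_not_down hd) (lt_irrefl _)

theorem Up.bound_head {m : ℕ} (hu : G.node u = .head) (h : Up G rank m u) :
    Up G rank (height G) u := by
  obtain ⟨l, a, k, ha, hl, hd | ⟨hk, w, m, hs, -⟩⟩ := h.exists_short_segment
  · exact (Up.of_pos (m := 0) ha hd).mono (by omega)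
  · by_cases hc : Constraint G rank a
    · exact absurd (hk.symm.trans ((hc.good hs.1).of_toHead hs).2.1) (by simp [hu])
    · exact (Up.of_pos (m := 0) ha (Down.bound (m := 0) hc)).mono (by omega)

/-- Upward paths cross at most a port-gadget and a head-gadget, since a clean head node has no
half-edge `toHead`. So `Marked` is closed under any number of steps. -/
theorem Up.bound {m : ℕ} (h : Up G rank m u) : Marked G rank u := by
  unfold Marked depth
  obtain ⟨l, a, k, ha, hl, hd | ⟨-, w, m, hs, hw⟩⟩ := h.exists_short_segment
  · exact (Up.of_pos (m := 0) ha hd).mono (by omega)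
  · by_cases hc : Constraint G rank a
    · have hw' := hw.bound_head ((hc.good hs.1).of_toHead hs).2.2
      exact (Up.of_pos (m := height G + 1) ha (.inr ⟨w, .inr hs, hw'⟩)).mono (by omega)
    · exact (Up.of_pos (m := 0) ha (Down.bound (m := 0) hc)).mono (by omega)

theorem Marked.of_down {m : ℕ} (h : Down G rank m u) : Marked G rank u :=
  Up.of_down h.bound _

theorem Marked.of_stepUp (hs : StepUp G u v) (h : Marked G rank v) : Marked G rank u :=
  Up.bound (m := depth G + 1) (.inr ⟨v, hs, h⟩)

theorem Marked.of_pos {x : G.V} {l k : ℕ} (h : Pos G x l k u) (hx : Marked G rank x) :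
    Marked G rank u :=
  (Up.of_pos h hx).bound

theorem Marked.exists_stepUp (h : Marked G rank u) (hd : ¬ Down G rank (depth G) u) :
    ∃ v, StepUp G u v ∧ Marked G rank v := by
  have key : ∀ m, Up G rank m u → ∃ v, StepUp G u v ∧ Marked G rank v := by
    intro m
    induction m with
    | zero => exact fun h => absurd h hd
    | succ m ih =>
      rintro (h | ⟨v, hs, hv⟩)
      · exact ih h
      · exact ⟨v, hs, hv.bound⟩
  exact key _ h

theorem Down.exists_stepDown {m : ℕ} (h : Down G rank m u) (hc : Constraint G rank u) :
    ∃ v, StepDown G u v ∧ Down G rank (depth G) v := by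
  induction m with
  | zero => exact absurd hc h
  | succ m ih =>
    rcases h with h | ⟨v, hs, hv⟩
    · exact ih h
    · exact ⟨v, hs, hv.bound⟩

/-! ### The neighbours of unmarked nodes -/

theorem not_down_of_not_marked {m : ℕ} (h : ¬ Marked G rank u) : ¬ Down G rank m u :=
  fun hd => h (Marked.of_down hd)

theorem constraint_of_not_marked (h : ¬ Marked G rank u) : Constraint G rank u :=
  constraint_of_not_down (not_down_of_not_marked (m := 0) h)

theorem not_marked_of_stepUp (h : ¬ Marked G rank u) (hs : StepUp G u v) : ¬ Marked G rank v :=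
  fun hv => h (Marked.of_stepUp hs hv)

/-- If `v` were marked because of an error below it, so would be `u`. Otherwise `v` has a marked
node above it, but the only step up from `v` leads back to `u`. -/
theorem not_marked_of_stepDown (h : ¬ Marked G rank u) (hs : StepDown G u v) :
    ¬ Marked G rank v := by
  intro hv
  by_cases hd : Down G rank (depth G) v
  · exact h (Marked.of_down (Down.of_stepDown hs hd))
  obtain ⟨w, hw, hmw⟩ := hv.exists_stepUp hd
  have hcu := constraint_of_not_marked h
  have hcv := constraint_of_not_down hd
  suffices w = u from h (this ▸ hmw)
  have child : G.Step parent v u → G.node v ≠ .inter → w = u := by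
    intro hp hk
    rcases hw with hw | hw
    · exact hcv.unique hk hw hp
    · exact absurd ⟨u, hp⟩ ((hcv.port_root ((hcv.good hw.1).of_toHead hw).2.1).1 ⟨w, hw⟩)
  have port : G.Step toHead v u → G.node v = .port → w = u := by
    intro hp hk
    rcases hw with hw | hw
    · exact absurd ⟨w, hw⟩ ((hcv.port_root hk).1 ⟨u, hp⟩)
    · exact hcv.unique (by simp [hk]) hw hp
  rcases hs with hs | hs | hs | hs | hs
  · have := (hcu.good hs.1).of_leftChild hs
    exact child this.1 (this.2.1 ▸ this.2.2)
  · have := (hcu.good hs.1).of_rightChild hs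
    exact child this.1 (this.2.1 ▸ this.2.2)
  · have := (hcu.good hs.1).of_port1 hs
    exact port this.1 this.2.2
  · have := (hcu.good hs.1).of_port2 hs
    exact port this.1 this.2.2
  · exact absurd hw (hcv.stepUp_inter ((hcu.good hs.1).of_toInter hs).2.2)

theorem Pos.not_marked {x : G.V} {l k : ℕ} (h : Pos G x l k u) (hx : ¬ Marked G rank x) :
    ¬ Marked G rank u := by
  induction h with
  | refl => exact hx
  | left _ hs ih => exact not_marked_of_stepDown ih (.inl hs)
  | right _ hs ih => exact not_marked_of_stepDown ih (.inr (.inl hs))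

theorem Pos.not_marked_of_pos {x : G.V} {l k : ℕ} (h : Pos G x l k u) (hu : ¬ Marked G rank u) :
    ¬ Marked G rank x :=
  fun hx => hu (Marked.of_pos h hx)

/-- An unmarked node of a gadget is a descendant of the root of the gadget. -/
theorem exists_root (hu : ¬ Marked G rank u) :
    ∃ r l k, Pos G r l k u ∧ ¬ G.Has parent r := by
  by_contra! hno
  -- Without a root one could climb forever through unmarked ancestors, contradicting the bound on
  -- the number of clean layers.
  have key : ∀ m, ∃ a k, Pos G a m k u := by
    intro m
    induction m with
    | zero => exact ⟨u, 0, .refl⟩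
    | succ m ih =>
      obtain ⟨a, k, ha⟩ := ih
      obtain ⟨b, hb⟩ := hno a m k ha
      obtain ⟨j, hj⟩ := (constraint_of_not_marked (ha.not_marked_of_pos hu)).pos_of_parent hb
      obtain ⟨i, hi⟩ := hj.trans ha
      exact ⟨b, i, by rwa [Nat.add_comm] at hi⟩
  obtain ⟨a, k, ha⟩ := key (height G)
  have := ha.lt_height_of_not_down (not_down_of_not_marked (ha.not_marked_of_pos hu))
  exact lt_irrefl _ this

/-- The lateral neighbours of an unmarked node are unmarked, and they are descendants of the same
root at the adjacent positions. -/
theorem Pos.lateral {r : G.V} {l : ℕ} (hr : ¬ G.Has parent r) : ∀ {k : ℕ} {u : G.V},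
    Pos G r l k u → ¬ Marked G rank u →
    (∀ v, G.Step .right u v → ¬ Marked G rank v ∧ Pos G r l (k + 1) v) ∧
    (∀ v, G.Step .left u v → ¬ Marked G rank v ∧ ∃ j, k = j + 1 ∧ Pos G r l j v) := by
  induction l with
  | zero =>
    intro k u h hu
    obtain ⟨rfl, rfl⟩ := h.zero
    have := (constraint_of_not_marked hu).root_alone hr
    exact ⟨fun v hv => absurd ⟨v, hv⟩ this.2, fun v hv => absurd ⟨v, hv⟩ this.1⟩
  | succ l ih =>
    intro k u h hu
    have hcu := constraint_of_not_marked hu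
    obtain ⟨j, p, hp, hj⟩ := h.succ
    have hps : ∃ i, Pos G p 1 i u := by
      rcases hj with ⟨-, hs⟩ | ⟨-, hs⟩
      · exact ⟨_, Pos.refl.left hs⟩
      · exact ⟨_, Pos.refl.right hs⟩
    obtain ⟨i, hi⟩ := hps
    have hmp := hi.not_marked_of_pos hu
    have hcp := constraint_of_not_marked hmp
    obtain ⟨ihr, ihl⟩ := ih hp hmp
    have child : ∀ {q x : G.V}, ¬ Marked G rank q →
        (G.Step leftChild q x ∨ G.Step rightChild q x) → ¬ Marked G rank x := by
      rintro q x hq (hs | hs)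
      · exact not_marked_of_stepDown hq (.inl hs)
      · exact not_marked_of_stepDown hq (.inr (.inl hs))
    have hk : G.node u ≠ .inter := by
      rcases hj with ⟨-, hs⟩ | ⟨-, hs⟩
      · have := (hcp.good hs.1).of_leftChild hs
        exact this.2.1 ▸ this.2.2
      · have := (hcp.good hs.1).of_rightChild hs
        exact this.2.1 ▸ this.2.2
    rcases hj with ⟨rfl, hs⟩ | ⟨rfl, hs⟩
    · constructor
      · intro v hv
        obtain ⟨w, hw⟩ := hcp.children_iff.1 ⟨u, hs⟩
        obtain rfl := hcu.unique hk hv (hcp.siblings _ _ hs hw)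
        exact ⟨child hmp (.inr hw), hp.right hw⟩
      · intro v hv
        -- A left neighbour of a left child must be the right child of the left neighbour `q` of the
        -- parent, by `cousins` and the uniqueness of labels at `u`. The other cases are analogous.
        obtain ⟨q, hq⟩ := (hcu.left_end p hs).1 ⟨v, hv⟩
        obtain ⟨hmq, i, rfl, hqi⟩ := ihl q hq
        have hcq := constraint_of_not_marked hmq
        have hqp := ((hcp.good hq.1).of_left hq).1
        obtain ⟨a, ha⟩ := hcq.children_iff.1 ((hcq.layer_iff p hqp).2 ⟨u, hs⟩)
        have hau := hcq.cousins _ _ _ hqp ha hs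
        obtain rfl := hcu.unique hk hv ((hcu.good' hau.1).of_right hau).1
        exact ⟨child hmq (.inr ha), _, by omega, hqi.right ha⟩
    · constructor
      · intro v hv
        obtain ⟨q, hq⟩ := (hcu.right_end p hs).1 ⟨v, hv⟩
        obtain ⟨hmq, hqi⟩ := ihr q hq
        obtain ⟨b, hb⟩ := (hcp.layer_iff q hq).1 (hcp.children_iff.2 ⟨u, hs⟩)
        obtain rfl := hcu.unique hk hv (hcp.cousins _ _ _ hq hs hb)
        exact ⟨child hmq (.inl hb), hqi.left hb⟩
      · intro v hv
        obtain ⟨w, hw⟩ := hcp.children_iff.2 ⟨u, hs⟩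
        have hwu := hcp.siblings _ _ hw hs
        obtain rfl := hcu.unique hk hv ((hcu.good' hwu.1).of_right hwu).1
        exact ⟨child hmp (.inl hw), _, rfl, hp.left hw⟩

/-- Vertical steps are covered by the closure of the marking, and lateral steps by `Pos.lateral`.
Hence unmarked gadgets are never cut, and only inter-octopus nodes separate unmarked nodes from
marked ones. -/
theorem not_marked_of_adj (hu : ¬ Marked G rank u) (hk : G.node u ≠ .inter)
    (ha : G.graph.Adj u v) : ¬ Marked G rank v := by
  obtain ⟨r, l, k, hp, hr⟩ := exists_root hu
  have hl := hp.lateral hr hu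
  cases hh : G.half u v with
  | left => exact (hl.2 v ⟨ha, hh⟩).1
  | right => exact (hl.1 v ⟨ha, hh⟩).1
  | parent => exact not_marked_of_stepUp hu (.inl ⟨ha, hh⟩)
  | toHead => exact not_marked_of_stepUp hu (.inr ⟨ha, hh⟩)
  | leftChild => exact not_marked_of_stepDown hu (.inl ⟨ha, hh⟩)
  | rightChild => exact not_marked_of_stepDown hu (.inr (.inl ⟨ha, hh⟩))
  | port1 => exact not_marked_of_stepDown hu (.inr (.inr (.inl ⟨ha, hh⟩)))
  | port2 => exact not_marked_of_stepDown hu (.inr (.inr (.inr (.inl ⟨ha, hh⟩))))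
  | toInter => exact not_marked_of_stepDown hu (.inr (.inr (.inr (.inr ⟨ha, hh⟩))))
  | toPort =>
    have := ((constraint_of_not_marked hu).good ha).table
    rw [hh] at this
    exact absurd this.2.1 hk

/-! ### Validity of the marking -/

theorem keep_step_iff {S : Set G.V} {a : HalfEdgeLabel} :
    (G.keep S).Step a u v ↔ G.Step a u v ∧ u ∈ S ∧ v ∈ S :=
  ⟨fun h => ⟨⟨h.1.1, h.2⟩, h.1.2⟩, fun h => ⟨⟨h.1.1, h.2⟩, h.1.2⟩⟩

theorem keep_step_of_ne_inter {a : HalfEdgeLabel} (hu : ¬ Marked G rank u)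
    (hk : G.node u ≠ .inter) : (G.keep {v | ¬ Marked G rank v}).Step a u v ↔ G.Step a u v :=
  keep_step_iff.trans ⟨fun h => h.1, fun h => ⟨h, hu, not_marked_of_adj hu hk h.1⟩⟩

theorem keep_has_of_ne_inter {a : HalfEdgeLabel} (hu : ¬ Marked G rank u)
    (hk : G.node u ≠ .inter) : (G.keep {v | ¬ Marked G rank v}).Has a u ↔ G.Has a u :=
  exists_congr fun _ => keep_step_of_ne_inter hu hk

theorem nbrs_keep_subset (S : Set G.V) (u : G.V) : (G.keep S).nbrs u ⊆ G.nbrs u := by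
  intro v hv
  exact LabeledGraph.mem_nbrs.2 (LabeledGraph.mem_nbrs.1 hv).1

/-- A node of a gadget keeps all its half-edges, and so do the gadget neighbours that its constraint
inspects, so the constraint carries over. An inter-octopus node may lose neighbours, but the only
clauses with content there, consistent edges and bounded degree, pass to subgraphs. -/
theorem constraint_keep (hu : ¬ Marked G rank u) :
    Constraint (G.keep {v | ¬ Marked G rank v}) rank u := by
  have hc := constraint_of_not_marked hu
  set K := G.keep {v | ¬ Marked G rank v} with hK
  have step : ∀ {a x y}, K.Step a x y → G.Step a x y ∧ ¬ Marked G rank x ∧ ¬ Marked G rank y :=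
    fun h => keep_step_iff.1 h
  have edge : ∀ v, K.graph.Adj u v → EdgeOk (K.node u) (K.half u v) (K.half v u) (K.node v) :=
    fun v hv => hc.edge_ok v hv.1
  have hdeg : K.node u = .inter → (K.nbrs u).card ≤ rank := fun h =>
    (Finset.card_le_card (nbrs_keep_subset _ u)).trans (hc.inter_degree h)
  by_cases hk : G.node u = .inter
  · have no : ∀ {a : HalfEdgeLabel} {v}, a ≠ toPort → ¬ K.Step a u v := fun ha hs =>
      hc.not_step_of_inter hk ha (step hs).1
    have hno : ∀ {a : HalfEdgeLabel}, a ≠ toPort → ¬ K.Has a u := fun ha ⟨_, hs⟩ => no ha hs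
    have child : ∀ {a : HalfEdgeLabel} {p}, (a = leftChild ∨ a = rightChild) → ¬ K.Step a p u := by
      intro a p ha hs
      have := ((hc.good (step hs).1.1.symm).half_of_inter hk).2.1
      rw [(step hs).1.2] at this
      simp [this] at ha
    have hkind : ∀ {k : NodeKind}, k ≠ .inter → K.node u ≠ k := fun h h' => h (h'.symm.trans hk)
    exact
      { edge_ok := edge
        distinct := fun h => absurd hk h
        inter_degree := hdeg
        children_iff := iff_of_false (hno (by simp)) (hno (by simp))
        siblings := fun _ _ h => absurd h (no (by simp))
        layer_iff := fun _ h => absurd h (no (by simp))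
        cousins := fun _ _ _ h => absurd h (no (by simp))
        root_alone := fun _ => ⟨hno (by simp), hno (by simp)⟩
        left_end := fun _ h => absurd h (child (.inl rfl))
        right_end := fun _ h => absurd h (child (.inr rfl))
        head_port1 := fun h => absurd h (hkind (by simp))
        head_port2 := fun h => absurd h (hkind (by simp))
        port_root := fun h => absurd h (hkind (by simp))
        port_leaf := fun h => absurd h (hkind (by simp)) }
  · have hs : ∀ {a v}, K.Step a u v ↔ G.Step a u v := keep_step_of_ne_inter hu hk
    have hh : ∀ {a}, K.Has a u ↔ G.Has a u := keep_has_of_ne_inter hu hk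
    have hh' : ∀ {a v}, ¬ Marked G rank v → G.node v = G.node u → (K.Has a v ↔ G.Has a v) :=
      fun hv hvk => keep_has_of_ne_inter hv (hvk ▸ hk)
    have right_kind : ∀ {v}, G.Step right u v → G.node v = G.node u :=
      fun h => ((hc.good h.1).of_right h).2.1
    have lc : ∀ {p}, G.Step leftChild p u → G.node p = G.node u :=
      fun h => ((hc.good' h.1).of_leftChild h).2.1.symm
    have rc : ∀ {p}, G.Step rightChild p u → G.node p = G.node u :=
      fun h => ((hc.good' h.1).of_rightChild h).2.1.symm
    exact
      { edge_ok := edge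
        distinct := fun h v w hv hw => hc.distinct h v w hv.1 hw.1
        inter_degree := hdeg
        children_iff := by rw [hh, hh]; exact hc.children_iff
        siblings := fun v w hv hw =>
          keep_step_iff.2 ⟨hc.siblings v w (step hv).1 (step hw).1, (step hv).2.2, (step hw).2.2⟩
        layer_iff := fun v hv => by
          rw [hh, hh' (step hv).2.2 (right_kind (step hv).1)]
          exact hc.layer_iff v (step hv).1
        cousins := fun v a b hv ha hb => keep_step_iff.2
          ⟨hc.cousins v a b (step hv).1 (step ha).1 (step hb).1, (step ha).2.2, (step hb).2.2⟩
        root_alone := by rw [hh, hh, hh]; exact hc.root_alone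
        left_end := fun p hp => by
          rw [hh, hh' (step hp).2.1 (lc (step hp).1)]
          exact hc.left_end p (step hp).1
        right_end := fun p hp => by
          rw [hh, hh' (step hp).2.1 (rc (step hp).1)]
          exact hc.right_end p (step hp).1
        head_port1 := by rw [hh, hh]; exact hc.head_port1
        head_port2 := by rw [hh, hh]; exact hc.head_port2
        port_root := by rw [hh, hh]; exact hc.port_root
        port_leaf := by rw [hh, hh, hh]; exact hc.port_leaf }

variable {Γ : Type}

open Classical in
/-- The output of a node: it is marked if it has to be, and outputs `o` otherwise. -/
noncomputable def markOutput (G : GadgetGraph) (rank : ℕ) (u : G.V) (o : Option Γ) :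
    LiftOutput Γ :=
  if ¬ Constraint G rank u then .error
  else if Down G rank (depth G) u then .down
  else if Marked G rank u then .up
  else .unmarked o

theorem markOutput_of_not_marked (hu : ¬ Marked G rank u) (o : Option Γ) :
    markOutput G rank u o = .unmarked o := by
  rw [markOutput, if_neg (not_not.2 (constraint_of_not_marked hu)),
    if_neg (not_down_of_not_marked hu), if_neg hu]

theorem isUnmarked_markOutput_iff (o : Option Γ) :
    (markOutput G rank u o).IsUnmarked ↔ ¬ Marked G rank u := by
  constructor
  · rintro ⟨o', h⟩ hu
    unfold markOutput at h
    split_ifs at h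
  · exact fun hu => ⟨o, markOutput_of_not_marked hu o⟩

/-- The order of the cases in `markOutput` matters: the next node on a path down to an error is
again an error or has an error below it, so it outputs `error` or `down`. A pointer up only needs
some marked node above. -/
theorem badGraphRule_markOutput (o : G.V → Option Γ) (u : G.V) :
    BadGraphRule G rank (fun v => markOutput G rank v (o v)) u := by
  have hun : ∀ v, (markOutput G rank v (o v)).IsUnmarked ↔ ¬ Marked G rank v :=
    fun v => isUnmarked_markOutput_iff _
  by_cases hc : Constraint G rank u
  · by_cases hd : Down G rank (depth G) u
    · have h : markOutput G rank u (o u) = .down := by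
        rw [markOutput, if_neg (not_not.2 hc), if_pos hd]
      simp only [BadGraphRule, h]
      obtain ⟨v, hs, hv⟩ := hd.exists_stepDown hc
      refine ⟨v, hs, ?_⟩
      unfold markOutput
      split_ifs <;> simp
    · by_cases hm : Marked G rank u
      · have h : markOutput G rank u (o u) = .up := by
          rw [markOutput, if_neg (not_not.2 hc), if_neg hd, if_pos hm]
        simp only [BadGraphRule, h]
        obtain ⟨v, hs, hv⟩ := hm.exists_stepUp hd
        exact ⟨v, hs, fun h => (hun v).1 h hv⟩
      · have hS : {v | (markOutput G rank v (o v)).IsUnmarked} = {v | ¬ Marked G rank v} :=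
          Set.ext hun
        simp only [BadGraphRule, markOutput_of_not_marked hm]
        rw [hS]
        exact constraint_keep hm
  · have h : markOutput G rank u (o u) = .error := by rw [markOutput, if_pos hc]
    simp only [BadGraphRule, h]
    exact hc


/-! ### Octopus gadgets of unmarked nodes -/

theorem cleanBelow_of_not_marked {x : G.V} (hx : ¬ Marked G rank x) (l : ℕ) :
    CleanBelow G rank x l :=
  cleanBelow_of_not_down (not_down_of_not_marked hx) l

theorem Pos.node_eq {x : G.V} {l k : ℕ} (h : Pos G x l k u) (hx : ¬ Marked G rank x) :
    G.node u = G.node x :=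
  h.kind (cleanBelow_of_not_marked hx l)

theorem Pos.lt_height_of_not_marked {x : G.V} {l k : ℕ} (h : Pos G x l k u)
    (hx : ¬ Marked G rank x) : l < height G :=
  h.lt_height_of_not_down (not_down_of_not_marked hx)

/-- A node is the descendant of at most one root, at one position. -/
theorem Pos.root_unique {r r' : G.V} {l : ℕ} (hr : ¬ G.Has parent r) (hr' : ¬ G.Has parent r') :
    ∀ {k l' k' : ℕ} {u : G.V}, ¬ Marked G rank u → Pos G r l k u → Pos G r' l' k' u →
      r = r' ∧ l = l' ∧ k = k' := by
  induction l with
  | zero =>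
    intro k l' k' u hu h h'
    obtain ⟨rfl, rfl⟩ := h.zero
    cases l' with
    | zero => exact ⟨h'.zero.2, rfl, h'.zero.1.symm⟩
    | succ l' =>
      obtain ⟨j, p, -, hs, -⟩ := h'.step_parent
        (cleanBelow_of_not_marked (h'.not_marked_of_pos hu) _)
      exact absurd ⟨p, hs⟩ hr
  | succ l ih =>
    intro k l' k' u hu h h'
    obtain ⟨j, p, hp, hs, hk, hk', hj⟩ := h.step_parent
      (cleanBelow_of_not_marked (h.not_marked_of_pos hu) _)
    cases l' with
    | zero =>
      obtain ⟨-, rfl⟩ := h'.zero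
      exact absurd ⟨p, hs⟩ hr'
    | succ l' =>
      obtain ⟨j', p', hp', hs', -, -, hj'⟩ := h'.step_parent
        (cleanBelow_of_not_marked (h'.not_marked_of_pos hu) _)
      obtain rfl := (constraint_of_not_marked hu).unique (hk ▸ hk') hs hs'
      obtain ⟨rfl, rfl, rfl⟩ := ih (not_marked_of_stepUp hu (.inl hs)) hp hp'
      refine ⟨rfl, rfl, ?_⟩
      rcases hj with ⟨e, h1⟩ | ⟨e, h1⟩ <;> rcases hj' with ⟨e', h2⟩ | ⟨e', h2⟩ <;> simp_all

/-- The root of a head-gadget that consists of unmarked nodes. -/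
structure IsRoot (G : GadgetGraph) (rank : ℕ) (r : G.V) : Prop where
  not_marked : ¬ Marked G rank r
  head : G.node r = .head
  not_has_parent : ¬ G.Has parent r

/-- `p` is the root of the port-gadget with key `κ` of the octopus gadget with root `r`: the keys
`2 * k` and `2 * k + 1` belong to the port-gadgets at the `k`-th leaf of the head-gadget. -/
def KeyOf (G : GadgetGraph) (rank : ℕ) (r : G.V) (κ : ℕ) (p : G.V) : Prop :=
  IsRoot G rank r ∧ ∃ l k h, Pos G r l k h ∧
    ((κ = 2 * k ∧ G.Step port1 h p) ∨ (κ = 2 * k + 1 ∧ G.Step port2 h p))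

def IsKey (G : GadgetGraph) (rank : ℕ) (r : G.V) (κ : ℕ) : Prop :=
  ∃ p, KeyOf G rank r κ p

open Classical in
/-- The number of port-gadgets to the left of the one with key `κ`. -/
noncomputable def portIndex (G : GadgetGraph) (rank : ℕ) (r : G.V) (κ : ℕ) : ℕ :=
  Nat.count (IsKey G rank r) κ

/-- `p` is the root of the `i`-th port-gadget of the octopus gadget with root `r`. -/
def PortOf (G : GadgetGraph) (rank : ℕ) (r : G.V) (i : ℕ) (p : G.V) : Prop :=
  ∃ κ, KeyOf G rank r κ p ∧ i = portIndex G rank r κ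

/-- `u` belongs to the `i`-th port-gadget of the octopus gadget with root `r`. -/
def PortMem (G : GadgetGraph) (rank : ℕ) (r : G.V) (i : ℕ) (u : G.V) : Prop :=
  ∃ p l k, PortOf G rank r i p ∧ Pos G p l k u

/-- `u` belongs to the octopus gadget with root `r`. -/
def Mem (G : GadgetGraph) (rank : ℕ) (r u : G.V) : Prop :=
  (IsRoot G rank r ∧ ∃ l k, Pos G r l k u) ∨ ∃ i, PortMem G rank r i u

/-- The `i`-th port-gadget of the octopus gadget with root `r` has the left-most leaf `x`, which is
adjacent to the inter-octopus node `b`. -/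
def Attached (G : GadgetGraph) (rank : ℕ) (r : G.V) (i : ℕ) (x b : G.V) : Prop :=
  ∃ p l, PortOf G rank r i p ∧ Pos G p l 0 x ∧ G.Step toInter x b

theorem KeyOf.exists_head {r p : G.V} {κ : ℕ} (h : KeyOf G rank r κ p) :
    ∃ l k x, Pos G r l k x ∧ ¬ Marked G rank x ∧ G.node x = .head ∧ G.Step toHead p x ∧
      ((κ = 2 * k ∧ G.Step port1 x p) ∨ (κ = 2 * k + 1 ∧ G.Step port2 x p)) := by
  obtain ⟨hr, l, k, x, hx, hs⟩ := h
  have hm := hx.not_marked hr.not_marked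
  have hc := constraint_of_not_marked hm
  refine ⟨l, k, x, hx, hm, (hx.node_eq hr.not_marked).trans hr.head, ?_, hs⟩
  rcases hs with ⟨-, hs⟩ | ⟨-, hs⟩
  · exact ((hc.good hs.1).of_port1 hs).1
  · exact ((hc.good hs.1).of_port2 hs).1

theorem KeyOf.not_marked {r p : G.V} {κ : ℕ} (h : KeyOf G rank r κ p) : ¬ Marked G rank p := by
  obtain ⟨l, k, x, -, hm, hk, hs, -⟩ := h.exists_head
  exact not_marked_of_adj hm (by simp [hk]) hs.1.symm

theorem KeyOf.node_eq {r p : G.V} {κ : ℕ} (h : KeyOf G rank r κ p) : G.node p = .port := by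
  obtain ⟨l, k, x, -, hm, -, hs, -⟩ := h.exists_head
  exact (((constraint_of_not_marked h.not_marked).good hs.1).of_toHead hs).2.1

theorem KeyOf.not_has_parent {r p : G.V} {κ : ℕ} (h : KeyOf G rank r κ p) :
    ¬ G.Has parent p := by
  obtain ⟨l, k, x, -, -, -, hs, -⟩ := h.exists_head
  exact ((constraint_of_not_marked h.not_marked).port_root h.node_eq).1 ⟨x, hs⟩

/-- A layer index is below `2 ^ l`, and `2 ^ l` is at most the number of nodes. So counting keys
below `2 * Fintype.card G.V` counts all port-gadgets. -/
theorem KeyOf.lt {r p : G.V} {κ : ℕ} (h : KeyOf G rank r κ p) : κ < 2 * Fintype.card G.V := by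
  obtain ⟨l, k, x, hx, -, -, -, hs⟩ := h.exists_head
  have := hx.lt
  have := hx.two_pow_le (cleanBelow_of_not_marked h.1.not_marked _)
  omega

theorem KeyOf.root_unique {r r' p : G.V} {κ κ' : ℕ} (h : KeyOf G rank r κ p)
    (h' : KeyOf G rank r' κ' p) : r = r' ∧ κ = κ' := by
  have hr := h.1.not_has_parent
  have hr' := h'.1.not_has_parent
  have hp := h.not_marked
  have hk := h.node_eq
  obtain ⟨l, k, x, hx, hm, -, hs, hκ⟩ := h.exists_head
  obtain ⟨l', k', x', hx', -, -, hs', hκ'⟩ := h'.exists_head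
  obtain rfl := (constraint_of_not_marked hp).unique (by simp [hk]) hs hs'
  obtain ⟨rfl, -, rfl⟩ := Pos.root_unique hr hr' hm hx hx'
  refine ⟨rfl, ?_⟩
  rcases hκ with ⟨e, h1⟩ | ⟨e, h1⟩ <;> rcases hκ' with ⟨e', h2⟩ | ⟨e', h2⟩
  · omega
  · exact absurd (h1.2.symm.trans h2.2) (by simp)
  · exact absurd (h1.2.symm.trans h2.2) (by simp)
  · omega

/-- All leaves of a gadget are in the same layer. -/
theorem Pos.layer_eq {r : G.V} {l l' k k' : ℕ} (hr : ¬ Marked G rank r) (h : Pos G r l k u)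
    (h' : Pos G r l' k' v) (hu : ¬ G.Has leftChild u) (hv : ¬ G.Has leftChild v) : l = l' := by
  have key : ∀ {l l' k k' : ℕ} {u v : G.V}, Pos G r l k u → Pos G r l' k' v →
      ¬ G.Has leftChild u → l' ≤ l := by
    intro l l' k k' u v h h' hu
    by_contra! hl
    obtain ⟨d, rfl⟩ := Nat.exists_eq_add_of_lt hl
    rw [show l + d + 1 = (l + 1) + d by omega] at h'
    obtain ⟨y, i, -, hy, -⟩ := h'.split
    obtain ⟨j, p, hp, hj⟩ := hy.succ
    have hcp := constraint_of_not_marked (hp.not_marked hr)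
    refine hu (hp.has_leftChild (cleanBelow_of_not_marked hr _) h ?_)
    rcases hj with ⟨-, hs⟩ | ⟨-, hs⟩
    · exact ⟨_, hs⟩
    · exact hcp.children_iff.2 ⟨_, hs⟩
  exact le_antisymm (key h' h hv) (key h h' hu)

theorem leaf_of_stepPort (hu : ¬ Marked G rank u) (hk : G.node u = .head)
    (h : G.Step port1 u v ∨ G.Step port2 u v) : ¬ G.Has leftChild u := by
  have hc := constraint_of_not_marked hu
  rcases h with h | h
  · exact (hc.head_port1 hk).1 ⟨v, h⟩
  · exact hc.head_port2 hk ⟨v, h⟩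

/-- A key records only the index of the leaf, not its layer; this suffices because all leaves of the
head-gadget lie in one layer. -/
theorem KeyOf.port_unique {r p p' : G.V} {κ : ℕ} (h : KeyOf G rank r κ p)
    (h' : KeyOf G rank r κ p') : p = p' := by
  have hr := h.1.not_marked
  obtain ⟨l, k, x, hx, hm, hk, -, hκ⟩ := h.exists_head
  obtain ⟨l', k', x', hx', hm', hk', -, hκ'⟩ := h'.exists_head
  have hl := leaf_of_stepPort hm hk (hκ.imp And.right And.right)
  have hl' := leaf_of_stepPort hm' hk' (hκ'.imp And.right And.right)
  obtain rfl := Pos.layer_eq hr hx hx' hl hl'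
  obtain rfl : k = k' := by omega
  obtain rfl := hx.eq (cleanBelow_of_not_marked hr _) hx'
  have hc := constraint_of_not_marked hm
  rcases hκ with ⟨e, h1⟩ | ⟨e, h1⟩ <;> rcases hκ' with ⟨e', h2⟩ | ⟨e', h2⟩
  · exact hc.unique (by simp [hk]) h1 h2
  · omega
  · omega
  · exact hc.unique (by simp [hk]) h1 h2

theorem PortOf.not_marked {r p : G.V} {i : ℕ} (h : PortOf G rank r i p) : ¬ Marked G rank p :=
  h.choose_spec.1.not_marked

theorem PortOf.isRoot {r p : G.V} {i : ℕ} (h : PortOf G rank r i p) : IsRoot G rank r :=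
  h.choose_spec.1.1

theorem PortOf.node_eq {r p : G.V} {i : ℕ} (h : PortOf G rank r i p) : G.node p = .port :=
  h.choose_spec.1.node_eq

theorem PortOf.not_has_parent {r p : G.V} {i : ℕ} (h : PortOf G rank r i p) :
    ¬ G.Has parent p :=
  h.choose_spec.1.not_has_parent

theorem PortOf.root_unique {r r' p : G.V} {i i' : ℕ} (h : PortOf G rank r i p)
    (h' : PortOf G rank r' i' p) : r = r' ∧ i = i' := by
  obtain ⟨κ, hκ, rfl⟩ := h
  obtain ⟨κ', hκ', rfl⟩ := h'
  obtain ⟨rfl, rfl⟩ := hκ.root_unique hκ'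
  exact ⟨rfl, rfl⟩

theorem PortOf.port_unique {r p p' : G.V} {i : ℕ} (h : PortOf G rank r i p)
    (h' : PortOf G rank r i p') : p = p' := by
  classical
  obtain ⟨κ, hκ, rfl⟩ := h
  obtain ⟨κ', hκ', e⟩ := h'
  obtain rfl := Nat.count_injective ⟨p, hκ⟩ ⟨p', hκ'⟩ e
  exact hκ.port_unique hκ'

/-- The number of port-gadgets of the octopus gadget with root `r`. -/
noncomputable def portCount (G : GadgetGraph) (rank : ℕ) (r : G.V) : ℕ :=
  portIndex G rank r (2 * Fintype.card G.V)

theorem KeyOf.portIndex_lt {r p : G.V} {κ κ' : ℕ} (h : KeyOf G rank r κ p) (hκ : κ < κ') :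
    portIndex G rank r κ < portIndex G rank r κ' := by
  classical
  exact Nat.count_strict_mono ⟨p, h⟩ hκ

theorem PortOf.lt {r p : G.V} {i : ℕ} (h : PortOf G rank r i p) : i < portCount G rank r := by
  obtain ⟨κ, hκ, rfl⟩ := h
  exact hκ.portIndex_lt hκ.lt

/-- `Nat.count` rises by one at each key and stays constant elsewhere, so it takes every value below
its final one at a key. -/
theorem exists_portOf {r : G.V} {i : ℕ} (h : i < portCount G rank r) :
    ∃ p, PortOf G rank r i p := by
  classical
  have key : ∀ N, i < portIndex G rank r N →
      ∃ κ, IsKey G rank r κ ∧ i = portIndex G rank r κ := by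
    intro N
    induction N with
    | zero => simp [portIndex]
    | succ N ih =>
      intro hi
      by_cases hN : i < portIndex G rank r N
      · exact ih hN
      · unfold portIndex at hi hN ⊢
        rw [Nat.count_succ] at hi
        split_ifs at hi with hk
        · exact ⟨N, hk, by omega⟩
        · exact absurd hi hN
  obtain ⟨κ, ⟨p, hp⟩, e⟩ := key _ h
  exact ⟨p, κ, hp, e⟩

theorem portIndex_succ {r p : G.V} {κ : ℕ} (h : KeyOf G rank r κ p) :
    portIndex G rank r (κ + 1) = portIndex G rank r κ + 1 := by
  classical
  exact Nat.count_succ_eq_succ_count_iff.2 ⟨p, h⟩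

theorem portIndex_succ_of_not {r : G.V} {κ : ℕ} (h : ¬ IsKey G rank r κ) :
    portIndex G rank r (κ + 1) = portIndex G rank r κ := by
  classical
  exact Nat.count_succ_eq_count_iff.2 h

/-- Below an unmarked node, there is a left-most leaf. -/
theorem exists_leftmost_leaf (hu : ¬ Marked G rank u) :
    ∃ l x, Pos G u l 0 x ∧ ¬ G.Has leftChild x := by
  by_contra! hno
  have key : ∀ m, ∃ x, Pos G u m 0 x := by
    intro m
    induction m with
    | zero => exact ⟨u, .refl⟩
    | succ m ih =>
      obtain ⟨x, hx⟩ := ih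
      obtain ⟨y, hy⟩ := hno m x hx
      exact ⟨y, hx.left hy⟩
  obtain ⟨x, hx⟩ := key (height G)
  exact lt_irrefl _ (hx.lt_height_of_not_marked hu)

theorem PortOf.exists_attached {r p : G.V} {i : ℕ} (h : PortOf G rank r i p) :
    ∃ x b, Attached G rank r i x b := by
  obtain ⟨l, x, hx, hl⟩ := exists_leftmost_leaf h.not_marked
  have hm := hx.not_marked h.not_marked
  have hk := (hx.node_eq h.not_marked).trans h.node_eq
  -- A left neighbour would sit at an index `j` with `0 = j + 1`.
  have hleft : ¬ G.Has left x := by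
    rintro ⟨y, hy⟩
    obtain ⟨-, j, hj, -⟩ := (hx.lateral h.not_has_parent hm).2 y hy
    omega
  obtain ⟨b, hb⟩ := ((constraint_of_not_marked hm).port_leaf hk).2 ⟨hl, hleft⟩
  exact ⟨x, b, p, l, h, hx, hb⟩

theorem Attached.not_marked {r x b : G.V} {i : ℕ} (h : Attached G rank r i x b) :
    ¬ Marked G rank x := by
  obtain ⟨p, l, hp, hx, -⟩ := h
  exact hx.not_marked hp.not_marked

theorem Attached.node_eq {r x b : G.V} {i : ℕ} (h : Attached G rank r i x b) :
    G.node x = .port := by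
  obtain ⟨p, l, hp, hx, -⟩ := h
  exact (hx.node_eq hp.not_marked).trans hp.node_eq

theorem Attached.portMem {r x b : G.V} {i : ℕ} (h : Attached G rank r i x b) :
    PortMem G rank r i x := by
  obtain ⟨p, l, hp, hx, -⟩ := h
  exact ⟨p, l, 0, hp, hx⟩

theorem Attached.lt {r x b : G.V} {i : ℕ} (h : Attached G rank r i x b) :
    i < portCount G rank r := by
  obtain ⟨p, l, hp, -, -⟩ := h
  exact hp.lt

theorem Attached.step {r x b : G.V} {i : ℕ} (h : Attached G rank r i x b) :
    G.Step toInter x b := by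
  obtain ⟨p, l, -, -, hs⟩ := h
  exact hs

theorem Attached.inter {r x b : G.V} {i : ℕ} (h : Attached G rank r i x b) :
    G.node b = .inter :=
  (((constraint_of_not_marked h.not_marked).good h.step.1).of_toInter h.step).2.2

theorem Attached.inter_not_marked {r x b : G.V} {i : ℕ} (h : Attached G rank r i x b) :
    ¬ Marked G rank b :=
  not_marked_of_adj h.not_marked (by simp [h.node_eq]) h.step.1

theorem Attached.isRoot {r x b : G.V} {i : ℕ} (h : Attached G rank r i x b) :
    IsRoot G rank r := by
  obtain ⟨p, l, hp, -, -⟩ := h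
  exact hp.isRoot

theorem Attached.unique {r x b x' b' : G.V} {i : ℕ} (h : Attached G rank r i x b)
    (h' : Attached G rank r i x' b') : x = x' ∧ b = b' := by
  have hm := h.not_marked
  have hk := h.node_eq
  have hm' := h'.not_marked
  have hk' := h'.node_eq
  obtain ⟨p, l, hp, hx, hs⟩ := h
  obtain ⟨p', l', hp', hx', hs'⟩ := h'
  obtain rfl := hp.port_unique hp'
  have hc := constraint_of_not_marked hm
  have hc' := constraint_of_not_marked hm'
  obtain rfl := Pos.layer_eq hp.not_marked hx hx' ((hc.port_leaf hk).1 ⟨b, hs⟩).1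
    ((hc'.port_leaf hk').1 ⟨b', hs'⟩).1
  obtain rfl := hx.eq (cleanBelow_of_not_marked hp.not_marked _) hx'
  exact ⟨rfl, hc.unique (by simp [hk]) hs hs'⟩

theorem PortMem.unique {r r' : G.V} {i i' : ℕ} (h : PortMem G rank r i u)
    (h' : PortMem G rank r' i' u) : r = r' ∧ i = i' := by
  obtain ⟨p, l, k, hp, hu⟩ := h
  obtain ⟨p', l', k', hp', hu'⟩ := h'
  obtain ⟨rfl, -, -⟩ := Pos.root_unique hp.not_has_parent hp'.not_has_parent
    (hu.not_marked hp.not_marked) hu hu'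
  exact hp.root_unique hp'

theorem PortMem.not_marked {r : G.V} {i : ℕ} (h : PortMem G rank r i u) : ¬ Marked G rank u := by
  obtain ⟨p, l, k, hp, hu⟩ := h
  exact hu.not_marked hp.not_marked

theorem PortMem.node_eq {r : G.V} {i : ℕ} (h : PortMem G rank r i u) : G.node u = .port := by
  obtain ⟨p, l, k, hp, hu⟩ := h
  exact (hu.node_eq hp.not_marked).trans hp.node_eq

theorem Mem.unique {r r' : G.V} (h : Mem G rank r u) (h' : Mem G rank r' u) : r = r' := by
  rcases h with ⟨hr, l, k, h⟩ | ⟨i, h⟩ <;> rcases h' with ⟨hr', l', k', h'⟩ | ⟨i', h'⟩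
  · exact (Pos.root_unique hr.not_has_parent hr'.not_has_parent (h.not_marked hr.not_marked)
      h h').1
  · exact absurd (h'.node_eq.symm.trans ((h.node_eq hr.not_marked).trans hr.head)) (by simp)
  · exact absurd (h.node_eq.symm.trans ((h'.node_eq hr'.not_marked).trans hr'.head)) (by simp)
  · exact (h.unique h').1

theorem exists_isRoot (hu : ¬ Marked G rank u) (hk : G.node u = .head) :
    ∃ r l k, IsRoot G rank r ∧ Pos G r l k u := by
  obtain ⟨r, l, k, h, hr⟩ := exists_root hu
  have hm := h.not_marked_of_pos hu
  exact ⟨r, l, k, ⟨hm, (h.node_eq hm).symm.trans hk, hr⟩, h⟩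

theorem exists_portMem (hu : ¬ Marked G rank u) (hk : G.node u = .port) :
    ∃ r i, PortMem G rank r i u := by
  obtain ⟨p, l, k, h, hp⟩ := exists_root hu
  have hm := h.not_marked_of_pos hu
  have hpk := (h.node_eq hm).symm.trans hk
  have hc := constraint_of_not_marked hm
  obtain ⟨x, hx⟩ := (hc.port_root hpk).2 hp
  have hmx := not_marked_of_stepUp hm (.inr hx)
  have := (hc.good hx.1).of_toHead hx
  obtain ⟨r, l', k', hr, hrx⟩ := exists_isRoot hmx this.2.2
  rcases this.1 with hs | hs
  · exact ⟨r, _, p, l, k, ⟨2 * k', ⟨hr, l', k', x, hrx, .inl ⟨rfl, hs⟩⟩, rfl⟩, h⟩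
  · exact ⟨r, _, p, l, k, ⟨2 * k' + 1, ⟨hr, l', k', x, hrx, .inr ⟨rfl, hs⟩⟩, rfl⟩, h⟩

/-- Adjacent nodes of port-gadgets belong to the same port-gadget. -/
theorem PortMem.of_adj {r : G.V} {i : ℕ} (h : PortMem G rank r i u) (ha : G.graph.Adj u v)
    (hv : G.node v = .port) : PortMem G rank r i v := by
  have hm := h.not_marked
  have hk := h.node_eq
  obtain ⟨p, l, k, hp, hu⟩ := h
  have hc := constraint_of_not_marked hm
  have hl := hu.lateral hp.not_has_parent hm
  have htab := (hc.good ha).table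
  cases hh : G.half u v with
  | left =>
    obtain ⟨-, j, -, hj⟩ := hl.2 v ⟨ha, hh⟩
    exact ⟨p, l, j, hp, hj⟩
  | right => exact ⟨p, l, _, hp, (hl.1 v ⟨ha, hh⟩).2⟩
  | leftChild => exact ⟨p, _, _, hp, hu.left ⟨ha, hh⟩⟩
  | rightChild => exact ⟨p, _, _, hp, hu.right ⟨ha, hh⟩⟩
  | parent =>
    cases l with
    | zero =>
      obtain ⟨-, rfl⟩ := hu.zero
      exact absurd ⟨v, ha, hh⟩ hp.not_has_parent
    | succ l =>
      obtain ⟨j, q, hq, hs, -⟩ := hu.step_parent (cleanBelow_of_not_marked hp.not_marked _)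
      obtain rfl := hc.unique (a := .parent) (by simp [hk]) ⟨ha, hh⟩ hs
      exact ⟨p, l, j, hp, hq⟩
  | port1 => simp [hh, EdgeTable, hk] at htab
  | port2 => simp [hh, EdgeTable, hk] at htab
  | toHead => simp [hh, EdgeTable, hv] at htab
  | toInter => simp [hh, EdgeTable, hv] at htab
  | toPort => simp [hh, EdgeTable, hk] at htab

/-- A node adjacent to an inter-octopus node is the left-most leaf of its port-gadget. -/
theorem PortMem.attached {r b : G.V} {i : ℕ} (h : PortMem G rank r i u)
    (hs : G.Step toInter u b) : Attached G rank r i u b := by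
  have hm := h.not_marked
  have hk := h.node_eq
  obtain ⟨p, l, k, hp, hu⟩ := h
  have hleaf := ((constraint_of_not_marked hm).port_leaf hk).1 ⟨b, hs⟩
  have hc := cleanBelow_of_not_marked hp.not_marked l
  cases k with
  | zero => exact ⟨p, l, hp, hu, hs⟩
  | succ k =>
    obtain ⟨y, hy⟩ := hu.full hc k (by have := hu.lt; omega)
    have hyu := hy.step_right hc hu
    exact absurd ⟨y, (((constraint_of_not_marked hm).good' hyu.1).of_right hyu).1⟩ hleaf.2

/-! ### The order of the port-gadgets -/

theorem PortOf.portMem {r p : G.V} {i : ℕ} (h : PortOf G rank r i p) : PortMem G rank r i p :=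
  ⟨p, 0, 0, h, .refl⟩

theorem keyOf_of_port1 {r p x : G.V} {l k : ℕ} (hr : IsRoot G rank r) (hx : Pos G r l k x)
    (hs : G.Step port1 x p) : KeyOf G rank r (2 * k) p :=
  ⟨hr, l, k, x, hx, .inl ⟨rfl, hs⟩⟩

theorem keyOf_of_port2 {r p x : G.V} {l k : ℕ} (hr : IsRoot G rank r) (hx : Pos G r l k x)
    (hs : G.Step port2 x p) : KeyOf G rank r (2 * k + 1) p :=
  ⟨hr, l, k, x, hx, .inr ⟨rfl, hs⟩⟩

/-- The right-most port-gadget at a leaf precedes those of the leaves to the right. -/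
theorem portOf_of_lastPort {r p x : G.V} {l k : ℕ} (hr : IsRoot G rank r) (hx : Pos G r l k x)
    (hs : LastPort G x p) :
    ∃ i, PortOf G rank r i p ∧ portIndex G rank r (2 * k + 2) = i + 1 := by
  rcases hs with hs | ⟨hno, hs⟩
  · have hk := keyOf_of_port2 hr hx hs
    exact ⟨_, ⟨_, hk, rfl⟩, portIndex_succ hk⟩
  · have hk := keyOf_of_port1 hr hx hs
    refine ⟨_, ⟨_, hk, rfl⟩, ?_⟩
    rw [← portIndex_succ hk]
    -- The key `2 * k + 1` could only come from a second port-gadget at the same leaf.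
    refine portIndex_succ_of_not fun ⟨q, hq⟩ => ?_
    obtain ⟨l', k', x', hx', hm', hk', -, hκ⟩ := hq.exists_head
    have hm := hx.not_marked hr.not_marked
    have hl := leaf_of_stepPort hm ((hx.node_eq hr.not_marked).trans hr.head) (.inl hs)
    have hl' := leaf_of_stepPort hm' hk' (hκ.imp And.right And.right)
    obtain rfl := Pos.layer_eq hr.not_marked hx hx' hl hl'
    rcases hκ with ⟨e, -⟩ | ⟨e, h2⟩
    · omega
    · obtain rfl : k = k' := by omega
      obtain rfl := hx.eq (cleanBelow_of_not_marked hr.not_marked _) hx'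
      exact hno ⟨q, h2⟩

/-- The right-most port-gadget of an octopus gadget. -/
theorem portOf_last {r p x : G.V} {l k : ℕ} (hr : IsRoot G rank r) (hx : Pos G r l k x)
    (hright : ¬ G.Has .right x) (hs : LastPort G x p) :
    ∃ i, PortOf G rank r i p ∧ portCount G rank r = i + 1 := by
  obtain ⟨i, hi, e⟩ := portOf_of_lastPort hr hx hs
  refine ⟨i, hi, ?_⟩
  have hlt := hi.lt
  by_contra hne
  -- A further port-gadget would have a key of at least `2 * k + 2`, hence hang at a leaf to the
  -- right of `x`; the full layer then gives `x` a right neighbour.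
  obtain ⟨q, hq⟩ := exists_portOf (show i + 1 < portCount G rank r by omega)
  obtain ⟨κ, hκ, e'⟩ := hq
  have hκk : ¬ κ < 2 * k + 2 := fun h => by
    have := hκ.portIndex_lt h
    omega
  obtain ⟨l', k', x', hx', hm', hk', -, hκ'⟩ := hκ.exists_head
  have hm := hx.not_marked hr.not_marked
  have hl := leaf_of_stepPort (v := p) hm ((hx.node_eq hr.not_marked).trans hr.head)
    (hs.elim .inr fun h => .inl h.2)
  have hl' := leaf_of_stepPort hm' hk' (hκ'.imp And.right And.right)
  obtain rfl := Pos.layer_eq hr.not_marked hx hx' hl hl'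
  have hc := cleanBelow_of_not_marked hr.not_marked l
  obtain ⟨y, hy⟩ := hx.full hc (k + 1) (by have := hx'.lt; omega)
  exact hright ⟨y, hx.step_right hc hy⟩

theorem portOf_first {r p x : G.V} {l k : ℕ} (hr : IsRoot G rank r) (hx : Pos G r l k x)
    (hleft : ¬ G.Has .left x) (hs : G.Step port1 x p) : PortOf G rank r 0 p := by
  have hc := cleanBelow_of_not_marked hr.not_marked l
  cases k with
  | zero =>
    refine ⟨_, keyOf_of_port1 hr hx hs, ?_⟩
    simp [portIndex]
  | succ k =>
    obtain ⟨y, hy⟩ := hx.full hc k (by have := hx.lt; omega)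
    have hyx := hy.step_right hc hx
    have := constraint_of_not_marked (hx.not_marked hr.not_marked)
    exact absurd ⟨y, ((this.good' hyx.1).of_right hyx).1⟩ hleft

theorem portOf_pair_same_leaf {r p q x : G.V} {l k : ℕ} (hr : IsRoot G rank r)
    (hx : Pos G r l k x) (hp : G.Step port1 x p) (hq : G.Step port2 x q) :
    ∃ i, PortOf G rank r i p ∧ PortOf G rank r (i + 1) q :=
  ⟨_, ⟨_, keyOf_of_port1 hr hx hp, rfl⟩, _, keyOf_of_port2 hr hx hq,
    (portIndex_succ (keyOf_of_port1 hr hx hp)).symm⟩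

theorem portOf_pair_next_leaf {r p q x y : G.V} {l k : ℕ} (hr : IsRoot G rank r)
    (hx : Pos G r l k x) (hxy : G.Step .right x y) (hp : LastPort G x p)
    (hq : G.Step port1 y q) : ∃ i, PortOf G rank r i p ∧ PortOf G rank r (i + 1) q := by
  obtain ⟨i, hi, e⟩ := portOf_of_lastPort hr hx hp
  have hy := ((hx.lateral hr.not_has_parent (hx.not_marked hr.not_marked)).1 y hxy).2
  exact ⟨i, hi, _, keyOf_of_port1 hr hy hq, e.symm⟩

/-! ### The virtual multigraph -/

theorem exists_attached {r : G.V} {i : ℕ} (h : i < portCount G rank r) :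
    ∃ b : {b : G.V // G.node b = .inter}, ∃ x, Attached G rank r i x b := by
  obtain ⟨p, hp⟩ := exists_portOf h
  obtain ⟨x, b, hb⟩ := hp.exists_attached
  exact ⟨⟨b, hb.inter⟩, x, hb⟩

/-- The multigraph whose white nodes stand for the octopus gadgets, and whose black nodes are the
inter-octopus nodes. The root of a head-gadget stands for the octopus gadget, all other nodes of
head- and port-gadgets are isolated white nodes. -/
noncomputable def virtualGraph (G : GadgetGraph) (rank : ℕ) : IncidenceMultigraph :=
  open Classical in
  { W := {u : G.V // G.node u ≠ .inter}
    B := {u : G.V // G.node u = .inter}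
    deg := fun w => portCount G rank w
    nbr := fun _ i => (exists_attached i.2).choose }

theorem virtualGraph_nbr_eq_iff {w : (virtualGraph G rank).W}
    {i : Fin ((virtualGraph G rank).deg w)} {b : (virtualGraph G rank).B} :
    (virtualGraph G rank).nbr w i = b ↔ ∃ x, Attached G rank w.1 i x b.1 := by
  have h := (exists_attached (G := G) (rank := rank) (r := w.1) i.2).choose_spec
  constructor
  · rintro rfl
    exact h
  · rintro ⟨x, hx⟩
    obtain ⟨y, hy⟩ := h
    exact Subtype.ext (hy.unique hx).2

/-- The white node of the virtual network that a node stands for. -/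
def netWhite (G : GadgetGraph) (rank : ℕ) (u : G.V) (h : G.node u ≠ .inter) :
    (virtualGraph G rank).net.V :=
  .inl (show (virtualGraph G rank).W from ⟨u, h⟩)

/-- The black node of the virtual network that a node stands for. -/
def netBlack (G : GadgetGraph) (rank : ℕ) (u : G.V) (h : G.node u = .inter) :
    (virtualGraph G rank).net.V :=
  .inr (show (virtualGraph G rank).B from ⟨u, h⟩)

open Classical in
/-- The node of the virtual network that a node stands for. -/
noncomputable def toNet (G : GadgetGraph) (rank : ℕ) (u : G.V) : (virtualGraph G rank).net.V :=
  if h : G.node u = .inter then netBlack G rank u h else netWhite G rank u h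

def ofNet (G : GadgetGraph) (rank : ℕ) : (virtualGraph G rank).net.V → G.V :=
  Sum.elim Subtype.val Subtype.val

theorem toNet_of_inter (h : G.node u = .inter) : toNet G rank u = netBlack G rank u h :=
  dif_pos h

theorem toNet_of_ne_inter (h : G.node u ≠ .inter) : toNet G rank u = netWhite G rank u h :=
  dif_neg h

theorem ofNet_toNet (u : G.V) : ofNet G rank (toNet G rank u) = u := by
  by_cases h : G.node u = .inter
  · rw [toNet_of_inter h]
    rfl
  · rw [toNet_of_ne_inter h]
    rfl

theorem toNet_ofNet (x : (virtualGraph G rank).net.V) : toNet G rank (ofNet G rank x) = x := by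
  rcases x with ⟨u, h⟩ | ⟨u, h⟩
  · exact toNet_of_ne_inter h
  · exact toNet_of_inter h

theorem ofNet_injective : Function.Injective (ofNet G rank) :=
  Function.LeftInverse.injective toNet_ofNet

/-- This equality is the purpose of the isolated white nodes: the simulated algorithm gets the same
`n`, hence the same radius `T n` and the same range of identifiers. -/
theorem card_net : Fintype.card (virtualGraph G rank).net.V = Fintype.card G.V :=
  Fintype.card_congr ⟨ofNet G rank, toNet G rank, toNet_ofNet, ofNet_toNet⟩

end GadgetGraph

/-- The relation `Z` acts as a bijection between `s` and `t`. It serves to compare multisets of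
half-edge labels, and later the neighbours of an inter-octopus node with the edges at a virtual
black node. -/
theorem Finset.map_val_eq_map_val_of_rel {α β γ : Type*} {s : Finset α} {t : Finset β}
    (Z : α → β → Prop) {f : α → γ} {g : β → γ} (forth : ∀ a ∈ s, ∃ b ∈ t, Z a b ∧ f a = g b)
    (back : ∀ b ∈ t, ∃ a ∈ s, Z a b)
    (inj : ∀ a a' b b', Z a b → Z a' b' → (a = a' ↔ b = b')) :
    s.val.map f = t.val.map g := by
  choose i hi hZ hf using forth
  refine Multiset.map_eq_map_of_bij_of_nodup f g s.nodup t.nodup i hi ?_ ?_ hf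
  · exact fun a ha a' ha' h => (inj a a' _ _ (hZ a ha) (hZ a' ha')).2 h
  · intro b hb
    obtain ⟨a, ha, hab⟩ := back b hb
    exact ⟨a, ha, (inj a a _ _ (hZ a ha) hab).1 rfl⟩

namespace LabeledGraph

variable {X E S : Type}

/-! ### Back-and-forth systems -/

/-- A back-and-forth system between two networks: `Z k u u'` means that the radius-`k`
neighbourhoods of `u` and `u'` correspond to each other. -/
structure BackForth (G G' : LabeledGraph X E) (Z : ℕ → G.V → G'.V → Prop) : Prop where
  mono : ∀ {k u u'}, Z (k + 1) u u' → Z k u u'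
  forth : ∀ {k u u' w}, Z (k + 1) u u' → G.graph.Adj u w →
    ∃ w', Z k w w' ∧ G'.graph.Adj u' w' ∧ G.half u w = G'.half u' w' ∧ G.half w u = G'.half w' u'
  back : ∀ {k u u' w'}, Z (k + 1) u u' → G'.graph.Adj u' w' →
    ∃ w, Z k w w' ∧ G.graph.Adj u w ∧ G.half u w = G'.half u' w' ∧ G.half w u = G'.half w' u'
  node : ∀ {k u u'}, Z k u u' → G.node u = G'.node u'
  inj : ∀ {u u' w w'}, Z 0 u u' → Z 0 w w' → (u = w ↔ u' = w')
  card : Fintype.card G.V = Fintype.card G'.V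

namespace BackForth

variable {G G' : LabeledGraph X E} {Z : ℕ → G.V → G'.V → Prop}

theorem symm (B : BackForth G G' Z) : BackForth G' G fun k u' u => Z k u u' where
  mono := B.mono
  forth := fun h ha => by
    obtain ⟨w, h1, h2, h3, h4⟩ := B.back h ha
    exact ⟨w, h1, h2, h3.symm, h4.symm⟩
  back := fun h ha => by
    obtain ⟨w, h1, h2, h3, h4⟩ := B.forth h ha
    exact ⟨w, h1, h2, h3.symm, h4.symm⟩
  node := fun h => (B.node h).symm
  inj := fun h h' => (B.inj h h').symm
  card := B.card.symm

theorem le (B : BackForth G G' Z) {k m : ℕ} {u : G.V} {u' : G'.V} (h : Z m u u') (hk : k ≤ m) :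
    Z k u u' := by
  induction m, hk using Nat.le_induction with
  | base => exact h
  | succ m _ ih => exact ih (B.mono h)

theorem adj (B : BackForth G G' Z) {u w : G.V} {u' w' : G'.V} (hu : Z 1 u u') (hw : Z 0 w w')
    (ha : G.graph.Adj u w) : G'.graph.Adj u' w' ∧ G.half u w = G'.half u' w' := by
  obtain ⟨x, hx, h1, h2, -⟩ := B.forth hu ha
  obtain rfl := (B.inj hw hx).1 rfl
  exact ⟨h1, h2⟩

theorem walk (B : BackForth G G' Z) {k : ℕ} {u w : G.V} (p : G.graph.Walk u w) :
    ∀ {u' : G'.V}, Z (k + p.length) u u' →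
      ∃ w', Z k w w' ∧ ∃ p' : G'.graph.Walk u' w', p'.length = p.length := by
  induction p with
  | nil => exact fun {u'} h => ⟨u', h, .nil, rfl⟩
  | cons ha p ih =>
    intro u' h
    obtain ⟨x, hx, hx', -⟩ := B.forth (k := k + p.length) h ha
    obtain ⟨w', hw', p', hp'⟩ := ih hx
    exact ⟨w', hw', .cons hx' p', by simp [hp']⟩

theorem ball (B : BackForth G G' Z) {k T : ℕ} {v u : G.V} {v' : G'.V} (hv : Z (k + T) v v')
    (hu : G.graph.edist v u ≤ T) : ∃ u', Z k u u' ∧ G'.graph.edist v' u' ≤ T := by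
  obtain ⟨p, hp⟩ := SimpleGraph.exists_walk_of_edist_ne_top
    (ne_top_of_le_ne_top (ENat.natCast_ne_top T) hu)
  have hpT : p.length ≤ T := by rw [← hp] at hu; exact_mod_cast hu
  obtain ⟨u', hu', p', hp'⟩ := B.walk (k := k) p (B.le hv (by omega))
  exact ⟨u', hu', (SimpleGraph.edist_le p').trans (by rw [hp']; exact_mod_cast hpT)⟩

theorem map_half (B : BackForth G G' Z) {u : G.V} {u' : G'.V} (h : Z 1 u u') :
    (G.nbrs u).val.map (G.half u) = (G'.nbrs u').val.map (G'.half u') := by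
  refine Finset.map_val_eq_map_val_of_rel (Z 0) ?_ ?_ fun a a' b b' => B.inj
  · intro w hw
    obtain ⟨w', h1, h2, h3, -⟩ := B.forth h (mem_nbrs.1 hw)
    exact ⟨w', mem_nbrs.2 h2, h1, h3⟩
  · intro w' hw'
    obtain ⟨w, h1, h2, -⟩ := B.back h (mem_nbrs.1 hw')
    exact ⟨w, mem_nbrs.2 h2, h1⟩

end BackForth

/-! ### Views -/

section View

variable {G G' : LabeledGraph X E} {ident : G.V → ℕ} {ident' : G'.V → ℕ} {T : ℕ}
  {σ : G.V → Option S} {σ' : G'.V → Option S} {v : G.V} {v' : G'.V}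

/-- Injective identifiers make the choice in the definition of the view harmless. -/
theorem view_info (hi : ident.Injective) {u : G.V} (hu : G.graph.edist v u ≤ T) :
    (G.view ident T σ v).info (ident u) =
      some (G.node u, (G.nbrs u).val.map (G.half u), σ u) := by
  have h : ∃ w, ident w = ident u ∧ G.graph.edist v w ≤ T := ⟨u, rfl, hu⟩
  have hw : h.choose = u := hi h.choose_spec.1
  simp only [view]
  rw [dif_pos h, hw]

theorem exists_of_view_info {i : ℕ} (h : (G.view ident T σ v).info i ≠ none) :
    ∃ u, ident u = i ∧ G.graph.edist v u ≤ T := by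
  by_contra hno
  exact h (dif_neg hno)

theorem view_edge (hi : ident.Injective) {u w : G.V} (hu : G.graph.edist v u ≤ T)
    (hw : G.graph.edist v w ≤ T) (ha : G.graph.Adj u w) :
    (G.view ident T σ v).edge (ident u) (ident w) = some (G.half u w) := by
  have h : ∃ p : G.V × G.V, ident p.1 = ident u ∧ ident p.2 = ident w ∧
      G.graph.edist v p.1 ≤ T ∧ G.graph.edist v p.2 ≤ T ∧ G.graph.Adj p.1 p.2 :=
    ⟨(u, w), rfl, rfl, hu, hw, ha⟩
  have h1 : h.choose.1 = u := hi h.choose_spec.1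
  have h2 : h.choose.2 = w := hi h.choose_spec.2.1
  simp only [view]
  rw [dif_pos h, h1, h2]

theorem exists_of_view_edge {i j : ℕ} (h : (G.view ident T σ v).edge i j ≠ none) :
    ∃ u w, ident u = i ∧ ident w = j ∧ G.graph.edist v u ≤ T ∧ G.graph.edist v w ≤ T ∧
      G.graph.Adj u w := by
  by_contra hno
  refine h (dif_neg ?_)
  rintro ⟨p, hp⟩
  exact hno ⟨p.1, p.2, hp⟩

theorem edist_le_add_one {u w : G.V} (ha : G.graph.Adj u w) :
    G.graph.edist v w ≤ G.graph.edist v u + 1 := by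
  have := G.graph.edist_triangle (u := v) (v := u) (w := w)
  rwa [SimpleGraph.edist_eq_one_iff_adj.2 ha] at this

/-- The nodes that a pair of equal views identifies. -/
def ViewRel (G G' : LabeledGraph X E) (ident : G.V → ℕ) (ident' : G'.V → ℕ) (T : ℕ) (v : G.V)
    (v' : G'.V) (k : ℕ) (u : G.V) (u' : G'.V) : Prop :=
  ident u = ident' u' ∧ G.graph.edist v u + k ≤ T ∧ G'.graph.edist v' u' + k ≤ T

theorem ViewRel.mono {k : ℕ} {u : G.V} {u' : G'.V}
    (h : ViewRel G G' ident ident' T v v' (k + 1) u u') :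
    ViewRel G G' ident ident' T v v' k u u' := by
  refine ⟨h.1, le_trans ?_ h.2.1, le_trans ?_ h.2.2⟩ <;> gcongr <;> simp

theorem ViewRel.ball {k : ℕ} {u : G.V} {u' : G'.V}
    (h : ViewRel G G' ident ident' T v v' k u u') :
    G.graph.edist v u ≤ T ∧ G'.graph.edist v' u' ≤ T :=
  ⟨le_self_add.trans h.2.1, le_self_add.trans h.2.2⟩

/-- The argument `k` of `ViewRel` is the distance left to the boundary of the ball. While it is
positive, the edge lies inside the ball, so the other view shows it under the same identifiers. -/
theorem ViewRel.forth (hi : ident.Injective) (hi' : ident'.Injective)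
    (h : G.view ident T σ v = G'.view ident' T σ' v') {k : ℕ} {u w : G.V} {u' : G'.V}
    (hu : ViewRel G G' ident ident' T v v' (k + 1) u u') (ha : G.graph.Adj u w) :
    ∃ w', ViewRel G G' ident ident' T v v' k w w' ∧ G'.graph.Adj u' w' ∧
      G.half u w = G'.half u' w' ∧ G.half w u = G'.half w' u' := by
  have bound : ∀ {H : LabeledGraph X E} {x y z : H.V}, H.graph.edist x y + (k + 1 : ℕ) ≤ T →
      H.graph.Adj y z → H.graph.edist x z + k ≤ T := by
    intro H x y z hxy hyz
    refine le_trans ?_ hxy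
    calc H.graph.edist x z + k ≤ H.graph.edist x y + 1 + k := by
          gcongr
          exact edist_le_add_one hyz
      _ = H.graph.edist x y + (k + 1 : ℕ) := by
          push_cast
          rw [add_assoc, add_comm (1 : ℕ∞)]
  have hw := bound hu.2.1 ha
  have hwT : G.graph.edist v w ≤ T := le_self_add.trans hw
  have huT := hu.ball.1
  have e1 := view_edge (σ := σ) hi huT hwT ha
  have e2 := view_edge (σ := σ) hi hwT huT ha.symm
  rw [h] at e1 e2
  obtain ⟨x, w', hx, hw', hxT, hwT', hxw⟩ := exists_of_view_edge (by rw [e1]; simp)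
  obtain rfl := hi' (hx.trans hu.1)
  rw [hu.1, ← hw', view_edge hi' hxT hwT' hxw] at e1
  rw [hu.1, ← hw', view_edge hi' hwT' hxT hxw.symm] at e2
  exact ⟨w', ⟨hw'.symm, hw, bound hu.2.2 hxw⟩, hxw, (Option.some.inj e1).symm,
    (Option.some.inj e2).symm⟩

theorem ViewRel.symm {k : ℕ} {u : G.V} {u' : G'.V}
    (h : ViewRel G G' ident ident' T v v' k u u') :
    ViewRel G' G ident' ident T v' v k u' u :=
  ⟨h.1.symm, h.2.2, h.2.1⟩

theorem ViewRel.info_eq (hi : ident.Injective) (hi' : ident'.Injective)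
    (h : G.view ident T σ v = G'.view ident' T σ' v') {k : ℕ} {u : G.V} {u' : G'.V}
    (hu : ViewRel G G' ident ident' T v v' k u u') : G.node u = G'.node u' ∧ σ u = σ' u' := by
  have e := view_info (σ := σ) hi hu.ball.1
  rw [h, hu.1, view_info hi' hu.ball.2, Option.some.injEq, Prod.mk.injEq, Prod.mk.injEq] at e
  exact ⟨e.1.symm, e.2.2.symm⟩

/-- Equal views yield a back-and-forth system. -/
theorem backForth_of_view_eq (hi : ident.Injective) (hi' : ident'.Injective)
    (h : G.view ident T σ v = G'.view ident' T σ' v') :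
    BackForth G G' (ViewRel G G' ident ident' T v v') where
  mono := ViewRel.mono
  forth := ViewRel.forth hi hi' h
  back := fun hu ha => by
    obtain ⟨w, h1, h2, h3, h4⟩ := ViewRel.forth hi' hi h.symm hu.symm ha
    exact ⟨w, h1.symm, h2, h3.symm, h4.symm⟩
  node := fun hu => (hu.info_eq hi hi' h).1
  inj := fun hu hw => by
    rw [← hi.eq_iff, ← hi'.eq_iff, hu.1, hw.1]
  card := congrArg View.n h

theorem viewRel_center (h : G.view ident T σ v = G'.view ident' T σ' v') :
    ViewRel G G' ident ident' T v v' T v v' :=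
  ⟨congrArg View.center h, by simp, by simp⟩

/-- Nodes that correspond to each other in a back-and-forth system have equal views. -/
theorem BackForth.view_eq {Z : ℕ → G.V → G'.V → Prop} (B : BackForth G G' Z)
    (hi : ident.Injective) (hi' : ident'.Injective)
    (hid : ∀ {k u u'}, Z k u u' → ident u = ident' u')
    (hσ : ∀ {k u u'}, Z k u u' → σ u = σ' u') (hv : Z (1 + T) v v') :
    G.view ident T σ v = G'.view ident' T σ' v' := by
  -- The additional unit in `1 + T` leaves radius `1` at every node of the ball; this is needed for
  -- the labels of half-edges that leave the ball.
  have hinfo : (G.view ident T σ v).info = (G'.view ident' T σ' v').info := by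
    funext i
    by_cases h : (G.view ident T σ v).info i = none
    · rw [h]
      by_contra hne
      obtain ⟨u', rfl, hu'⟩ := exists_of_view_info (Ne.symm hne)
      obtain ⟨u, hu, hT⟩ := B.symm.ball hv hu'
      rw [← hid hu, view_info hi hT] at h
      cases h
    · obtain ⟨u, rfl, hu⟩ := exists_of_view_info h
      obtain ⟨u', hu', hT⟩ := B.ball hv hu
      rw [view_info hi hu, hid hu', view_info hi' hT, B.node hu', B.map_half hu', hσ hu']
  have hedge : (G.view ident T σ v).edge = (G'.view ident' T σ' v').edge := by
    funext i j
    by_cases h : (G.view ident T σ v).edge i j = none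
    · rw [h]
      by_contra hne
      obtain ⟨u', w', rfl, rfl, hu', hw', ha⟩ := exists_of_view_edge (Ne.symm hne)
      obtain ⟨u, hu, huT⟩ := B.symm.ball hv hu'
      obtain ⟨w, hw, hwT⟩ := B.symm.ball hv hw'
      rw [← hid hu, ← hid hw, view_edge hi huT hwT (B.symm.adj hu (B.mono hw) ha).1] at h
      cases h
    · obtain ⟨u, w, rfl, rfl, hu, hw, ha⟩ := exists_of_view_edge h
      obtain ⟨u', hu', huT⟩ := B.ball hv hu
      obtain ⟨w', hw', hwT⟩ := B.ball hv hw
      have := B.adj hu' (B.mono hw') ha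
      rw [view_edge hi hu hw ha, hid hu', hid hw', view_edge hi' huT hwT this.1, this.2]
  have hn : (G.view ident T σ v).n = (G'.view ident' T σ' v').n := B.card
  have hc : (G.view ident T σ v).center = (G'.view ident' T σ' v').center := hid hv
  generalize G.view ident T σ v = a at *
  generalize G'.view ident' T σ' v' = b at *
  cases a
  cases b
  simp_all

end View

end LabeledGraph

/-- An element of a set, if there is one. -/
noncomputable def Set.pick {α : Type*} (s : Set α) : Option α :=
  open Classical in if h : s.Nonempty then some h.some else none

theorem Set.pick_eq_some {α : Type*} {s : Set α} {a : α} (ha : a ∈ s) (h : ∀ b ∈ s, b = a) :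
    s.pick = some a := by
  have hs : s.Nonempty := ⟨a, ha⟩
  rw [Set.pick, dif_pos hs, h _ hs.some_mem]

theorem Set.pick_eq_none {α : Type*} {s : Set α} (h : ∀ a, a ∉ s) : s.pick = none :=
  dif_neg fun ⟨a, ha⟩ => h a ha

namespace GadgetGraph

open HalfEdgeLabel LabeledGraph

variable {rank : ℕ}

/-! ### Locality of gadgets -/

/-- An upper bound on the distance between two nodes of an octopus gadget, or of an octopus gadget
and an inter-octopus node attached to it, plus the radius that determines whether a node is
marked. -/
noncomputable def span (G : GadgetGraph) : ℕ :=
  4 * depth G + 3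

section Locality

variable {G G' : GadgetGraph} {Z : ℕ → G.V → G'.V → Prop} {k l m : ℕ} {u v w : G.V}
  {u' v' w' : G'.V}

theorem step_forth (B : BackForth G G' Z) {a : HalfEdgeLabel} (h : Z (k + 1) u u')
    (hs : G.Step a u w) : ∃ w', Z k w w' ∧ G'.Step a u' w' := by
  obtain ⟨w', h1, h2, h3, -⟩ := B.forth h hs.1
  exact ⟨w', h1, h2, h3 ▸ hs.2⟩

theorem step_forth_rev (B : BackForth G G' Z) {a : HalfEdgeLabel} (h : Z (k + 1) u u')
    (hs : G.Step a w u) : ∃ w', Z k w w' ∧ G'.Step a w' u' := by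
  obtain ⟨w', h1, h2, -, h3⟩ := B.forth h hs.1.symm
  exact ⟨w', h1, h2.symm, h3 ▸ hs.2⟩

theorem step_of_rel (B : BackForth G G' Z) {a : HalfEdgeLabel} (h : Z (k + 1) u u')
    (hw : Z m w w') (hs : G.Step a u w) : G'.Step a u' w' := by
  have := B.adj (B.le h (by omega)) (B.le hw (by omega)) hs.1
  exact ⟨this.1, this.2 ▸ hs.2⟩

theorem has_forth (B : BackForth G G' Z) {a : HalfEdgeLabel} (h : Z (k + 1) u u')
    (ha : G.Has a u) : G'.Has a u' := by
  obtain ⟨w, hw⟩ := ha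
  obtain ⟨w', -, hw'⟩ := step_forth B h hw
  exact ⟨w', hw'⟩

theorem has_iff (B : BackForth G G' Z) {a : HalfEdgeLabel} (h : Z (k + 1) u u') :
    G.Has a u ↔ G'.Has a u' :=
  ⟨has_forth B h, has_forth B.symm h⟩

/-- Every clause speaks of nodes at most two steps away from `u`; radius `3` covers these together
with their half-edges. -/
theorem constraint_forth (B : BackForth G G' Z) (h : Z 3 u u') (hc : Constraint G rank u) :
    Constraint G' rank u' := by
  have node : G'.node u' = G.node u := (B.node h).symm
  have back : ∀ {k x x' y'} {a : HalfEdgeLabel}, Z (k + 1) x x' → G'.Step a x' y' →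
      ∃ y, Z k y y' ∧ G.Step a x y := fun h hs => step_forth B.symm h hs
  have back_rev : ∀ {k x x' y'} {a : HalfEdgeLabel}, Z (k + 1) x x' → G'.Step a y' x' →
      ∃ y, Z k y y' ∧ G.Step a y x := fun h hs => step_forth_rev B.symm h hs
  have has : ∀ {a}, G'.Has a u' ↔ G.Has a u := (has_iff B h).symm
  exact
    { edge_ok := fun v' hv' => by
        obtain ⟨v, h1, h2, h3, h4⟩ := B.back h hv'
        rw [← h3, ← h4, node, ← B.node h1]
        exact hc.edge_ok v h2
      distinct := fun hk v' w' hv' hw' e => by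
        obtain ⟨v, h1, h2, h3, -⟩ := B.back h hv'
        obtain ⟨w, h1', h2', h3', -⟩ := B.back h hw'
        have := hc.distinct (node ▸ hk) v w h2 h2' (h3.trans (e.trans h3'.symm))
        exact (B.inj (B.le h1 (by omega)) (B.le h1' (by omega))).1 this
      inter_degree := fun hk => by
        have := congrArg Multiset.card (B.map_half (B.le h (by omega)))
        simp only [Multiset.card_map, Finset.card_val] at this
        rw [← this]
        exact hc.inter_degree (node ▸ hk)
      children_iff := by rw [has, has]; exact hc.children_iff
      siblings := fun v' w' hv' hw' => by
        obtain ⟨v, h1, hv⟩ := back h hv'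
        obtain ⟨w, h2, hw⟩ := back h hw'
        exact step_of_rel B h1 h2 (hc.siblings v w hv hw)
      layer_iff := fun v' hv' => by
        obtain ⟨v, h1, hv⟩ := back h hv'
        rw [has, ← has_iff B h1]
        exact hc.layer_iff v hv
      cousins := fun v' a' b' hv' ha' hb' => by
        obtain ⟨v, h1, hv⟩ := back h hv'
        obtain ⟨a, h2, ha⟩ := back h ha'
        obtain ⟨b, h3, hb⟩ := back h1 hb'
        exact step_of_rel B h2 h3 (hc.cousins v a b hv ha hb)
      root_alone := by rw [has, has, has]; exact hc.root_alone
      left_end := fun p' hp' => by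
        obtain ⟨p, h1, hp⟩ := back_rev h hp'
        rw [has, ← has_iff B h1]
        exact hc.left_end p hp
      right_end := fun p' hp' => by
        obtain ⟨p, h1, hp⟩ := back_rev h hp'
        rw [has, ← has_iff B h1]
        exact hc.right_end p hp
      head_port1 := by rw [node, has, has]; exact hc.head_port1
      head_port2 := by rw [node, has, has]; exact hc.head_port2
      port_root := by rw [node, has, has]; exact hc.port_root
      port_leaf := by rw [node, has, has, has]; exact hc.port_leaf }

theorem constraint_iff (B : BackForth G G' Z) (h : Z (k + 3) u u') :
    Constraint G rank u ↔ Constraint G' rank u' :=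
  have h' := B.le h (Nat.le_add_left 3 k)
  ⟨constraint_forth B h', constraint_forth B.symm h'⟩

theorem stepDown_forth (B : BackForth G G' Z) (h : Z (k + 1) u u') (hs : StepDown G u v) :
    ∃ v', Z k v v' ∧ StepDown G' u' v' := by
  have ha : G.graph.Adj u v := by
    rcases hs with h | h | h | h | h <;> exact h.1
  obtain ⟨v', h1, h2, h3, -⟩ := B.forth h ha
  exact ⟨v', h1, by
    simpa only [StepDown, LabeledGraph.Step, ← h3, h2, ha, true_and] using hs⟩

theorem height_eq (B : BackForth G G' Z) : height G = height G' := by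
  rw [height, height, B.card]

theorem depth_eq (B : BackForth G G' Z) : depth G = depth G' := by
  rw [depth, depth, height_eq B]

theorem span_eq (B : BackForth G G' Z) : span G = span G' := by
  rw [span, span, depth_eq B]

theorem stepUp_forth (B : BackForth G G' Z) (h : Z (k + 1) u u') (hs : StepUp G u v) :
    ∃ v', Z k v v' ∧ StepUp G' u' v' := by
  rcases hs with hs | hs
  · obtain ⟨v', h1, h2⟩ := step_forth B h hs
    exact ⟨v', h1, .inl h2⟩
  · obtain ⟨v', h1, h2⟩ := step_forth B h hs
    exact ⟨v', h1, .inr h2⟩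

theorem down_forth (B : BackForth G G' Z) : ∀ {u u'}, Z (m + 3) u u' → Down G rank m u →
    Down G' rank m u' := by
  induction m with
  | zero => exact fun h hd hc => hd ((constraint_iff B h).2 hc)
  | succ m ih =>
    rintro u u' h (hd | ⟨v, hs, hd⟩)
    · exact .inl (ih (B.le h (by omega)) hd)
    · obtain ⟨v', hv, hs'⟩ := stepDown_forth (k := m + 3) B (B.le h (by omega)) hs
      exact .inr ⟨v', hs', ih hv hd⟩

theorem up_forth (B : BackForth G G' Z) : ∀ {u u'}, Z (m + depth G + 3) u u' → Up G rank m u →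
    Up G' rank m u' := by
  induction m with
  | zero =>
    intro u u' h hd
    have := down_forth (m := depth G) B (B.le h (by omega)) hd
    rwa [depth_eq B] at this
  | succ m ih =>
    rintro u u' h (hd | ⟨v, hs, hd⟩)
    · exact .inl (ih (B.le h (by omega)) hd)
    · obtain ⟨v', hv, hs'⟩ := stepUp_forth (k := m + depth G + 3) B (B.le h (by omega)) hs
      exact .inr ⟨v', hs', ih hv hd⟩

/-- The radius pays for `depth G` steps up, `depth G` steps down and the constraint at the end. -/
theorem marked_forth (B : BackForth G G' Z) (h : Z k u u') (hk : 2 * depth G + 3 ≤ k)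
    (hu : Marked G rank u) : Marked G' rank u' := by
  have := up_forth (m := depth G) B (B.le h (by omega)) hu
  rwa [depth_eq B] at this

theorem marked_iff (B : BackForth G G' Z) (h : Z k u u') (hk : 2 * depth G + 3 ≤ k) :
    Marked G rank u ↔ Marked G' rank u' :=
  ⟨marked_forth B h hk, marked_forth B.symm h (depth_eq B ▸ hk)⟩

theorem markOutput_eq (B : BackForth G G' Z) (h : Z k u u') (hk : 2 * depth G + 3 ≤ k)
    {Γ : Type} (o : Option Γ) : markOutput G rank u o = markOutput G' rank u' o := by
  have h1 : Constraint G rank u ↔ Constraint G' rank u' :=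
    constraint_iff (k := 0) B (B.le h (by omega))
  have h2 : Down G rank (depth G) u ↔ Down G' rank (depth G') u' := by
    rw [← depth_eq B]
    exact ⟨down_forth B (B.le h (by omega)), down_forth B.symm (B.le h (by omega))⟩
  classical
  exact if_congr (not_congr h1) rfl (if_congr h2 rfl (if_congr (marked_iff B h hk) rfl rfl))

theorem pos_down (B : BackForth G G' Z) {x : G.V} {x' : G'.V} : ∀ {k j u}, Z (k + l) x x' →
    Pos G x l j u → ∃ u', Z k u u' ∧ Pos G' x' l j u' := by
  induction l with
  | zero =>
    intro k j u h hu
    obtain ⟨rfl, rfl⟩ := hu.zero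
    exact ⟨x', h, .refl⟩
  | succ l ih =>
    intro k j u h hu
    obtain ⟨i, p, hp, hj⟩ := hu.succ
    obtain ⟨p', hp', hp''⟩ := ih (k := k + 1) (B.le h (by omega)) hp
    rcases hj with ⟨rfl, hs⟩ | ⟨rfl, hs⟩
    · obtain ⟨u', hu', hs'⟩ := step_forth B hp' hs
      exact ⟨u', hu', hp''.left hs'⟩
    · obtain ⟨u', hu', hs'⟩ := step_forth B hp' hs
      exact ⟨u', hu', hp''.right hs'⟩

theorem pos_up (B : BackForth G G' Z) {x : G.V} : ∀ {k j u u'}, Z (k + l) u u' →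
    Pos G x l j u → ∃ x', Z k x x' ∧ Pos G' x' l j u' := by
  induction l with
  | zero =>
    intro k j u u' h hu
    obtain ⟨rfl, rfl⟩ := hu.zero
    exact ⟨u', h, .refl⟩
  | succ l ih =>
    intro k j u u' h hu
    obtain ⟨i, p, hp, hj⟩ := hu.succ
    rcases hj with ⟨rfl, hs⟩ | ⟨rfl, hs⟩
    · obtain ⟨p', hp', hs'⟩ := step_forth_rev (k := k + l) B (B.le h (by omega)) hs
      obtain ⟨x', hx, hx'⟩ := ih hp' hp
      exact ⟨x', hx, hx'.left hs'⟩
    · obtain ⟨p', hp', hs'⟩ := step_forth_rev (k := k + l) B (B.le h (by omega)) hs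
      obtain ⟨x', hx, hx'⟩ := ih hp' hp
      exact ⟨x', hx, hx'.right hs'⟩

theorem isRoot_forth (B : BackForth G G' Z) (h : Z k u u') (hk : 2 * depth G + 3 ≤ k)
    (hu : IsRoot G rank u) : IsRoot G' rank u' where
  not_marked := (marked_iff B h hk).not.1 hu.not_marked
  head := (B.node h).symm.trans hu.head
  not_has_parent := (has_iff (k := 0) B (B.le h (by omega))).not.1 hu.not_has_parent

theorem keyOf_down (B : BackForth G G' Z) {r p : G.V} {r' : G'.V} {κ : ℕ}
    (h : Z (k + height G + 2 * depth G + 3) r r') (hp : KeyOf G rank r κ p) :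
    ∃ p', Z k p p' ∧ KeyOf G' rank r' κ p' := by
  obtain ⟨hr, l, j, x, hx, hs⟩ := hp
  have hl := hx.lt_height_of_not_marked hr.not_marked
  have hr' := isRoot_forth B h (by omega) hr
  obtain ⟨x', hx', hpos⟩ := pos_down (k := k + 1) B (B.le h (by omega)) hx
  rcases hs with ⟨e, hs⟩ | ⟨e, hs⟩
  · obtain ⟨p', hp', hs'⟩ := step_forth B hx' hs
    exact ⟨p', hp', hr', l, j, x', hpos, .inl ⟨e, hs'⟩⟩
  · obtain ⟨p', hp', hs'⟩ := step_forth B hx' hs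
    exact ⟨p', hp', hr', l, j, x', hpos, .inr ⟨e, hs'⟩⟩

/-- The index depends on the set of all keys, and the whole head-gadget with its ports is visible
from the root. -/
theorem portIndex_eq (B : BackForth G G' Z) {r : G.V} {r' : G'.V}
    (h : Z (k + height G + 2 * depth G + 3) r r') :
    portIndex G rank r = portIndex G' rank r' := by
  have key : IsKey G rank r = IsKey G' rank r' := by
    funext κ
    refine propext ⟨fun ⟨p, hp⟩ => ?_, fun ⟨p, hp⟩ => ?_⟩
    · obtain ⟨p', -, hp'⟩ := keyOf_down B h hp
      exact ⟨p', hp'⟩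
    · rw [height_eq B, depth_eq B] at h
      obtain ⟨p', -, hp'⟩ := keyOf_down B.symm h hp
      exact ⟨p', hp'⟩
  unfold portIndex
  rw [key]

theorem portOf_down (B : BackForth G G' Z) {r p : G.V} {r' : G'.V} {i : ℕ}
    (h : Z (k + height G + 2 * depth G + 3) r r') (hp : PortOf G rank r i p) :
    ∃ p', Z k p p' ∧ PortOf G' rank r' i p' := by
  obtain ⟨κ, hκ, rfl⟩ := hp
  obtain ⟨p', hp', hκ'⟩ := keyOf_down B h hκ
  exact ⟨p', hp', κ, hκ', by rw [portIndex_eq B h]⟩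

/-- One `height G` is spent on climbing from the port-gadget to the root, the other on exploring the
head-gadget from there to recount the ports. -/
theorem portOf_up (B : BackForth G G' Z) {r p : G.V} {p' : G'.V} {i : ℕ}
    (h : Z (k + 2 * height G + 2 * depth G + 3) p p') (hp : PortOf G rank r i p) :
    ∃ r', Z k r r' ∧ PortOf G' rank r' i p' := by
  obtain ⟨κ, hκ, rfl⟩ := hp
  obtain ⟨hr, l, j, x, hx, hs⟩ := hκ
  have hl := hx.lt_height_of_not_marked hr.not_marked
  have key : ∀ {a : HalfEdgeLabel}, G.Step a x p → ∃ x' r',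
      Z (k + height G + 2 * depth G + 3) r r' ∧ Pos G' r' l j x' ∧ G'.Step a x' p' := by
    intro a hs
    obtain ⟨x', hx', hs'⟩ := step_forth_rev (k := k + height G + 2 * depth G + 3 + l) B
      (B.le h (by omega)) hs
    obtain ⟨r', hr', hpos⟩ := pos_up B hx' hx
    exact ⟨x', r', hr', hpos, hs'⟩
  rcases hs with ⟨e, hs⟩ | ⟨e, hs⟩
  · obtain ⟨x', r', hr', hpos, hs'⟩ := key hs
    exact ⟨r', B.le hr' (by omega), κ, ⟨isRoot_forth B hr' (by omega) hr, l, j, x', hpos,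
      .inl ⟨e, hs'⟩⟩, by rw [portIndex_eq B hr']⟩
  · obtain ⟨x', r', hr', hpos, hs'⟩ := key hs
    exact ⟨r', B.le hr' (by omega), κ, ⟨isRoot_forth B hr' (by omega) hr, l, j, x', hpos,
      .inr ⟨e, hs'⟩⟩, by rw [portIndex_eq B hr']⟩

theorem portMem_up (B : BackForth G G' Z) {r : G.V} {i : ℕ} (h : Z (k + span G) u u')
    (hu : PortMem G rank r i u) : ∃ r', Z k r r' ∧ PortMem G' rank r' i u' := by
  unfold span depth at h
  obtain ⟨p, l, j, hp, hpos⟩ := hu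
  have hl := hpos.lt_height_of_not_marked hp.not_marked
  obtain ⟨p', hp', hpos'⟩ := pos_up (k := k + 2 * height G + 2 * depth G + 3) B
    (B.le h (by unfold depth; omega)) hpos
  obtain ⟨r', hr', h'⟩ := portOf_up B hp' hp
  exact ⟨r', hr', p', l, j, h', hpos'⟩

theorem portMem_down (B : BackForth G G' Z) {r : G.V} {r' : G'.V} {i : ℕ}
    (h : Z (k + span G) r r') (hu : PortMem G rank r i u) :
    ∃ u', Z k u u' ∧ PortMem G' rank r' i u' := by
  unfold span depth at h
  obtain ⟨p, l, j, hp, hpos⟩ := hu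
  have hl := hpos.lt_height_of_not_marked hp.not_marked
  obtain ⟨p', hp', h'⟩ := portOf_down (k := k + l) B (B.le h (by unfold depth; omega)) hp
  obtain ⟨u', hu', hpos'⟩ := pos_down B hp' hpos
  exact ⟨u', hu', p', l, j, h', hpos'⟩

theorem mem_up (B : BackForth G G' Z) {r : G.V} (h : Z (k + span G) u u')
    (hu : Mem G rank r u) : ∃ r', Z k r r' ∧ Mem G' rank r' u' := by
  rcases hu with ⟨hr, l, j, hpos⟩ | ⟨i, hi⟩
  · have hl := hpos.lt_height_of_not_marked hr.not_marked
    unfold span depth at h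
    obtain ⟨r', hr', hpos'⟩ := pos_up (k := k + 2 * depth G + 3) B
      (B.le h (by unfold depth; omega)) hpos
    exact ⟨r', B.le hr' (by omega), .inl ⟨isRoot_forth B hr' (by omega) hr, l, j, hpos'⟩⟩
  · obtain ⟨r', hr', h'⟩ := portMem_up B h hi
    exact ⟨r', hr', .inr ⟨i, h'⟩⟩

theorem mem_down (B : BackForth G G' Z) {r : G.V} {r' : G'.V} (h : Z (k + span G) r r')
    (hu : Mem G rank r u) : ∃ u', Z k u u' ∧ Mem G' rank r' u' := by
  rcases hu with ⟨hr, l, j, hpos⟩ | ⟨i, hi⟩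
  · have hl := hpos.lt_height_of_not_marked hr.not_marked
    unfold span depth at h
    obtain ⟨u', hu', hpos'⟩ := pos_down (k := k) B (B.le h (by omega)) hpos
    exact ⟨u', hu', .inl ⟨isRoot_forth B h (by unfold depth; omega) hr, l, j, hpos'⟩⟩
  · obtain ⟨u', hu', h'⟩ := portMem_down B h hi
    exact ⟨u', hu', .inr ⟨i, h'⟩⟩

/-- One of the two nodes is the root of an octopus gadget, the other one is the inter-octopus node
that is attached to the `i`-th port-gadget. -/
def Joined (G : GadgetGraph) (rank : ℕ) (i : ℕ) (u v : G.V) : Prop :=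
  ∃ x, Attached G rank u i x v ∨ Attached G rank v i x u

theorem Joined.symm {i : ℕ} (h : Joined G rank i u v) : Joined G rank i v u :=
  h.imp fun _ => Or.symm

/-- Following one virtual edge, in either direction, costs at most `span G` of the radius: it
crosses one port-gadget and one head-gadget and verifies the index of the port. -/
theorem joined_forth (B : BackForth G G' Z) {i : ℕ} (h : Z (k + span G) u u')
    (hu : Joined G rank i u v) : ∃ v', Z k v v' ∧ Joined G' rank i u' v' := by
  unfold span depth at h
  obtain ⟨x, ⟨p, l, hp, hpos, hs⟩ | ⟨p, l, hp, hpos, hs⟩⟩ := hu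
  · have hl := hpos.lt_height_of_not_marked hp.not_marked
    obtain ⟨p', hp', h'⟩ := portOf_down (k := k + 1 + l) B (B.le h (by unfold depth; omega)) hp
    obtain ⟨x', hx', hpos'⟩ := pos_down B hp' hpos
    obtain ⟨v', hv', hs'⟩ := step_forth B hx' hs
    exact ⟨v', hv', x', .inl ⟨p', l, h', hpos', hs'⟩⟩
  · have hl := hpos.lt_height_of_not_marked hp.not_marked
    obtain ⟨x', hx', hs'⟩ := step_forth_rev (k := k + 2 * height G + 2 * depth G + 3 + l) B
      (B.le h (by unfold depth; omega)) hs
    obtain ⟨p', hp', hpos'⟩ := pos_up B hx' hpos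
    obtain ⟨v', hv', h'⟩ := portOf_up B hp' hp
    exact ⟨v', hv', x', .inr ⟨p', l, h', hpos', hs'⟩⟩

theorem joined_of_rel (B : BackForth G G' Z) {i : ℕ} (h : Z (k + span G) u u') (hv : Z m v v')
    (hu : Joined G rank i u v) : Joined G' rank i u' v' := by
  obtain ⟨w, hw, h'⟩ := joined_forth B h hu
  obtain rfl := (B.inj (B.le hv (by omega)) (B.le hw (by omega))).1 rfl
  exact h'

end Locality

/-! ### The virtual network -/

variable {G : GadgetGraph}

theorem net_adj_white_black {w : (virtualGraph G rank).W} {b : (virtualGraph G rank).B} :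
    (virtualGraph G rank).net.graph.Adj (Sum.inl w) (Sum.inr b) ↔
      ∃ i, (virtualGraph G rank).nbr w i = b := by
  simp only [IncidenceMultigraph.net, SimpleGraph.fromRel_adj]
  constructor
  · rintro ⟨-, ⟨w', i, h1, h2⟩ | ⟨w', i, h1, h2⟩⟩
    · obtain rfl := Sum.inl.inj h1
      exact ⟨i, (Sum.inr.inj h2).symm⟩
    · exact absurd h1 Sum.inr_ne_inl
  · rintro ⟨i, rfl⟩
    exact ⟨Sum.inl_ne_inr, .inl ⟨w, i, rfl, rfl⟩⟩

theorem exists_nbr_eq_iff {w : (virtualGraph G rank).W} {b : (virtualGraph G rank).B} {i : ℕ} :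
    (∃ h : i < (virtualGraph G rank).deg w, (virtualGraph G rank).nbr w ⟨i, h⟩ = b) ↔
      Joined G rank i w.1 b.1 := by
  constructor
  · rintro ⟨h, e⟩
    obtain ⟨x, hx⟩ := virtualGraph_nbr_eq_iff.1 e
    exact ⟨x, .inl hx⟩
  · rintro ⟨x, hx | hx⟩
    · exact ⟨hx.lt, virtualGraph_nbr_eq_iff.2 ⟨x, hx⟩⟩
    · exact absurd hx.inter w.2

theorem mem_positions_iff {w : (virtualGraph G rank).W} {b : (virtualGraph G rank).B} {i : ℕ} :
    i ∈ (virtualGraph G rank).positions w b ↔ Joined G rank i w.1 b.1 := by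
  rw [← exists_nbr_eq_iff]
  simp only [IncidenceMultigraph.positions, Finset.mem_map, Finset.mem_filter, Finset.mem_univ,
    true_and, Fin.valEmbedding_apply]
  constructor
  · rintro ⟨j, hj, rfl⟩
    exact ⟨j.2, hj⟩
  · rintro ⟨h, e⟩
    exact ⟨⟨i, h⟩, e, rfl⟩

theorem Joined.inter_iff {i : ℕ} {u v : G.V} (h : Joined G rank i u v) :
    G.node u = .inter ↔ G.node v ≠ .inter := by
  obtain ⟨x, hx | hx⟩ := h
  · simp [hx.inter, hx.isRoot.head]
  · simp [hx.inter, hx.isRoot.head]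

theorem net_adj_iff {x y : (virtualGraph G rank).net.V} :
    (virtualGraph G rank).net.graph.Adj x y ↔
      ∃ i, Joined G rank i (ofNet G rank x) (ofNet G rank y) := by
  have key : ∀ (w : (virtualGraph G rank).W) (b : (virtualGraph G rank).B),
      (virtualGraph G rank).net.graph.Adj (Sum.inl w) (Sum.inr b) ↔
        ∃ i, Joined G rank i w.1 b.1 := by
    intro w b
    rw [net_adj_white_black]
    simp only [← exists_nbr_eq_iff]
    exact ⟨fun ⟨i, h⟩ => ⟨i, i.2, h⟩, fun ⟨i, hi, h⟩ => ⟨⟨i, hi⟩, h⟩⟩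
  rcases x with w | b <;> rcases y with w' | b'
  · refine iff_of_false ?_ ?_
    · simp [IncidenceMultigraph.net]
    · rintro ⟨i, h⟩
      exact w.2 (h.inter_iff.2 w'.2)
  · exact key w b'
  · exact (SimpleGraph.adj_comm _ _ _).trans
      ((key w' b).trans (exists_congr fun _ => ⟨Joined.symm, Joined.symm⟩))
  · refine iff_of_false ?_ ?_
    · simp [IncidenceMultigraph.net]
    · rintro ⟨i, h⟩
      exact h.inter_iff.1 b.2 b'.2

theorem mem_net_half_iff {x y : (virtualGraph G rank).net.V} {i : ℕ} :
    i ∈ (virtualGraph G rank).net.half x y ↔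
      Joined G rank i (ofNet G rank x) (ofNet G rank y) := by
  rcases x with w | b <;> rcases y with w' | b'
  · refine iff_of_false (Finset.notMem_empty i) fun h => ?_
    exact w.2 (h.inter_iff.2 w'.2)
  · exact mem_positions_iff
  · exact mem_positions_iff.trans ⟨Joined.symm, Joined.symm⟩
  · refine iff_of_false (Finset.notMem_empty i) fun h => ?_
    exact h.inter_iff.1 b.2 b'.2

open Classical in
theorem net_node_eq (x : (virtualGraph G rank).net.V) :
    (virtualGraph G rank).net.node x =
      if G.node (ofNet G rank x) = .inter then Color.black else Color.white := by
  rcases x with w | b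
  · exact (if_neg w.2).symm
  · exact (if_pos b.2).symm

/-! ### Back-and-forth systems between virtual networks -/

section

variable {G' : GadgetGraph} {Z : ℕ → G.V → G'.V → Prop}

/-- The back-and-forth system between virtual networks that is induced by one between gadget
graphs. -/
def NetRel (G G' : GadgetGraph) (rank : ℕ) (Z : ℕ → G.V → G'.V → Prop) (k : ℕ)
    (x : (virtualGraph G rank).net.V) (x' : (virtualGraph G' rank).net.V) : Prop :=
  Z (span G * k + span G) (ofNet G rank x) (ofNet G' rank x')

theorem netRel_symm (B : BackForth G G' Z) :
    NetRel G' G rank (fun k u' u => Z k u u') = fun k x' x => NetRel G G' rank Z k x x' := by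
  funext k x' x
  simp only [NetRel, span_eq B]

/-- Each virtual step consumes `span G`. The additional `span G` in `NetRel` survives at `k = 0`,
where it is needed to compare the states stored in a gadget. -/
theorem netRel_forth (B : BackForth G G' Z) {k : ℕ} {x y : (virtualGraph G rank).net.V}
    {x' : (virtualGraph G' rank).net.V} (h : NetRel G G' rank Z (k + 1) x x')
    (ha : (virtualGraph G rank).net.graph.Adj x y) :
    ∃ y', NetRel G G' rank Z k y y' ∧ (virtualGraph G' rank).net.graph.Adj x' y' ∧
      (virtualGraph G rank).net.half x y = (virtualGraph G' rank).net.half x' y' ∧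
      (virtualGraph G rank).net.half y x = (virtualGraph G' rank).net.half y' x' := by
  have h' : Z (span G * k + span G + span G) (ofNet G rank x) (ofNet G' rank x') := by
    rw [NetRel, mul_add, mul_one] at h
    exact h
  obtain ⟨i, hi⟩ := net_adj_iff.1 ha
  obtain ⟨v', hv', hi'⟩ := joined_forth B h' hi
  have hof : ofNet G' rank (toNet G' rank v') = v' := ofNet_toNet v'
  -- A half-edge label of the virtual network lists all parallel edges, so every position `j` is
  -- compared and not only `i`.
  have key : ∀ j, Joined G rank j (ofNet G rank x) (ofNet G rank y) ↔
      Joined G' rank j (ofNet G' rank x') v' := fun j =>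
    ⟨joined_of_rel B h' hv', joined_of_rel B.symm (span_eq B ▸ h') hv'⟩
  refine ⟨toNet G' rank v', ?_, net_adj_iff.2 ⟨i, hof.symm ▸ hi'⟩, ?_, ?_⟩
  · rw [NetRel, hof]
    exact hv'
  · ext j
    rw [mem_net_half_iff, mem_net_half_iff, hof]
    exact key j
  · ext j
    rw [mem_net_half_iff, mem_net_half_iff, hof]
    exact ⟨fun h => ((key j).1 h.symm).symm, fun h => ((key j).2 h.symm).symm⟩

theorem backForth_net (B : BackForth G G' Z) :
    BackForth (virtualGraph G rank).net (virtualGraph G' rank).net (NetRel G G' rank Z) where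
  mono := fun h => B.le h (by rw [mul_add]; omega)
  forth := netRel_forth B
  back := fun {k x x' y'} h ha => by
    have := netRel_forth (rank := rank) (k := k) B.symm (x := x') (x' := x) (y := y')
    rw [netRel_symm B] at this
    obtain ⟨y, h1, h2, h3, h4⟩ := this h ha
    exact ⟨y, h1, h2, h3.symm, h4.symm⟩
  node := fun h => by rw [net_node_eq, net_node_eq, B.node h]
  inj := fun h h' => by
    rw [← ofNet_injective.eq_iff, ← ofNet_injective.eq_iff]
    exact B.inj (B.le h (Nat.zero_le _)) (B.le h' (Nat.zero_le _))
  card := by rw [card_net, card_net, B.card]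

end

end GadgetGraph

/-! ### Runs of SLOCAL algorithms -/

theorem SLOCALAlgorithm.run_concat {X E Y : Type} (A : SLOCALAlgorithm X E Y)
    (G : LabeledGraph X E) (ident : G.V → ℕ) (T : ℕ) (order : List G.V) (v : G.V) :
    open Classical in
    A.run G ident T (order ++ [v]) = Function.update (A.run G ident T order) v
      (some (A.step (G.view ident T (A.run G ident T order) v))) := by
  simp [SLOCALAlgorithm.run, List.foldl_append]

theorem SLOCALAlgorithm.run_append_of_notMem {X E Y : Type} (A : SLOCALAlgorithm X E Y)
    (G : LabeledGraph X E) (ident : G.V → ℕ) (T : ℕ) (l l' : List G.V) {v : G.V} (hv : v ∉ l') :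
    A.run G ident T (l ++ l') v = A.run G ident T l v := by
  classical
  induction l' using List.reverseRecOn with
  | nil => simp
  | append_singleton l' w ih =>
    rw [← List.append_assoc, SLOCALAlgorithm.run_concat]
    simp only [List.mem_append, List.mem_singleton, not_or] at hv
    rw [Function.update_of_ne hv.2, ih hv.1]

theorem SLOCALAlgorithm.run_isSome {X E Y : Type} (A : SLOCALAlgorithm X E Y)
    (G : LabeledGraph X E) (ident : G.V → ℕ) (T : ℕ) (l : List G.V) (v : G.V) :
    (A.run G ident T l v).isSome ↔ v ∈ l := by
  classical
  induction l using List.reverseRecOn with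
  | nil => simp [SLOCALAlgorithm.run]
  | append_singleton l w ih =>
    rw [SLOCALAlgorithm.run_concat]
    by_cases h : v = w
    · simp [h]
    · simp [ih, h]

namespace GadgetGraph

open HalfEdgeLabel LabeledGraph

variable {rank : ℕ} {G : GadgetGraph} {u v w : G.V}

/-! ### The simulation -/

open Classical in
/-- The node that simulates the virtual node to which `u` belongs: the root of its octopus gadget
or, if `u` is not in such a gadget, the node `u` itself. -/
noncomputable def rep (G : GadgetGraph) (rank : ℕ) (u : G.V) : G.V :=
  if h : ∃ r, Mem G rank r u then h.choose else u

theorem rep_eq_iff {x : G.V} :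
    rep G rank u = x ↔ Mem G rank x u ∨ ((∀ r, ¬ Mem G rank r u) ∧ u = x) := by
  by_cases h : ∃ r, Mem G rank r u
  · rw [rep, dif_pos h]
    have hs := h.choose_spec
    constructor
    · rintro rfl
      exact .inl hs
    · rintro (hx | ⟨hno, -⟩)
      · exact hs.unique hx
      · exact absurd hs (hno _)
  · rw [rep, dif_neg h]
    push Not at h
    simp [h]

theorem PortMem.rep_eq {r : G.V} {i : ℕ} (h : PortMem G rank r i u) : rep G rank u = r :=
  rep_eq_iff.2 (.inl (.inr ⟨i, h⟩))

/-- The index of the port-gadget to which `u` belongs. -/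
noncomputable def portNumber (G : GadgetGraph) (rank : ℕ) (u : G.V) : Option ℕ :=
  {i | ∃ r, PortMem G rank r i u}.pick

theorem PortMem.portNumber_eq {r : G.V} {i : ℕ} (h : PortMem G rank r i u) :
    portNumber G rank u = some i :=
  Set.pick_eq_some ⟨r, h⟩ fun _ ⟨_, hj⟩ => (hj.unique h).2

theorem portNumber_eq_none (h : G.node u ≠ .port) : portNumber G rank u = none :=
  Set.pick_eq_none fun _ ⟨_, hi⟩ => h hi.node_eq

variable {S Y : Type}

/-- The states of the virtual nodes, as stored in the states of the nodes. -/
noncomputable def virtualState (G : GadgetGraph) (rank : ℕ) (σ : G.V → Option (S × Y))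
    (x : (virtualGraph G rank).net.V) : Option S :=
  {s | ∃ u y, rep G rank u = ofNet G rank x ∧ σ u = some (s, y)}.pick

variable {Γ : Type} (A : SLOCALAlgorithm Color (Finset ℕ) (ℕ → Γ))

/-- The new state of the virtual node of `v` when `v` is processed. -/
noncomputable def nextState (G : GadgetGraph) (rank T : ℕ) (ident : G.V → ℕ)
    (σ : G.V → Option (A.State × Y)) (v : G.V) : A.State :=
  -- A state stored by an earlier node of the gadget is reused; the virtual node is processed only
  -- if there is none.
  (virtualState G rank σ (toNet G rank (rep G rank v))).getD
    (A.step ((virtualGraph G rank).net.view (fun x => ident (ofNet G rank x)) T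
      (virtualState G rank σ) (toNet G rank (rep G rank v))))

/-- The output of `v` when the state of its virtual node is `s`. -/
noncomputable def nodeOutput (G : GadgetGraph) (rank : ℕ) (v : G.V) (s : A.State) :
    LiftOutput Γ :=
  markOutput G rank v ((portNumber G rank v).map (A.output s))

/-! ### Locality of the simulation -/

section Locality

variable {G' : GadgetGraph} {Z : ℕ → G.V → G'.V → Prop} {k : ℕ} {u' v' : G'.V}

theorem not_mem_forth (B : BackForth G G' Z) (h : Z (k + span G) u u')
    (hu : ∀ r, ¬ Mem G rank r u) (r' : G'.V) : ¬ Mem G' rank r' u' := fun h' => by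
  obtain ⟨r, -, hr⟩ := mem_up B.symm (span_eq B ▸ h) h'
  exact hu r hr

theorem rep_up (B : BackForth G G' Z) (h : Z (k + span G) u u') :
    Z k (rep G rank u) (rep G' rank u') := by
  rcases rep_eq_iff.1 (rfl : rep G rank u = rep G rank u) with hr | ⟨hno, e⟩
  · obtain ⟨r', h', hr'⟩ := mem_up B h hr
    rwa [rep_eq_iff.2 (.inl hr')]
  · have : rep G' rank u' = u' := rep_eq_iff.2 (.inr ⟨not_mem_forth B h hno, rfl⟩)
    rw [this, ← e]
    exact B.le h (Nat.le_add_right _ _)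

theorem rep_down (B : BackForth G G' Z) {x : G.V} {x' : G'.V} (h : Z (k + span G) x x')
    (hu : rep G rank u = x) : ∃ u', Z k u u' ∧ rep G' rank u' = x' := by
  rcases rep_eq_iff.1 hu with hr | ⟨hno, rfl⟩
  · obtain ⟨u', h', hr'⟩ := mem_down B h hr
    exact ⟨u', h', rep_eq_iff.2 (.inl hr')⟩
  · exact ⟨x', B.le h (Nat.le_add_right _ _), rep_eq_iff.2 (.inr ⟨not_mem_forth B h hno, rfl⟩)⟩

theorem portNumber_eq (B : BackForth G G' Z) (h : Z (k + span G) u u') :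
    portNumber G rank u = portNumber G' rank u' := by
  unfold portNumber
  congr 1
  ext i
  constructor
  · rintro ⟨r, hr⟩
    obtain ⟨r', -, h'⟩ := portMem_up B h hr
    exact ⟨r', h'⟩
  · rintro ⟨r, hr⟩
    obtain ⟨r', -, h'⟩ := portMem_up B.symm (span_eq B ▸ h) hr
    exact ⟨r', h'⟩

/-- The set of states offered by the nodes with a given representative is the same on both sides, so
`Set.pick` makes the same choice. -/
theorem virtualState_eq (B : BackForth G G' Z) {σ : G.V → Option (S × Y)}
    {σ' : G'.V → Option (S × Y)} (hσ : ∀ {k u u'}, Z k u u' → σ u = σ' u')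
    {x : (virtualGraph G rank).net.V} {x' : (virtualGraph G' rank).net.V}
    (h : NetRel G G' rank Z k x x') : virtualState G rank σ x = virtualState G' rank σ' x' := by
  unfold virtualState
  congr 1
  ext s
  constructor
  · rintro ⟨u, y, hu, hs⟩
    obtain ⟨u', h', hu'⟩ := rep_down B h hu
    exact ⟨u', y, hu', (hσ h').symm.trans hs⟩
  · rintro ⟨u', y, hu', hs⟩
    obtain ⟨u, h', hu⟩ := rep_down (k := span G * k) B.symm (by rw [← span_eq B]; exact h) hu'
    exact ⟨u, y, hu, (hσ h').trans hs⟩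

/-- In units of `span G`: `1 + T` for the virtual view, one for the reserve in `NetRel`, and one for
the way from `v` to its representative. -/
theorem nextState_eq (B : BackForth G G' Z) {T : ℕ} {ident : G.V → ℕ} {ident' : G'.V → ℕ}
    (hi : ident.Injective) (hi' : ident'.Injective)
    (hid : ∀ {k u u'}, Z k u u' → ident u = ident' u')
    {σ : G.V → Option (A.State × Y)} {σ' : G'.V → Option (A.State × Y)}
    (hσ : ∀ {k u u'}, Z k u u' → σ u = σ' u') (h : Z (span G * (T + 3)) v v') :
    nextState A G rank T ident σ v = nextState A G' rank T ident' σ' v' := by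
  have hrep : NetRel G G' rank Z (1 + T) (toNet G rank (rep G rank v))
      (toNet G' rank (rep G' rank v')) := by
    rw [NetRel, ofNet_toNet, ofNet_toNet]
    refine rep_up B ?_
    rwa [show span G * (1 + T) + span G + span G = span G * (T + 3) by ring]
  unfold nextState
  rw [virtualState_eq B hσ hrep]
  congr 2
  exact (backForth_net B).view_eq (hi.comp ofNet_injective) (hi'.comp ofNet_injective)
    (fun h => hid h) (fun h => virtualState_eq B hσ h) hrep

theorem nodeOutput_eq (B : BackForth G G' Z) (h : Z (k + span G) v v') (s : A.State) :
    nodeOutput A G rank v s = nodeOutput A G' rank v' s := by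
  unfold nodeOutput
  rw [portNumber_eq B h, markOutput_eq B h (by unfold span; omega)]

end Locality

/-- The radius of the queries of the simulation. -/
noncomputable def radius (T : ℕ → ℕ) (n : ℕ) : ℕ :=
  (4 * (2 * (Nat.log 2 n + 1) + 2) + 3) * (T n + 3)

/-- A state of a network during the execution of an algorithm. -/
structure Configuration (S : Type) where
  G : GadgetGraph
  ident : G.V → ℕ
  injective : ident.Injective
  σ : G.V → Option S
  v : G.V

noncomputable def Configuration.view (C : Configuration S) (T : ℕ → ℕ) :
    View NodeKind HalfEdgeLabel S :=
  C.G.view C.ident (radius T (Fintype.card C.G.V)) C.σ C.v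

noncomputable def Configuration.next (rank : ℕ) (T : ℕ → ℕ)
    (C : Configuration (A.State × LiftOutput Γ)) : A.State × LiftOutput Γ :=
  let s := nextState A C.G rank (T (Fintype.card C.G.V)) C.ident C.σ C.v
  (s, nodeOutput A C.G rank C.v s)

/-- Equal views induce a back-and-forth system, along which every ingredient of the step is
transported. This makes the step a function of the view alone. -/
theorem Configuration.next_eq {T : ℕ → ℕ} {C C' : Configuration (A.State × LiftOutput Γ)}
    (h : C.view T = C'.view T) : C.next A rank T = C'.next A rank T := by
  obtain ⟨G, ident, hi, σ, v⟩ := C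
  obtain ⟨G', ident', hi', σ', v'⟩ := C'
  simp only [Configuration.view] at h
  have hcard : Fintype.card G.V = Fintype.card G'.V := congrArg View.n h
  rw [← hcard] at h
  have B := backForth_of_view_eq hi hi' h
  have hv := viewRel_center h
  have hr : radius T (Fintype.card G.V) = span G * (T (Fintype.card G.V) + 3) := rfl
  have hs := nextState_eq (rank := rank) (T := T (Fintype.card G.V)) A B hi hi' (fun h => h.1)
    (fun hu => (hu.info_eq hi hi' h).2) (hr ▸ hv)
  have ho := nodeOutput_eq (rank := rank) (k := 0) A B
    (B.le hv (by rw [hr, zero_add]; exact Nat.le_mul_of_pos_right _ (by omega)))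
  simp only [Configuration.next]
  rw [← hcard, hs, ho]

open Classical in
/-- The algorithm for the lifted problem that simulates `A`. -/
noncomputable def liftAlgorithm (rank : ℕ) (T : ℕ → ℕ) :
    SLOCALAlgorithm NodeKind HalfEdgeLabel (LiftOutput Γ) where
  State := A.State × LiftOutput Γ
  step := fun V =>
    -- Any configuration with the observed view will do, as all of them have the same next state.
    if h : ∃ C : Configuration (A.State × LiftOutput Γ), C.view T = V then
      h.choose.next A rank T
    -- A view that no configuration produces is irrelevant; stepping on an empty view merely
    -- supplies an element of `A.State`.
    else (A.step ⟨0, 0, fun _ => none, fun _ _ => none⟩, .error)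
  output := Prod.snd

theorem liftAlgorithm_step (rank : ℕ) (T : ℕ → ℕ)
    (C : Configuration (A.State × LiftOutput Γ)) :
    (liftAlgorithm A rank T).step (C.view T) = C.next A rank T := by
  have h : ∃ C' : Configuration (A.State × LiftOutput Γ), C'.view T = C.view T := ⟨C, rfl⟩
  exact (dif_pos h).trans (Configuration.next_eq A h.choose_spec)

/-- The states of the simulation after the nodes of `order` have been processed correspond to an
execution of the simulated algorithm that processes the virtual nodes in the order of their first
occurrence. -/
theorem simulation (rank : ℕ) (T : ℕ → ℕ) {ident : G.V → ℕ} (hi : ident.Injective)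
    (order : List G.V) (horder : order.Nodup) :
    ∃ vl : List (virtualGraph G rank).net.V, vl.Nodup ∧
      (∀ u ∈ order, toNet G rank (rep G rank u) ∈ vl) ∧
      (∀ x ∈ vl, ∃ u ∈ order, rep G rank u = ofNet G rank x) ∧
      ∀ u ∈ order, ∃ s,
        A.run (virtualGraph G rank).net (fun x => ident (ofNet G rank x))
          (T (Fintype.card G.V)) vl (toNet G rank (rep G rank u)) = some s ∧
        (liftAlgorithm A rank T).run G ident (radius T (Fintype.card G.V)) order u =
          some (s, nodeOutput A G rank u s) := by
  classical
  induction order using List.reverseRecOn with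
  | nil => exact ⟨[], by simp⟩
  | append_singleton order v ih =>
    obtain ⟨vl, hnd, hmem, hrep, hrun⟩ := ih (List.Nodup.of_append_left horder)
    have hv : v ∉ order := fun h =>
      (List.disjoint_of_nodup_append horder) h (List.mem_singleton_self v)
    set L := liftAlgorithm A rank T with hL
    set σ : G.V → Option (A.State × LiftOutput Γ) :=
      L.run G ident (radius T (Fintype.card G.V)) order with hσ
    set identN : (virtualGraph G rank).net.V → ℕ := fun x => ident (ofNet G rank x) with hidN
    set τ := A.run (virtualGraph G rank).net identN (T (Fintype.card G.V)) vl with hτ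
    have hσmem : ∀ {u s}, σ u = some s → u ∈ order := fun {u s} h =>
      (L.run_isSome G ident _ order u).1 (by rw [← hσ, h]; rfl)
    -- All processed nodes of one gadget store the same state, namely the one in the virtual run;
    -- gadgets without processed nodes are exactly the unprocessed virtual nodes.
    have hstate : virtualState G rank σ = τ := by
      funext x
      by_cases hx : x ∈ vl
      · obtain ⟨u, hu, hux⟩ := hrep x hx
        obtain ⟨s, hs, hs'⟩ := hrun u hu
        rw [hux, toNet_ofNet] at hs
        rw [hs]
        refine Set.pick_eq_some ⟨u, _, hux, hs'⟩ ?_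
        rintro t ⟨u', y, hu', ht⟩
        obtain ⟨s', hs1, hs2⟩ := hrun u' (hσmem ht)
        rw [hu', toNet_ofNet, hs] at hs1
        rw [ht] at hs2
        have e1 := Option.some.inj hs1
        have e2 := congrArg Prod.fst (Option.some.inj hs2)
        exact e2.trans e1.symm
      · have hno : τ x = none := by
          rw [← Option.not_isSome_iff_eq_none, hτ, A.run_isSome]
          exact hx
        rw [hno]
        refine Set.pick_eq_none ?_
        rintro t ⟨u', y, hu', ht⟩
        have := hmem u' (hσmem ht)
        rw [hu', toNet_ofNet] at this
        exact hx this
    set x := toNet G rank (rep G rank v) with hx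
    set s := nextState A G rank (T (Fintype.card G.V)) ident σ v with hs
    have hstep : L.step (G.view ident (radius T (Fintype.card G.V)) σ v) =
        (s, nodeOutput A G rank v s) :=
      liftAlgorithm_step A rank T ⟨G, ident, hi, σ, v⟩
    have hsnext : s = (τ x).getD (A.step ((virtualGraph G rank).net.view identN (T (Fintype.card G.V)) τ x)) := by
      rw [hs, nextState, hstate]
    have hold : ∀ u ∈ order, L.run G ident (radius T (Fintype.card G.V)) (order ++ [v]) u = σ u :=
      fun u hu => L.run_append_of_notMem G ident _ order [v] fun h =>
        hv (List.mem_singleton.1 h ▸ hu)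
    have hnew : L.run G ident (radius T (Fintype.card G.V)) (order ++ [v]) v =
        some (s, nodeOutput A G rank v s) := by
      rw [SLOCALAlgorithm.run_concat, Function.update_self, ← hstep]
      rfl
    by_cases hxv : x ∈ vl
    · refine ⟨vl, hnd, ?_, ?_, ?_⟩
      · intro u hu
        rcases List.mem_append.1 hu with hu | hu
        · exact hmem u hu
        · obtain rfl := List.mem_singleton.1 hu
          exact hxv
      · intro y hy
        obtain ⟨u, hu, h⟩ := hrep y hy
        exact ⟨u, List.mem_append_left _ hu, h⟩
      · intro u hu
        rcases List.mem_append.1 hu with hu | hu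
        · rw [hold u hu]
          exact hrun u hu
        · obtain rfl := List.mem_singleton.1 hu
          refine ⟨s, ?_, hnew⟩
          obtain ⟨t, ht⟩ := Option.isSome_iff_exists.1
            ((A.run_isSome (virtualGraph G rank).net identN (T (Fintype.card G.V)) vl x).2 hxv)
          rw [ht, hsnext, show τ x = some t from ht]
          rfl
    · have hnone : τ x = none := by
        rw [← Option.not_isSome_iff_eq_none, hτ, A.run_isSome]
        exact hxv
      -- This is the first visit to the virtual node `x`, so it is processed now.
      refine ⟨vl ++ [x], ?_, ?_, ?_, ?_⟩
      · rw [List.nodup_append]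
        refine ⟨hnd, List.nodup_singleton x, ?_⟩
        rintro a ha b hb rfl
        exact hxv (List.mem_singleton.1 hb ▸ ha)
      · intro u hu
        rcases List.mem_append.1 hu with hu | hu
        · exact List.mem_append_left _ (hmem u hu)
        · obtain rfl := List.mem_singleton.1 hu
          exact List.mem_append_right _ (List.mem_singleton_self _)
      · intro y hy
        rcases List.mem_append.1 hy with hy | hy
        · obtain ⟨u, hu, h⟩ := hrep y hy
          exact ⟨u, List.mem_append_left _ hu, h⟩
        · obtain rfl := List.mem_singleton.1 hy
          exact ⟨v, by simp, (ofNet_toNet _).symm⟩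
      · intro u hu
        rcases List.mem_append.1 hu with hu | hu
        · rw [hold u hu]
          obtain ⟨t, ht, ht'⟩ := hrun u hu
          refine ⟨t, ?_, ht'⟩
          rw [← ht]
          refine A.run_append_of_notMem (virtualGraph G rank).net identN _ vl [x] fun h => hxv ?_
          rw [← List.mem_singleton.1 h]
          exact hmem u hu
        · obtain rfl := List.mem_singleton.1 hu
          refine ⟨s, ?_, hnew⟩
          rw [SLOCALAlgorithm.run_concat, hsnext, hnone]
          exact Function.update_self ..

end GadgetGraph

namespace GadgetGraph

open HalfEdgeLabel LabeledGraph

variable {rank : ℕ} {G : GadgetGraph} {u v w : G.V}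

/-! ### Validity of the simulated outputs -/

theorem mem_edgesAt_iff {b : (virtualGraph G rank).B}
    {e : Σ w : (virtualGraph G rank).W, Fin ((virtualGraph G rank).deg w)} :
    e ∈ (virtualGraph G rank).edgesAt b ↔ ∃ x, Attached G rank e.1.1 e.2 x b.1 := by
  rw [← virtualGraph_nbr_eq_iff]
  simp [IncidenceMultigraph.edgesAt]

/-- The unmarked neighbours of an inter-octopus node correspond to the incident edges of the virtual
black node. -/
theorem map_nbrs_eq_map_edgesAt {α : Type} {b : (virtualGraph G rank).B}
    (hb : ¬ Marked G rank b.1) (f : G.V → α)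
    (g : (Σ w : (virtualGraph G rank).W, Fin ((virtualGraph G rank).deg w)) → α)
    (hfg : ∀ x e, Attached G rank e.1.1 e.2 x b.1 → f x = g e) :
    ((G.keep {v | ¬ Marked G rank v}).nbrs b.1).val.map f =
      ((virtualGraph G rank).edgesAt b).val.map g := by
  refine Finset.map_val_eq_map_val_of_rel
    (fun (x : G.V) e => Attached G rank e.1.1 e.2 x b.1) ?_ ?_ ?_
  · intro x hx
    have ha := LabeledGraph.mem_nbrs.1 hx
    have hx := ha.2.2
    have h := ((constraint_of_not_marked hb).good ha.1).half_of_inter b.2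
    obtain ⟨r, i, hr⟩ := exists_portMem hx h.2.2
    have hat := hr.attached ⟨ha.1.symm, h.2.1⟩
    have hrk : G.node r ≠ .inter := by simp [hat.isRoot.head]
    let e : Σ w : (virtualGraph G rank).W, Fin ((virtualGraph G rank).deg w) :=
      ⟨⟨r, hrk⟩, ⟨i, hat.lt⟩⟩
    exact ⟨e, mem_edgesAt_iff.2 ⟨x, hat⟩, hat, hfg x e hat⟩
  · intro e he
    obtain ⟨x, hx⟩ := mem_edgesAt_iff.1 he
    exact ⟨x, LabeledGraph.mem_nbrs.2 ⟨hx.step.1.symm, hb, hx.not_marked⟩, hx⟩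
  · rintro x x' ⟨⟨r, hr⟩, ⟨i, hi⟩⟩ ⟨⟨r', hr'⟩, ⟨i', hi'⟩⟩ h h'
    constructor
    · rintro rfl
      obtain ⟨e1, e2⟩ := h.portMem.unique h'.portMem
      simp only at e1 e2
      subst e1 e2
      rfl
    · intro e
      rw [← e] at h'
      exact (h.unique h').1

/-- This makes the virtual multigraph an admissible instance of `P`. A marked inter-octopus node has
no virtual edges; at an unmarked one they are counted by its unmarked neighbours, at most `rank`
many. -/
theorem card_edgesAt_le (b : (virtualGraph G rank).B) :
    ((virtualGraph G rank).edgesAt b).card ≤ rank := by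
  by_cases hb : Marked G rank b.1
  · rw [Finset.card_eq_zero.2]
    · exact Nat.zero_le _
    · refine Finset.eq_empty_of_forall_notMem fun e he => ?_
      obtain ⟨x, hx⟩ := mem_edgesAt_iff.1 he
      exact hx.inter_not_marked hb
  · have h := congrArg Multiset.card
      (map_nbrs_eq_map_edgesAt hb (fun _ => ()) (fun _ => ()) fun _ _ _ => rfl)
    have h' := (Multiset.card_map _ _).symm.trans (h.trans (Multiset.card_map _ _))
    exact h'.symm.le.trans <| (Finset.card_le_card (nbrs_keep_subset _ _)).trans
      ((constraint_of_not_marked hb).inter_degree b.2)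

theorem lastPort_of_keep (hu : ¬ Marked G rank u) (hk : G.node u ≠ .inter)
    (h : LastPort (G.keep {v | ¬ Marked G rank v}) u v) : LastPort G u v := by
  rcases h with h | ⟨hno, h⟩
  · exact .inl (keep_step_iff.1 h).1
  · exact .inr ⟨fun h' => hno ((keep_has_of_ne_inter hu hk).2 h'), (keep_step_iff.1 h).1⟩

variable {Γ : Type} {P : LinearizableProblem Γ}

/-- The output for the lifted problem that is obtained from one for the virtual network. -/
noncomputable def liftOutput (G : GadgetGraph) (rank : ℕ)
    (y : (virtualGraph G rank).net.V → ℕ → Γ) (u : G.V) : LiftOutput Γ :=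
  markOutput G rank u ((portNumber G rank u).map (y (toNet G rank (rep G rank u))))

section

variable {y : (virtualGraph G rank).net.V → ℕ → Γ}

theorem label_of_not_marked (hu : ¬ Marked G rank u) : (liftOutput G rank y u).label =
    (portNumber G rank u).map (y (toNet G rank (rep G rank u))) := by
  rw [liftOutput, markOutput_of_not_marked hu]
  rfl

theorem PortMem.label_eq {r : G.V} {i : ℕ} (h : PortMem G rank r i u) :
    (liftOutput G rank y u).label = some (y (toNet G rank r) i) := by
  rw [label_of_not_marked h.not_marked, h.portNumber_eq, h.rep_eq]
  rfl

theorem PortOf.label_eq {r p : G.V} {i : ℕ} {a : Γ} (h : PortOf G rank r i p)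
    (ha : (liftOutput G rank y p).label = some a) : a = y (toNet G rank r) i :=
  (Option.some.inj (h.portMem.label_eq.symm.trans ha)).symm

theorem IsRoot.whiteOk {r : G.V} (h : IsRoot G rank r)
    (hy : ∀ w : (virtualGraph G rank).W,
      P.WhiteOk ((virtualGraph G rank).deg w) (y (Sum.inl w))) :
    P.WhiteOk (portCount G rank r) (y (toNet G rank r)) := by
  have hk : G.node r ≠ .inter := by simp [h.head]
  rw [toNet_of_ne_inter hk]
  exact hy ⟨r, hk⟩

theorem filterMap_label_eq {b : (virtualGraph G rank).B} (hb : ¬ Marked G rank b.1) :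
    ((G.keep {v | ¬ Marked G rank v}).nbrs b.1).val.filterMap
        (fun x => (liftOutput G rank y x).label) =
      ((virtualGraph G rank).edgesAt b).val.map fun e => y (Sum.inl e.1) e.2 := by
  have h : ∀ x (e : Σ w : (virtualGraph G rank).W, Fin ((virtualGraph G rank).deg w)),
      Attached G rank e.1.1 e.2 x b.1 →
      (liftOutput G rank y x).label = some (y (Sum.inl e.1) e.2) := by
    intro x e hx
    rw [hx.portMem.label_eq, toNet_of_ne_inter e.1.2]
    rfl
  have hmap := map_nbrs_eq_map_edgesAt hb (fun x => (liftOutput G rank y x).label)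
    (fun e => some (y (Sum.inl e.1) e.2)) h
  have hmap' := congrArg (Multiset.filterMap id) hmap
  refine (Multiset.filterMap_map _ _ _).symm.trans (hmap'.trans ?_)
  rw [Multiset.filterMap_map, ← Multiset.filterMap_eq_map]
  rfl

/-- At unmarked head nodes the induced subgraph has the same half-edges, so first, last and
consecutive port-gadgets are those of the virtual white node. The rules for heads then follow from
`WhiteOk`, and the rule at inter-octopus nodes from `BlackOk`. -/
theorem promiseRule_liftOutput
    (hw : ∀ w : (virtualGraph G rank).W,
      P.WhiteOk ((virtualGraph G rank).deg w) (y (Sum.inl w)))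
    (hb : ∀ b : (virtualGraph G rank).B,
      P.BlackOk (((virtualGraph G rank).edgesAt b).val.map fun e => y (Sum.inl e.1) e.2))
    (hu : ¬ Marked G rank u) :
    PromiseRule (G.keep {v | ¬ Marked G rank v}) P (fun v => (liftOutput G rank y v).label) u := by
  have hc := constraint_of_not_marked hu
  have step : ∀ {a x z}, (G.keep {v | ¬ Marked G rank v}).Step a x z →
      G.Step a x z ∧ ¬ Marked G rank x ∧ ¬ Marked G rank z := fun h => keep_step_iff.1 h
  have hlast : ∀ {v}, LastPort (G.keep {v | ¬ Marked G rank v}) u v →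
      G.node u = .head ∧ LastPort G u v := by
    intro v hs
    have hk : G.node u = .head := by
      rcases hs with hs | ⟨-, hs⟩
      · exact ((hc.good (step hs).1.1).of_port2 (step hs).1).2.1
      · exact ((hc.good (step hs).1.1).of_port1 (step hs).1).2.1
    exact ⟨hk, lastPort_of_keep hu (by simp [hk]) hs⟩
  exact
    { port_iff := by
        simp only [label_of_not_marked hu, Option.isSome_map]
        constructor
        · intro h
          by_contra hk
          rw [portNumber_eq_none (G := G) hk] at h
          cases h
        · intro hk
          obtain ⟨r, i, hr⟩ := exists_portMem hu hk
          rw [hr.portNumber_eq]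
          rfl
      same_port := fun v ha hk hkv => by
        obtain ⟨r, i, hr⟩ := exists_portMem hu hk
        exact hr.label_eq.trans (hr.of_adj ha.1 hkv).label_eq.symm
      first := fun v a hk hleft hs ha => by
        obtain ⟨r, l, k, hr, hpos⟩ := exists_isRoot hu hk
        rw [keep_has_of_ne_inter hu (by rw [show G.node u = .head from hk]; simp)] at hleft
        have hp := portOf_first hr hpos hleft (step hs).1
        rw [hp.label_eq ha]
        exact ((hr.whiteOk hw).1 hp.lt).1
      last := fun v a hk hright hs ha => by
        obtain ⟨r, l, k, hr, hpos⟩ := exists_isRoot hu hk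
        rw [keep_has_of_ne_inter hu (by rw [show G.node u = .head from hk]; simp)] at hright
        obtain ⟨i, hp, e⟩ := portOf_last hr hpos hright (hlast hs).2
        rw [hp.label_eq ha]
        have := ((hr.whiteOk hw).1 (by omega)).2
        rwa [e, Nat.add_sub_cancel] at this
      pair_same_leaf := fun v w a b hv hw' ha hb' => by
        have hk := ((hc.good hv.1.1).of_port1 (step hv).1).2.1
        obtain ⟨r, l, k, hr, hpos⟩ := exists_isRoot hu hk
        obtain ⟨i, hp, hq⟩ := portOf_pair_same_leaf hr hpos (step hv).1 (step hw').1
        rw [hp.label_eq ha, hq.label_eq hb']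
        exact (hr.whiteOk hw).2 i hq.lt
      pair_next_leaf := fun u' v w a b hu' hv hw' ha hb' => by
        obtain ⟨r, l, k, hr, hpos⟩ := exists_isRoot hu (hlast hv).1
        obtain ⟨i, hp, hq⟩ := portOf_pair_next_leaf hr hpos (step hu').1 (hlast hv).2 (step hw').1
        rw [hp.label_eq ha, hq.label_eq hb']
        exact (hr.whiteOk hw).2 i hq.lt
      black := fun hk => by
        have h := hb (show (virtualGraph G rank).B from ⟨u, hk⟩)
        rw [← filterMap_label_eq (b := (show (virtualGraph G rank).B from ⟨u, hk⟩)) hu] at h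
        exact h }

theorem nodeOutput_eq_liftOutput (A : SLOCALAlgorithm Color (Finset ℕ) (ℕ → Γ)) {s : A.State}
    (h : A.output s = y (toNet G rank (rep G rank u))) :
    nodeOutput A G rank u s = liftOutput G rank y u := by
  rw [liftOutput, ← h, nodeOutput]

theorem lift_valid (y : (virtualGraph G P.rank).net.V → ℕ → Γ)
    (hw : ∀ w : (virtualGraph G P.rank).W,
      P.WhiteOk ((virtualGraph G P.rank).deg w) (y (Sum.inl w)))
    (hb : ∀ b : (virtualGraph G P.rank).B,
      P.BlackOk (((virtualGraph G P.rank).edgesAt b).val.map fun e => y (Sum.inl e.1) e.2)) :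
    (lift P).Valid G (liftOutput G P.rank y) := by
  have hS : {v | (liftOutput G P.rank y v).IsUnmarked} = {v | ¬ Marked G P.rank v} :=
    Set.ext fun v => isUnmarked_markOutput_iff _
  intro u
  refine ⟨badGraphRule_markOutput _ u, fun hu => ?_⟩
  rw [hS]
  exact promiseRule_liftOutput hw hb ((isUnmarked_markOutput_iff _).1 hu)

end

theorem solvable_lift {c : ℕ} {T : ℕ → ℕ} (hP : SolvableInSLOCAL c P.problem T) :
    SolvableInSLOCAL c (lift P) (radius T) := by
  classical
  obtain ⟨A, hA⟩ := hP
  refine ⟨liftAlgorithm A P.rank T, fun (G : GadgetGraph) (ident : G.V → ℕ) hid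
    (order : List G.V) hnd hall => ?_⟩
  obtain ⟨vl, hvl, hmem, -, hrun⟩ := simulation A P.rank T hid.1 order hnd
  -- The virtual nodes that represent nobody, that is, isolated ones from inside octopus gadgets,
  -- are never visited. They are processed last to complete the order, which leaves the earlier
  -- states unchanged.
  set rest := Finset.univ.toList.filter fun x => x ∉ vl with hrest
  have hrest_mem : ∀ x, x ∈ rest ↔ x ∉ vl := fun x => by simp [hrest]
  have hidN : IsIdentifierAssignment c
      (fun x : (virtualGraph G P.rank).net.V => ident (ofNet G P.rank x)) := by
    refine ⟨hid.1.comp ofNet_injective, fun x => ?_⟩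
    rw [card_net]
    exact hid.2 _
  obtain ⟨y, hy, hval⟩ := hA ⟨virtualGraph G P.rank, card_edgesAt_le⟩ _ hidN (vl ++ rest)
    (List.nodup_append.2 ⟨hvl, (Finset.nodup_toList _).filter _, by
      rintro a ha b hb rfl
      exact (hrest_mem a).1 hb ha⟩)
    (fun x => List.mem_append.2 ((Classical.em (x ∈ vl)).imp_right (hrest_mem x).2))
  refine ⟨liftOutput G P.rank y, fun u => ?_, lift_valid y hval.1 hval.2⟩
  obtain ⟨s, hs, hs'⟩ := hrun u (hall u)
  have hyu := hy (toNet G P.rank (rep G P.rank u))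
  have hcard : Fintype.card (P.problem.net ⟨virtualGraph G P.rank, card_edgesAt_le⟩).V =
    Fintype.card G.V := card_net
  rw [hcard] at hyu
  have hsu := (A.run_append_of_notMem (virtualGraph G P.rank).net
    (fun x => ident (ofNet G P.rank x)) (T (Fintype.card G.V)) vl rest
    fun h => (hrest_mem _).1 h (hmem u (hall u))).trans hs
  have hout : A.output s = y (toNet G P.rank (rep G P.rank u)) :=
    Option.some.inj ((congrArg (Option.map A.output) hsu).symm.trans hyu)
  refine (congrArg (Option.map (liftAlgorithm A P.rank T).output) hs').trans ?_
  exact congrArg some (nodeOutput_eq_liftOutput A hout)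

/-! ### Growth of the radius -/

theorem isBigO_radius {T : ℕ → ℕ} (hT : ∀ n, 1 ≤ T n) :
    (fun n : ℕ => (radius T n : ℝ)) =O[atTop] fun n : ℕ => (T n : ℝ) * Real.log n := by
  -- `216 = 27 * 4 * 2`, with factors from the span, from `T n + 3 ≤ 4 * T n` and from the change to
  -- the natural logarithm.
  refine IsBigO.of_bound 216 ?_
  filter_upwards [eventually_ge_atTop 2] with n hn
  have hn' : (2 : ℝ) ≤ n := by exact_mod_cast hn
  have hlog : 0 < Real.log n := Real.log_pos (by linarith)
  have hl1 : 1 ≤ Nat.log 2 n := Nat.log_pos one_lt_two hn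
  have hl2 : (Nat.log 2 n : ℝ) ≤ 2 * Real.log n := by
    have h1 := Real.natLog_le_logb n 2
    have h2 : (1 / 2 : ℝ) < Real.log 2 := by linarith [Real.log_two_gt_d9]
    refine h1.trans ?_
    rw [Real.logb, Nat.cast_ofNat, div_le_iff₀ (by linarith)]
    nlinarith
  have hT1 : (1 : ℝ) ≤ T n := by exact_mod_cast hT n
  have hnat : radius T n ≤ 108 * (T n * Nat.log 2 n) := by
    -- The left side is `8 * Nat.log 2 n + 19`, and `Nat.log 2 n` is at least `1`.
    have h1 : 4 * (2 * (Nat.log 2 n + 1) + 2) + 3 ≤ 27 * Nat.log 2 n := by omega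
    have h2 : T n + 3 ≤ 4 * T n := by have := hT n; omega
    calc radius T n ≤ 27 * Nat.log 2 n * (4 * T n) := Nat.mul_le_mul h1 h2
      _ = 108 * (T n * Nat.log 2 n) := by ring
  have hreal : (radius T n : ℝ) ≤ 108 * (T n * Nat.log 2 n) := by exact_mod_cast hnat
  rw [Real.norm_of_nonneg (Nat.cast_nonneg _), Real.norm_of_nonneg (by positivity)]
  calc (radius T n : ℝ) ≤ 108 * (T n * Nat.log 2 n) := hreal
    _ ≤ 108 * (T n * (2 * Real.log n)) := by gcongr
    _ = 216 * (T n * Real.log n) := by ring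

end GadgetGraph

theorem mainTheorem6 {Γ : Type} [Finite Γ] (P : LinearizableProblem Γ) (c : ℕ) (hc : 1 ≤ c)
    (T : ℕ → ℕ) (hT : ∀ n, 1 ≤ T n) (hP : SolvableInSLOCAL c P.problem T) :
    ∃ T' : ℕ → ℕ, SolvableInSLOCAL c (lift P) T' ∧
      (fun n : ℕ => (T' n : ℝ)) =O[atTop] fun n : ℕ => (T n : ℝ) * Real.log n :=
  ⟨GadgetGraph.radius T, GadgetGraph.solvable_lift hP, GadgetGraph.isBigO_radius hT⟩
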